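/- Let $p>2$ be a prime, $\mathbb F$ an algebraically closed field of characteristic $p$, and $\mathfrak g=\mathfrak{sl}(2,1)$ the Lie superalgebra of supertraceless $3\times 3$ matrices in $\mathfrak{gl}(2,1)$ over $\mathbb F$, with basis $h_1=e_{11}+e_{33}$, $h_2=e_{22}+e_{33}$, $e_{ij}$ ($1\le i\ne j\le 3$). Its even part $\mathfrak g_{\bar 0}$ is restricted by $x^{[p]}=x^p$ (matrix power), and $\mathfrak g=\mathfrak g_{-1}\oplus\mathfrak g_{0}\oplus\mathfrak g_1$ with $\mathfrak g_{-1}=\mathbb Fe_{31}+\mathbb Fe_{32}$, $\mathfrak g_0=\mathfrak g_{\bar 0}$, $\mathfrak g_1=\mathbb Fe_{13}+\mathbb Fe_{23}$. For a linear form $\chi$ on $\mathfrak g_{\bar 0}$, the reduced enveloping algebra $u(\mathfrak g,\chi)$ is the quotient of $U(\mathfrak g)$ by the ideal generated by all $x^p-x^{[p]}-\chi(x)^p$, $x\in\mathfrak g_{\bar 0}$; define $u(\mathfrak g_0,\chi)$ and $u(\mathfrak g_0\oplus\mathfrak g_1,\chi)$ likewise. Let $\chi$ be a linear form on $\mathfrak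 g_{\bar 0}$ with $\chi(e_{12})=0$ and let $\lambda=(\lambda_1,\lambda_2)\in\mathbb F^2$ satisfy $\lambda_i^p-\lambda_i=\chi(h_i)^p$ for $i=1,2$. Let $M(\lambda)$ be the simple $u(\mathfrak g_0,\chi)$-module generated by a maximal vector $v_0$ of weight $\lambda$ (that is, $e_{12}v_0=0$, $h_iv_0=\lambda_iv_0$), with $\mathfrak g_1$ acting by zero, let $Z^\chi(\lambda)=u(\mathfrak g,\chi)\otimes_{u(\mathfrak g_0\oplus\mathfrak g_1,\chi)}M(\lambda)$ be the $\chi$-reduced Kac module, $\mathbb Z_2$-graded with $v_0$ even, and let $S^\chi(\lambda)$ be its unique simple quotient. Write $\langle i,j,k\rangle$ for the class of $e_{31}^ie_{32}^je_{21}^kv_0$ in $S^\chi(\lambda)$. For a $\mathfrak g$-module $V$ (a superspace), a derivation of parity $|\varphi|$ is a homogeneous linear map $\varphi:\mathfrak g\to V$ with $\varphi([x,y])=(-1)^{|\varphi||x|}x\varphi(y)-(-1)^{|y|(|\varphi|+|x|)}y\varphi(x)$ for homogeneous $x,y$; $\mathrm{Der}(\mathfrak g,V)$ is the span of these, $\mathrm{Ider}(\mathfrak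 g,V)$ is the span of the maps $x\mapsto(-1)^{|x||m|}xm$ with $m\in V$ homogeneous, and $H^1(\mathfrak g,V)=\mathrm{Der}(\mathfrak g,V)/\mathrm{Ider}(\mathfrak g,V)$. **Theorem.** One has $$\dim_{\mathbb F} H^1(\mathfrak g,S^\chi(\lambda))=\begin{cases}1,&\text{if }\chi=0\text{ and }\lambda=(p-1,p-1)\text{ or }(1,0),\\ 2,&\text{if }\chi=0\text{ and }\lambda=(p-1,0)\text{ or }(p-1,1),\\ 0,&\text{otherwise.}\end{cases}$$ Moreover, for $\chi=0$, the space $H^1(\mathfrak g,S^0(\lambda))$ is spanned by the classes of the following derivations (each is zero on the basis elements of $\mathfrak g$ that are not listed): - $\lambda=(p-1,p-1)$: $\psi_3$, with $\psi_3(e_{13})=-\langle0,1,0\rangle$, $\psi_3(e_{23})=\langle1,0,0\rangle$; - $\lambda=(p-1,0)$: $\psi_4$ and $\psi_5$, with $\psi_4(h_1)=-\langle1,0,p-1\rangle$, $\psi_4(e_{12})=\langle1,0,p-2\rangle$, $\psi_4(e_{13})=\langle0,0,p-1\rangle$, and $\psi_5(e_{23})=\langle0,0,0\rangle$, $\psi_5(e_{21})=-\langle1,0,0\rangle$;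 - $\lambda=(p-1,1)$: $\psi_6$ and $\psi_7$, with $\psi_6(e_{12})=\langle0,0,p-2\rangle$, $\psi_6(e_{32})=\langle1,0,p-2\rangle$, and $\psi_7(e_{21})=\langle0,0,0\rangle$, $\psi_7(e_{31})=\langle0,1,0\rangle$; - $\lambda=(1,0)$: $\psi_8$, with $\psi_8(e_{32})=\langle0,0,0\rangle$, $\psi_8(e_{31})=-\langle0,0,1\rangle$. -/

import Mathlib

open scoped TensorProduct

noncomputable section

namespace SL21

universe u v

/-! ### The Lie superalgebra `sl(2,1)` -/

/-- The sign `(-1)^{ij}` of two parities. -/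
def sgn (F : Type u) [Field F] (i j : ZMod 2) : F := (-1) ^ (i.val * j.val)

/-- The parities of the three basis vectors of the superspace `F^{2|1}`. -/
def idxParity : Fin 3 → ZMod 2 := ![0, 0, 1]

/-- A `3 × 3` matrix is homogeneous of parity `i` in `gl(2,1)` if all its nonzero entries are in
positions of parity `i`. -/
def IsHomog {F : Type u} [Field F] (i : ZMod 2) (x : Matrix (Fin 3) (Fin 3) F) : Prop :=
  ∀ a b, idxParity a + idxParity b ≠ i → x a b = 0

/-- The bracket `[x, y] = xy - (-1)^{ij} yx` of `gl(2,1)`, on elements `x`, `y` of parities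
`i`, `j`. -/
def superBracket {F : Type u} [Field F] (i j : ZMod 2) (x y : Matrix (Fin 3) (Fin 3) F) :
    Matrix (Fin 3) (Fin 3) F :=
  x * y - sgn F i j • (y * x)

/-- `𝔤 = sl(2,1)`: the matrices of supertrace zero. -/
def sl21 (F : Type u) [Field F] : Submodule F (Matrix (Fin 3) (Fin 3) F) where
  carrier := {x | x 0 0 + x 1 1 - x 2 2 = 0}
  zero_mem' := by simp
  add_mem' := by
    intro x y hx hy
    simp only [Set.mem_ofPred_eq, Matrix.add_apply] at *
    linear_combination hx + hy
  smul_mem' := by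
    intro c x hx
    simp only [Set.mem_ofPred_eq, Matrix.smul_apply, smul_eq_mul] at *
    linear_combination c * hx

/-- The even part `𝔤₀` of `sl(2,1)`. -/
def evenPart (F : Type u) [Field F] : Submodule F (Matrix (Fin 3) (Fin 3) F) where
  carrier := {x | x ∈ sl21 F ∧ IsHomog 0 x}
  zero_mem' := ⟨zero_mem _, fun _ _ _ => rfl⟩
  add_mem' := by
    intro x y hx hy
    exact ⟨add_mem hx.1 hy.1, fun a b h => by simp [hx.2 a b h, hy.2 a b h]⟩
  smul_mem' := by
    intro c x hx
    exact ⟨Submodule.smul_mem _ c hx.1, fun a b h => by simp [hx.2 a b h]⟩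

/-- `h₁ = e₁₁ + e₃₃` as an element of `𝔤₀`. (Indices start at `0` in the code.) -/
def h1 (F : Type u) [Field F] : evenPart F :=
  ⟨Matrix.single 0 0 1 + Matrix.single 2 2 1, by
    refine ⟨by simp [sl21], ?_⟩
    intro a b; fin_cases a <;> fin_cases b <;> (simp [idxParity]; try decide)⟩

/-- `h₂ = e₂₂ + e₃₃` as an element of `𝔤₀`. -/
def h2 (F : Type u) [Field F] : evenPart F :=
  ⟨Matrix.single 1 1 1 + Matrix.single 2 2 1, by
    refine ⟨by simp [sl21], ?_⟩
    intro a b; fin_cases a <;> fin_cases b <;> (simp [idxParity]; try decide)⟩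

/-- `e₁₂` as an element of `𝔤₀`. -/
def e12 (F : Type u) [Field F] : evenPart F :=
  ⟨Matrix.single 0 1 1, by
    refine ⟨by simp [sl21], ?_⟩
    intro a b; fin_cases a <;> fin_cases b <;> simp [idxParity]⟩

/-- `e₂₁` as an element of `𝔤`. -/
def e21 (F : Type u) [Field F] : sl21 F :=
  ⟨Matrix.single 1 0 1, by simp [sl21]⟩

/-- `e₃₁` as an element of `𝔤`. -/
def e31 (F : Type u) [Field F] : sl21 F :=
  ⟨Matrix.single 2 0 1, by simp [sl21]⟩

/-- `e₃₂` as an element of `𝔤`. -/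
def e32 (F : Type u) [Field F] : sl21 F :=
  ⟨Matrix.single 2 1 1, by simp [sl21]⟩

/-- `e₁₃` as an element of `𝔤`. -/
def e13 (F : Type u) [Field F] : sl21 F :=
  ⟨Matrix.single 0 2 1, by simp [sl21]⟩

/-- `e₂₃` as an element of `𝔤`. -/
def e23 (F : Type u) [Field F] : sl21 F :=
  ⟨Matrix.single 1 2 1, by simp [sl21]⟩

/-! ### Reduced enveloping algebras -/

/-- The defining relations of the `χ`-reduced enveloping algebra of a graded subalgebra `L` of
`gl(2,1)`: `xy - (-1)^{|x||y|} yx = [x, y]` for homogeneous `x`, `y`, and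
`x^p - x^{[p]} = χ(x)^p` for `x` even, where `x^{[p]}` is the `p`-th power of the matrix `x`. -/
inductive EnvRel (p : ℕ) {F : Type u} [Field F] (L : Submodule F (Matrix (Fin 3) (Fin 3) F))
    (χ : Module.Dual F (evenPart F)) : TensorAlgebra F L → TensorAlgebra F L → Prop
  | bracket (i j : ZMod 2) (x y z : L) (hx : IsHomog i (x : Matrix (Fin 3) (Fin 3) F))
      (hy : IsHomog j (y : Matrix (Fin 3) (Fin 3) F))
      (hz : (z : Matrix (Fin 3) (Fin 3) F) = superBracket i j x y) :
      EnvRel p L χ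
        (TensorAlgebra.ι F x * TensorAlgebra.ι F y
          - sgn F i j • (TensorAlgebra.ι F y * TensorAlgebra.ι F x))
        (TensorAlgebra.ι F z)
  | pPower (w : evenPart F) (x z : L)
      (hx : (x : Matrix (Fin 3) (Fin 3) F) = w)
      (hz : (z : Matrix (Fin 3) (Fin 3) F) = (w : Matrix (Fin 3) (Fin 3) F) ^ p) :
      EnvRel p L χ
        (TensorAlgebra.ι F x ^ p - TensorAlgebra.ι F z)
        (algebraMap F (TensorAlgebra F L) (χ w ^ p))

/-- The `χ`-reduced enveloping algebra `u(L, χ)`. -/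
def Env (p : ℕ) {F : Type u} [Field F] (L : Submodule F (Matrix (Fin 3) (Fin 3) F))
    (χ : Module.Dual F (evenPart F)) : Type u :=
  RingQuot (EnvRel p L χ)

instance (p : ℕ) {F : Type u} [Field F] (L : Submodule F (Matrix (Fin 3) (Fin 3) F))
    (χ : Module.Dual F (evenPart F)) : Ring (Env p L χ) :=
  inferInstanceAs (Ring (RingQuot (EnvRel p L χ)))

instance (p : ℕ) {F : Type u} [Field F] (L : Submodule F (Matrix (Fin 3) (Fin 3) F))
    (χ : Module.Dual F (evenPart F)) : Algebra F (Env p L χ) :=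
  inferInstanceAs (Algebra F (RingQuot (EnvRel p L χ)))

/-- The quotient map from the tensor algebra onto `u(L, χ)`. -/
def Env.ofTensor (p : ℕ) {F : Type u} [Field F] (L : Submodule F (Matrix (Fin 3) (Fin 3) F))
    (χ : Module.Dual F (evenPart F)) : TensorAlgebra F L →ₐ[F] Env p L χ :=
  RingQuot.mkAlgHom F (EnvRel p L χ)

/-- The canonical map `L → u(L, χ)`. -/
def ι (p : ℕ) {F : Type u} [Field F] (L : Submodule F (Matrix (Fin 3) (Fin 3) F))
    (χ : Module.Dual F (evenPart F)) : L →ₗ[F] Env p L χ :=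
  (Env.ofTensor p L χ).toLinearMap ∘ₗ TensorAlgebra.ι F

/-- The sum of all proper submodules of a module. It is the largest proper submodule if the module
has a unique simple quotient. -/
def sumProper (A : Type u) [Ring A] (M : Type v) [AddCommGroup M] [Module A M] : Submodule A M :=
  sSup {W : Submodule A M | W ≠ ⊤}

/-! ### The simple modules `M(λ)` of `u(𝔤₀, χ)` -/

/-- The universal `u(𝔤₀, χ)`-module generated by a maximal vector of weight `λ`, that is, a vector
`v` with `e₁₂ v = 0`, `h₁ v = λ₁ v`, `h₂ v = λ₂ v`. -/
abbrev BabyVerma (p : ℕ) {F : Type u} [Field F] (χ : Module.Dual F (evenPart F)) (l : F × F) :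
    Type u :=
  Env p (evenPart F) χ ⧸
    (Submodule.span (Env p (evenPart F) χ)
      {ι p (evenPart F) χ (e12 F),
        ι p (evenPart F) χ (h1 F) - algebraMap F _ l.1,
        ι p (evenPart F) χ (h2 F) - algebraMap F _ l.2})

/-- `M(λ)`: the simple `u(𝔤₀, χ)`-module generated by a maximal vector of weight `λ`. -/
abbrev EvenSimple (p : ℕ) {F : Type u} [Field F] (χ : Module.Dual F (evenPart F)) (l : F × F) :
    Type u :=
  BabyVerma p χ l ⧸ sumProper (Env p (evenPart F) χ) (BabyVerma p χ l)

/-- The maximal vector `v₀` of `M(λ)`. -/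
def evenVec (p : ℕ) {F : Type u} [Field F] (χ : Module.Dual F (evenPart F)) (l : F × F) :
    EvenSimple p χ l :=
  Submodule.Quotient.mk (Submodule.Quotient.mk 1)

/-! ### The `χ`-reduced Kac module and its simple quotient -/

/-- The relations that turn `u(𝔤, χ) ⊗_F M(λ)` into `u(𝔤, χ) ⊗_{u(𝔤₀ ⊕ 𝔤₁, χ)} M(λ)`, where
`𝔤₁ = F e₁₃ + F e₂₃` acts by zero on `M(λ)`; the algebra `u(𝔤₀ ⊕ 𝔤₁, χ)` is generated by
`𝔤₀` and `𝔤₁`. -/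
def kacRel (p : ℕ) {F : Type u} [Field F] (χ : Module.Dual F (evenPart F)) (l : F × F) :
    Submodule (Env p (sl21 F) χ) (Env p (sl21 F) χ ⊗[F] EvenSimple p χ l) :=
  Submodule.span (Env p (sl21 F) χ)
    ({t | ∃ (a : Env p (sl21 F) χ) (x : sl21 F) (x₀ : evenPart F) (m : EvenSimple p χ l),
        (x : Matrix (Fin 3) (Fin 3) F) = x₀ ∧
        t = (a * ι p (sl21 F) χ x) ⊗ₜ[F] m - a ⊗ₜ[F] (ι p (evenPart F) χ x₀ • m)} ∪
      {t | ∃ (a : Env p (sl21 F) χ) (m : EvenSimple p χ l),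
        t = (a * ι p (sl21 F) χ (e13 F)) ⊗ₜ[F] m ∨ t = (a * ι p (sl21 F) χ (e23 F)) ⊗ₜ[F] m})

/-- The `χ`-reduced Kac module `Z^χ(λ)`. -/
abbrev Kac (p : ℕ) {F : Type u} [Field F] (χ : Module.Dual F (evenPart F)) (l : F × F) : Type u :=
  (Env p (sl21 F) χ ⊗[F] EvenSimple p χ l) ⧸ kacRel p χ l

/-- `S^χ(λ)`: the unique simple quotient of `Z^χ(λ)`. (All submodules of `Z^χ(λ)` are graded, since
`h₁ + h₂` acts on its parts of `ℤ`-degree `0`, `-1`, `-2` by the different scalars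
`λ₁ + λ₂`, `λ₁ + λ₂ + 1`, `λ₁ + λ₂ + 2`.) -/
abbrev Simple (p : ℕ) {F : Type u} [Field F] (χ : Module.Dual F (evenPart F)) (l : F × F) :
    Type u :=
  Kac p χ l ⧸ sumProper (Env p (sl21 F) χ) (Kac p χ l)

/-- The class of `1 ⊗ v₀` in `S^χ(λ)`. -/
def simpleVec (p : ℕ) {F : Type u} [Field F] (χ : Module.Dual F (evenPart F)) (l : F × F) :
    Simple p χ l :=
  Submodule.Quotient.mk (Submodule.Quotient.mk (1 ⊗ₜ[F] evenVec p χ l))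

/-- The action of `𝔤` on `S^χ(λ)`. -/
def simpleAction (p : ℕ) {F : Type u} [Field F] (χ : Module.Dual F (evenPart F)) (l : F × F) :
    sl21 F →ₗ[F] Module.End F (Simple p χ l) :=
  (Algebra.lsmul F F (Simple p χ l)).toLinearMap ∘ₗ ι p (sl21 F) χ

/-- Products of homogeneous elements of `𝔤` in `u(𝔤, χ)`, with their parities. -/
inductive IsMonomial (p : ℕ) {F : Type u} [Field F] (χ : Module.Dual F (evenPart F)) :
    ZMod 2 → Env p (sl21 F) χ → Prop
  | one : IsMonomial p χ 0 1
  | mul (i j : ZMod 2) (x : sl21 F) (a : Env p (sl21 F) χ)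
      (hx : IsHomog i (x : Matrix (Fin 3) (Fin 3) F)) (ha : IsMonomial p χ j a) :
      IsMonomial p χ (i + j) (ι p (sl21 F) χ x * a)

/-- The `ℤ₂`-grading of `S^χ(λ)`: its part of parity `i` is `u(𝔤, χ)_i v₀` (so `v₀` is even). -/
def simpleGrading (p : ℕ) {F : Type u} [Field F] (χ : Module.Dual F (evenPart F)) (l : F × F)
    (i : ZMod 2) : Submodule F (Simple p χ l) :=
  Submodule.span F {s | ∃ a, IsMonomial p χ i a ∧ s = a • simpleVec p χ l}

/-! ### The first cohomology -/

/-- `φ` is a derivation of parity `k` from `𝔤` to the superspace `V = V₀ ⊕ V₁`, on which `𝔤` acts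
by `ρ`. -/
def IsDerivation {F : Type u} [Field F] {V : Type v} [AddCommGroup V] [Module F V]
    (ρ : sl21 F →ₗ[F] Module.End F V) (gr : ZMod 2 → Submodule F V) (k : ZMod 2)
    (φ : sl21 F →ₗ[F] V) : Prop :=
  (∀ (i : ZMod 2) (x : sl21 F), IsHomog i (x : Matrix (Fin 3) (Fin 3) F) → φ x ∈ gr (k + i)) ∧
  ∀ (i j : ZMod 2) (x y z : sl21 F),
    IsHomog i (x : Matrix (Fin 3) (Fin 3) F) → IsHomog j (y : Matrix (Fin 3) (Fin 3) F) →
    (z : Matrix (Fin 3) (Fin 3) F) = superBracket i j x y →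
    φ z = sgn F k i • ρ x (φ y) - sgn F j (k + i) • ρ y (φ x)

/-- `Der(𝔤, V)`: the span of the homogeneous derivations. -/
def Der {F : Type u} [Field F] {V : Type v} [AddCommGroup V] [Module F V]
    (ρ : sl21 F →ₗ[F] Module.End F V) (gr : ZMod 2 → Submodule F V) :
    Submodule F (sl21 F →ₗ[F] V) :=
  Submodule.span F {φ | ∃ k, IsDerivation ρ gr k φ}

/-- `Ider(𝔤, V)`: the span of the inner derivations `𝔇_m(x) = (-1)^{|x||m|} x m`, for `m`
homogeneous. -/
def Ider {F : Type u} [Field F] {V : Type v} [AddCommGroup V] [Module F V]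
    (ρ : sl21 F →ₗ[F] Module.End F V) (gr : ZMod 2 → Submodule F V) :
    Submodule F (sl21 F →ₗ[F] V) :=
  Submodule.span F {φ | ∃ (k : ZMod 2) (m : V), m ∈ gr k ∧ ∀ (i : ZMod 2) (x : sl21 F),
    IsHomog i (x : Matrix (Fin 3) (Fin 3) F) → φ x = sgn F i k • ρ x m}

/-- `H¹(𝔤, V) = Der(𝔤, V) / Ider(𝔤, V)`. -/
abbrev H1 {F : Type u} [Field F] {V : Type v} [AddCommGroup V] [Module F V]
    (ρ : sl21 F →ₗ[F] Module.End F V) (gr : ZMod 2 → Submodule F V) : Type (max u v) :=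
  Der ρ gr ⧸ (Ider ρ gr).submoduleOf (Der ρ gr)

/-! ### Explicit cochains -/

/-- The linear map `𝔤 → V` with given values on the basis `h₁, h₂, e_ij (i ≠ j)` of `𝔤`: the
entry of `f` in position `(i, j)` is the value on `e_ij`, and the first two diagonal entries are the
values on `h₁`, `h₂`. The last diagonal entry does not belong to a basis element; it is ignored. -/
def cochain {F : Type u} [Field F] {V : Type v} [AddCommGroup V] [Module F V]
    (f : Matrix (Fin 3) (Fin 3) V) : sl21 F →ₗ[F] V where
  toFun x := x.1 0 0 • f 0 0 + x.1 1 1 • f 1 1 + x.1 0 1 • f 0 1 + x.1 0 2 • f 0 2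
    + x.1 1 0 • f 1 0 + x.1 1 2 • f 1 2 + x.1 2 0 • f 2 0 + x.1 2 1 • f 2 1
  map_add' := by
    intro x y
    simp only [Submodule.coe_add, Matrix.add_apply, add_smul]
    abel
  map_smul' := by
    intro c x
    simp only [Submodule.coe_smul, Matrix.smul_apply, smul_eq_mul, mul_smul, smul_add,
      RingHom.id_apply]

/-- `⟨i, j, k⟩ = e₃₁^i e₃₂^j e₂₁^k v₀` in `S^χ(λ)`. -/
def bra (p : ℕ) {F : Type u} [Field F] (χ : Module.Dual F (evenPart F)) (l : F × F)
    (i j k : ℕ) : Simple p χ l :=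
  (ι p (sl21 F) χ (e31 F) ^ i * ι p (sl21 F) χ (e32 F) ^ j * ι p (sl21 F) χ (e21 F) ^ k) •
    simpleVec p χ l

/-- `e₁₃ ↦ -⟨0,1,0⟩`, `e₂₃ ↦ ⟨1,0,0⟩`. -/
def psi3 (p : ℕ) {F : Type u} [Field F] (χ : Module.Dual F (evenPart F)) (l : F × F) :
    sl21 F →ₗ[F] Simple p χ l :=
  cochain !![0, 0, -bra p χ l 0 1 0; 0, 0, bra p χ l 1 0 0; 0, 0, 0]

/-- `h₁ ↦ -⟨1,0,p-1⟩`, `e₁₂ ↦ ⟨1,0,p-2⟩`, `e₁₃ ↦ ⟨0,0,p-1⟩`. -/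
def psi4 (p : ℕ) {F : Type u} [Field F] (χ : Module.Dual F (evenPart F)) (l : F × F) :
    sl21 F →ₗ[F] Simple p χ l :=
  cochain !![-bra p χ l 1 0 (p - 1), bra p χ l 1 0 (p - 2), bra p χ l 0 0 (p - 1);
    0, 0, 0; 0, 0, 0]

/-- `e₂₃ ↦ ⟨0,0,0⟩`, `e₂₁ ↦ -⟨1,0,0⟩`. -/
def psi5 (p : ℕ) {F : Type u} [Field F] (χ : Module.Dual F (evenPart F)) (l : F × F) :
    sl21 F →ₗ[F] Simple p χ l :=
  cochain !![0, 0, 0; -bra p χ l 1 0 0, 0, bra p χ l 0 0 0; 0, 0, 0]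

/-- `e₁₂ ↦ ⟨0,0,p-2⟩`, `e₃₂ ↦ ⟨1,0,p-2⟩`. -/
def psi6 (p : ℕ) {F : Type u} [Field F] (χ : Module.Dual F (evenPart F)) (l : F × F) :
    sl21 F →ₗ[F] Simple p χ l :=
  cochain !![0, bra p χ l 0 0 (p - 2), 0; 0, 0, 0; 0, bra p χ l 1 0 (p - 2), 0]

/-- `e₂₁ ↦ ⟨0,0,0⟩`, `e₃₁ ↦ ⟨0,1,0⟩`. -/
def psi7 (p : ℕ) {F : Type u} [Field F] (χ : Module.Dual F (evenPart F)) (l : F × F) :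
    sl21 F →ₗ[F] Simple p χ l :=
  cochain !![0, 0, 0; bra p χ l 0 0 0, 0, 0; bra p χ l 0 1 0, 0, 0]

/-- `e₃₂ ↦ ⟨0,0,0⟩`, `e₃₁ ↦ -⟨0,0,1⟩`. -/
def psi8 (p : ℕ) {F : Type u} [Field F] (χ : Module.Dual F (evenPart F)) (l : F × F) :
    sl21 F →ₗ[F] Simple p χ l :=
  cochain !![0, 0, 0; 0, 0, 0; -bra p χ l 0 0 1, bra p χ l 0 0 0, 0]

/-- `Der(𝔤, S^χ(λ))`. -/
abbrev simpleDer (p : ℕ) {F : Type u} [Field F] (χ : Module.Dual F (evenPart F)) (l : F × F) :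
    Submodule F (sl21 F →ₗ[F] Simple p χ l) :=
  Der (simpleAction p χ l) (simpleGrading p χ l)

/-- `Ider(𝔤, S^χ(λ))`. -/
abbrev simpleIder (p : ℕ) {F : Type u} [Field F] (χ : Module.Dual F (evenPart F)) (l : F × F) :
    Submodule F (sl21 F →ₗ[F] Simple p χ l) :=
  Ider (simpleAction p χ l) (simpleGrading p χ l)

/-- `H¹(𝔤, S^χ(λ))`. -/
abbrev simpleH1 (p : ℕ) {F : Type u} [Field F] (χ : Module.Dual F (evenPart F)) (l : F × F) :
    Type u :=
  H1 (simpleAction p χ l) (simpleGrading p χ l)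

end SL21

end

/-!
A homogeneous derivation `φ` of parity `k`, multiplied by the sign `(-1)^{k|x|}`, is an ordinary
cocycle `ψ`, which is the same as an extension of the trivial module `F` by `V` (`extRep`). A central
element of the enveloping algebra that acts on `V` by a scalar `c` and kills `F` maps the added
vector to some `m ∈ V` with `x m = c ψ(x)` for all `x` (`rep_eq_smul_of_central`). Hence all
derivations are inner as soon as `c ≠ 0` for one such element (`Der_le_Ider_of_central`): for `χ ≠ 0`
one of `h₁^p - h₁`, `h₂^p - h₂`, `e₂₁^p` will do, as they act by `p`-th powers of values of `χ`, and
the Casimir element acts by `λ₂ (λ₁ + 1)`. There remain `χ = 0` and the atypical weights, those with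
`λ₂ (λ₁ + 1) = 0`.

For `χ = 0` it has to be known that the modules, defined by generators and relations, do not
collapse. A maximal vector of any admissible weight occurs among the polynomials in three variables,
a restricted `𝔤₀`-module because `p`-th powers of derivations are derivations
(`babyVerma_mk_one_ne_zero`). The Kac module maps to the explicit module `Λ(𝔤₋₁) ⊗ M(λ)`
(`EvenAction.induced`, `kacVec_ne_zero`), and a polynomial in the torus, which projects onto the line
of the maximal vector (`Action.proj`), shows that this vector lies in no proper submodule. So
`S(λ)` is a nonzero simple highest weight module (`isSimpleHighestWeight_of_simple`).

Let `λ` be atypical. Then `S(λ)` lives in the degrees `0` and `-1` only; its part of degree `0` is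
spanned by the `e₂₁^k v₀`, and a vector of degree `-1` is determined by its images under `e₁₃` and
`e₂₃` (`Action.IsAtypical.degOne_ext`). If `S(λ)` is not trivial, it has no invariants, so the
argument with `h₁^p - h₁` and `h₂^p - h₂`, now for `c = 0`, lets a cocycle be changed by an inner one
so that it vanishes on the torus (`exists_eq_on_torus`). The values on the six root vectors are then
weight vectors of the weight of their argument, subject to one linear equation for each bracket
(`IsTorusCocycle`). Since `h₁ + h₂` has only the eigenvalues `λ₁ + λ₂` and `λ₁ + λ₂ + 1`, these
equations have few solutions. For `λ₁ + λ₂ ≠ 0, -1` the values at `e₁₂` and `e₂₁` vanish, and a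
nonzero solution yields a singular vector of weight `(-1, -1)` or `(1, 0)`, hence `ψ₃` or `ψ₈`. The
case `λ₁ + λ₂ = 0` consists of the trivial module, where `H¹ = 0` as `𝔤` is perfect, and of
`λ = (-1, 1)`, with `ψ₆` and `ψ₇`; the case `λ₁ + λ₂ = -1` is `λ = (-1, 0)`, with `ψ₄` and `ψ₅`.

At the four exceptional weights `0` is not a weight of `S(λ)`, so that an inner derivation which
vanishes on the torus is zero (`eq_zero_of_mem_Ider`) and the `ψᵢ` stay independent modulo inner
derivations (`Action.IsAtypical.Der_eq_Ider_sup_span`). A weight argument also shows that the even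
and the odd part of `S(λ)` meet in zero (`disjoint_generatedGrading`), so that the parity of each
`ψᵢ` is determined.
-/

open scoped TensorProduct

noncomputable section

namespace SL21

universe u v w

/-! ### Representations of `𝔤` as eight operators -/

/-- The inclusion of the even part into `𝔤`. -/
def evenIncl (F : Type u) [Field F] : evenPart F →ₗ[F] sl21 F where
  toFun w := ⟨w.1, w.2.1⟩
  map_add' _ _ := rfl
  map_smul' _ _ := rfl

/-- `e₂₁` as an element of `𝔤₀`. -/
def e21₀ (F : Type u) [Field F] : evenPart F :=
  ⟨Matrix.single 1 0 1, by
    refine ⟨by simp [sl21], ?_⟩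
    intro a b; fin_cases a <;> fin_cases b <;> simp [idxParity]⟩

section Homog

variable {F : Type u} [Field F]

theorem isHomog_of_mem_evenPart (w : evenPart F) :
    IsHomog 0 (w : Matrix (Fin 3) (Fin 3) F) := w.2.2

theorem isHomog_evenIncl (w : evenPart F) :
    IsHomog 0 (evenIncl F w : Matrix (Fin 3) (Fin 3) F) := w.2.2

theorem isHomog_e21 : IsHomog 0 (e21 F : Matrix (Fin 3) (Fin 3) F) :=
  isHomog_of_mem_evenPart (e21₀ F)

theorem isHomog_e31 : IsHomog 1 (e31 F : Matrix (Fin 3) (Fin 3) F) := by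
  intro a b; fin_cases a <;> fin_cases b <;> simp [e31, idxParity]

theorem isHomog_e32 : IsHomog 1 (e32 F : Matrix (Fin 3) (Fin 3) F) := by
  intro a b; fin_cases a <;> fin_cases b <;> simp [e32, idxParity]

theorem isHomog_e13 : IsHomog 1 (e13 F : Matrix (Fin 3) (Fin 3) F) := by
  intro a b; fin_cases a <;> fin_cases b <;> simp [e13, idxParity]

theorem isHomog_e23 : IsHomog 1 (e23 F : Matrix (Fin 3) (Fin 3) F) := by
  intro a b; fin_cases a <;> fin_cases b <;> simp [e23, idxParity]

@[simp] theorem sgn_zero_left (j : ZMod 2) : sgn F 0 j = 1 := by simp [sgn]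

@[simp] theorem sgn_zero_right (i : ZMod 2) : sgn F i 0 = 1 := by simp [sgn]

@[simp] theorem sgn_one_one : sgn F 1 1 = -1 := by simp [sgn, ZMod.val_one]

theorem parity_cases (i : ZMod 2) : i = 0 ∨ i = 1 := by decide +revert

theorem entries_of_even {x : Matrix (Fin 3) (Fin 3) F} (hx : IsHomog 0 x) :
    x 0 2 = 0 ∧ x 1 2 = 0 ∧ x 2 0 = 0 ∧ x 2 1 = 0 :=
  ⟨hx _ _ (by simp [idxParity]), hx _ _ (by simp [idxParity]), hx _ _ (by simp [idxParity]),
    hx _ _ (by simp [idxParity])⟩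

theorem entries_of_odd {x : Matrix (Fin 3) (Fin 3) F} (hx : IsHomog 1 x) :
    x 0 0 = 0 ∧ x 0 1 = 0 ∧ x 1 0 = 0 ∧ x 1 1 = 0 ∧ x 2 2 = 0 := by
  refine ⟨hx _ _ ?_, hx _ _ ?_, hx _ _ ?_, hx _ _ ?_, hx _ _ ?_⟩ <;> simp [idxParity]

theorem supertrace_eq (x : sl21 F) : x.1 2 2 = x.1 0 0 + x.1 1 1 := by
  have := x.2
  simp only [sl21, Submodule.mem_mk, AddSubmonoid.mem_mk, AddSubsemigroup.mem_mk,
    Set.mem_ofPred_eq] at this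
  linear_combination -this

/-- Every linear map on `𝔤` is given by its values on the basis. -/
theorem eq_cochain {V : Type v} [AddCommGroup V] [Module F V] (φ : sl21 F →ₗ[F] V) :
    φ = cochain !![φ (evenIncl F (h1 F)), φ (evenIncl F (e12 F)), φ (e13 F);
      φ (e21 F), φ (evenIncl F (h2 F)), φ (e23 F); φ (e31 F), φ (e32 F), 0] := by
  ext x
  have hx : x = x.1 0 0 • evenIncl F (h1 F) + x.1 1 1 • evenIncl F (h2 F)
      + x.1 0 1 • evenIncl F (e12 F) + x.1 0 2 • e13 F + x.1 1 0 • e21 F + x.1 1 2 • e23 F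
      + x.1 2 0 • e31 F + x.1 2 1 • e32 F := by
    have h := supertrace_eq x
    apply Subtype.ext
    ext a b
    fin_cases a <;> fin_cases b <;>
      simp [evenIncl, h1, h2, e12, e13, e21, e23, e31, e32, h]
  conv_lhs => rw [hx]
  simp [cochain]

end Homog

/-- `ρ` turns the super bracket of homogeneous elements into the supercommutator. -/
def IsSuperRep {F : Type u} [Field F] {L : Submodule F (Matrix (Fin 3) (Fin 3) F)} {V : Type v}
    [AddCommGroup V] [Module F V] (ρ : L →ₗ[F] Module.End F V) : Prop :=
  ∀ (i j : ZMod 2) (x y z : L), IsHomog i (x : Matrix (Fin 3) (Fin 3) F) →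
    IsHomog j (y : Matrix (Fin 3) (Fin 3) F) →
    (z : Matrix (Fin 3) (Fin 3) F) = superBracket i j x y →
    ρ z = ρ x * ρ y - sgn F i j • (ρ y * ρ x)

/-- A representation of `𝔤₀` on `V`, given by the operators of the four basis elements. The
relations are oriented as rewriting rules towards the order `e₂₁, e₁₂, h₁, h₂`. -/
structure EvenAction (F : Type u) [Field F] (V : Type v) [AddCommGroup V] [Module F V] where
  h1 : Module.End F V
  h2 : Module.End F V
  e12 : Module.End F V
  e21 : Module.End F V
  h2_h1 : ∀ v, h2 (h1 v) = h1 (h2 v)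
  h1_e12 : ∀ v, h1 (e12 v) = e12 (h1 v) + e12 v
  h2_e12 : ∀ v, h2 (e12 v) = e12 (h2 v) - e12 v
  h1_e21 : ∀ v, h1 (e21 v) = e21 (h1 v) - e21 v
  h2_e21 : ∀ v, h2 (e21 v) = e21 (h2 v) + e21 v
  e12_e21 : ∀ v, e12 (e21 v) = e21 (e12 v) + h1 v - h2 v

/-- A representation of `𝔤` on `V`, given by the operators of the eight basis elements. The
relations are oriented as rewriting rules towards the order
`e₃₁, e₃₂, e₂₁, e₁₂, e₁₃, e₂₃, h₁, h₂`. -/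
structure Action (F : Type u) [Field F] (V : Type v) [AddCommGroup V] [Module F V]
    extends EvenAction F V where
  e13 : Module.End F V
  e23 : Module.End F V
  e31 : Module.End F V
  e32 : Module.End F V
  h1_e13 : ∀ v, h1 (e13 v) = e13 (h1 v)
  h2_e13 : ∀ v, h2 (e13 v) = e13 (h2 v) - e13 v
  h1_e23 : ∀ v, h1 (e23 v) = e23 (h1 v) - e23 v
  h2_e23 : ∀ v, h2 (e23 v) = e23 (h2 v)
  h1_e31 : ∀ v, h1 (e31 v) = e31 (h1 v)
  h2_e31 : ∀ v, h2 (e31 v) = e31 (h2 v) + e31 v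
  h1_e32 : ∀ v, h1 (e32 v) = e32 (h1 v) + e32 v
  h2_e32 : ∀ v, h2 (e32 v) = e32 (h2 v)
  e12_e31 : ∀ v, e12 (e31 v) = e31 (e12 v) - e32 v
  e12_e32 : ∀ v, e12 (e32 v) = e32 (e12 v)
  e21_e31 : ∀ v, e21 (e31 v) = e31 (e21 v)
  e21_e32 : ∀ v, e21 (e32 v) = e32 (e21 v) - e31 v
  e13_e12 : ∀ v, e13 (e12 v) = e12 (e13 v)
  e13_e21 : ∀ v, e13 (e21 v) = e21 (e13 v) - e23 v
  e23_e12 : ∀ v, e23 (e12 v) = e12 (e23 v) - e13 v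
  e23_e21 : ∀ v, e23 (e21 v) = e21 (e23 v)
  e13_e31 : ∀ v, e13 (e31 v) = h1 v - e31 (e13 v)
  e13_e32 : ∀ v, e13 (e32 v) = e12 v - e32 (e13 v)
  e23_e31 : ∀ v, e23 (e31 v) = e21 v - e31 (e23 v)
  e23_e32 : ∀ v, e23 (e32 v) = h2 v - e32 (e23 v)
  e32_e31 : ∀ v, e32 (e31 v) = -e31 (e32 v)
  e31_e31 : ∀ v, e31 (e31 v) = 0
  e32_e32 : ∀ v, e32 (e32 v) = 0
  e23_e13 : ∀ v, e23 (e13 v) = -e13 (e23 v)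
  e13_e13 : ∀ v, e13 (e13 v) = 0
  e23_e23 : ∀ v, e23 (e23 v) = 0

attribute [simp] EvenAction.h2_h1 EvenAction.h1_e12 EvenAction.h2_e12 EvenAction.h1_e21
  EvenAction.h2_e21 EvenAction.e12_e21
  Action.h1_e13 Action.h2_e13 Action.h1_e23 Action.h2_e23 Action.h1_e31 Action.h2_e31
  Action.h1_e32 Action.h2_e32 Action.e12_e31 Action.e12_e32 Action.e21_e31
  Action.e21_e32 Action.e13_e12 Action.e13_e21 Action.e23_e12 Action.e23_e21 Action.e13_e31
  Action.e13_e32 Action.e23_e31 Action.e23_e32 Action.e32_e31 Action.e31_e31 Action.e32_e32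
  Action.e23_e13 Action.e13_e13 Action.e23_e23

section Rep

variable {F : Type u} [Field F] {V : Type v} [AddCommGroup V] [Module F V]

theorem IsSuperRep.apply_apply {L : Submodule F (Matrix (Fin 3) (Fin 3) F)}
    {ρ : L →ₗ[F] Module.End F V} (h : IsSuperRep ρ) {i j : ZMod 2} {x y : L} (z : L)
    (hx : IsHomog i (x : Matrix (Fin 3) (Fin 3) F)) (hy : IsHomog j (y : Matrix (Fin 3) (Fin 3) F))
    (hz : (z : Matrix (Fin 3) (Fin 3) F) = superBracket i j x y) (v : V) :
    ρ x (ρ y v) = ρ z v + sgn F i j • ρ y (ρ x v) := by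
  rw [h i j x y z hx hy hz]
  simp

/-- The four operators of a representation of `𝔤₀`. -/
def EvenAction.ofRep (ρ : evenPart F →ₗ[F] Module.End F V) (h : IsSuperRep ρ) :
    EvenAction F V where
  h1 := ρ (SL21.h1 F)
  h2 := ρ (SL21.h2 F)
  e12 := ρ (SL21.e12 F)
  e21 := ρ (e21₀ F)
  h2_h1 v := by
    rw [h.apply_apply 0 (isHomog_of_mem_evenPart _) (isHomog_of_mem_evenPart _)] <;>
      simp [superBracket, SL21.h1, SL21.h2, mul_add, add_mul]
  h1_e12 v := by
    rw [h.apply_apply (SL21.e12 F) (isHomog_of_mem_evenPart _) (isHomog_of_mem_evenPart _)] <;>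
      simp [superBracket, SL21.h1, SL21.e12, mul_add, add_mul, add_comm]
  h2_e12 v := by
    rw [h.apply_apply (-SL21.e12 F) (isHomog_of_mem_evenPart _) (isHomog_of_mem_evenPart _)] <;>
      simp [superBracket, SL21.h2, SL21.e12, mul_add, add_mul, sub_eq_neg_add]
  h1_e21 v := by
    rw [h.apply_apply (-e21₀ F) (isHomog_of_mem_evenPart _) (isHomog_of_mem_evenPart _)] <;>
      simp [superBracket, SL21.h1, e21₀, mul_add, add_mul, sub_eq_neg_add]
  h2_e21 v := by
    rw [h.apply_apply (e21₀ F) (isHomog_of_mem_evenPart _) (isHomog_of_mem_evenPart _)] <;>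
      simp [superBracket, SL21.h2, e21₀, mul_add, add_mul, add_comm]
  e12_e21 v := by
    rw [h.apply_apply (SL21.h1 F - SL21.h2 F) (isHomog_of_mem_evenPart _)
      (isHomog_of_mem_evenPart _)]
    · simp; abel
    · simp [superBracket, SL21.h1, SL21.h2, SL21.e12, e21₀]

theorem EvenAction.ofRep_apply (ρ : evenPart F →ₗ[F] Module.End F V) (h : IsSuperRep ρ)
    (w : evenPart F) :
    ρ w = w.1 0 0 • (ofRep ρ h).h1 + w.1 1 1 • (ofRep ρ h).h2 + w.1 0 1 • (ofRep ρ h).e12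
      + w.1 1 0 • (ofRep ρ h).e21 := by
  have hw : w = w.1 0 0 • SL21.h1 F + w.1 1 1 • SL21.h2 F + w.1 0 1 • SL21.e12 F
      + w.1 1 0 • e21₀ F := by
    have h := supertrace_eq (evenIncl F w)
    obtain ⟨x1, x2, x3, x4⟩ := entries_of_even w.2.2
    simp only [evenIncl, LinearMap.coe_mk, AddHom.coe_mk] at h
    apply Subtype.ext
    ext a b
    fin_cases a <;> fin_cases b <;>
      simp [SL21.h1, SL21.h2, SL21.e12, e21₀, h, x1, x2, x3, x4]
  conv_lhs => rw [hw]
  simp [ofRep]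

/-- An odd element of super-square zero acts with square zero in characteristic `≠ 2`. -/
theorem IsSuperRep.sq_eq_zero {ρ : sl21 F →ₗ[F] Module.End F V} (h : IsSuperRep ρ)
    (two : (2 : F) ≠ 0) {x : sl21 F} (hx : IsHomog 1 (x : Matrix (Fin 3) (Fin 3) F))
    (hz : (x : Matrix (Fin 3) (Fin 3) F) * x = 0) (v : V) : ρ x (ρ x v) = 0 := by
  have := h.apply_apply 0 hx hx (by simp [superBracket, hz]) v
  rw [sgn_one_one, map_zero, LinearMap.zero_apply, zero_add, neg_one_smul] at this
  have h2 : (2 : F) • ρ x (ρ x v) = 0 := by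
    rw [two_smul]; nth_rewrite 1 [this]; simp
  exact (smul_eq_zero.1 h2).resolve_left two

/-- The eight operators of a representation of `𝔤`. -/
def Action.ofRep (ρ : sl21 F →ₗ[F] Module.End F V) (h : IsSuperRep ρ) (two : (2 : F) ≠ 0) :
    Action F V where
  h1 := ρ (evenIncl F (SL21.h1 F))
  h2 := ρ (evenIncl F (SL21.h2 F))
  e12 := ρ (evenIncl F (SL21.e12 F))
  e21 := ρ (SL21.e21 F)
  e13 := ρ (SL21.e13 F)
  e23 := ρ (SL21.e23 F)
  e31 := ρ (SL21.e31 F)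
  e32 := ρ (SL21.e32 F)
  h2_h1 v := by
    rw [h.apply_apply 0 (isHomog_evenIncl _) (isHomog_evenIncl _)] <;>
      simp [superBracket, evenIncl, SL21.h1, SL21.h2, mul_add, add_mul]
  h1_e12 v := by
    rw [h.apply_apply (evenIncl F (SL21.e12 F)) (isHomog_evenIncl _) (isHomog_evenIncl _)] <;>
      simp [superBracket, evenIncl, SL21.h1, SL21.e12, mul_add, add_mul, add_comm]
  h2_e12 v := by
    rw [h.apply_apply (-evenIncl F (SL21.e12 F)) (isHomog_evenIncl _) (isHomog_evenIncl _)] <;>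
      simp [superBracket, evenIncl, SL21.h2, SL21.e12, mul_add, add_mul, sub_eq_neg_add]
  h1_e21 v := by
    rw [h.apply_apply (-SL21.e21 F) (isHomog_evenIncl _) isHomog_e21] <;>
      simp [superBracket, evenIncl, SL21.h1, SL21.e21, mul_add, add_mul, sub_eq_neg_add]
  h2_e21 v := by
    rw [h.apply_apply (SL21.e21 F) (isHomog_evenIncl _) isHomog_e21] <;>
      simp [superBracket, evenIncl, SL21.h2, SL21.e21, mul_add, add_mul, add_comm]
  h1_e13 v := by
    rw [h.apply_apply 0 (isHomog_evenIncl _) isHomog_e13] <;>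
      simp [superBracket, evenIncl, SL21.h1, SL21.e13, mul_add, add_mul]
  h2_e13 v := by
    rw [h.apply_apply (-SL21.e13 F) (isHomog_evenIncl _) isHomog_e13] <;>
      simp [superBracket, evenIncl, SL21.h2, SL21.e13, mul_add, add_mul, sub_eq_neg_add]
  h1_e23 v := by
    rw [h.apply_apply (-SL21.e23 F) (isHomog_evenIncl _) isHomog_e23] <;>
      simp [superBracket, evenIncl, SL21.h1, SL21.e23, mul_add, add_mul, sub_eq_neg_add]
  h2_e23 v := by
    rw [h.apply_apply 0 (isHomog_evenIncl _) isHomog_e23] <;>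
      simp [superBracket, evenIncl, SL21.h2, SL21.e23, mul_add, add_mul]
  h1_e31 v := by
    rw [h.apply_apply 0 (isHomog_evenIncl _) isHomog_e31] <;>
      simp [superBracket, evenIncl, SL21.h1, SL21.e31, mul_add, add_mul]
  h2_e31 v := by
    rw [h.apply_apply (SL21.e31 F) (isHomog_evenIncl _) isHomog_e31] <;>
      simp [superBracket, evenIncl, SL21.h2, SL21.e31, mul_add, add_mul, add_comm]
  h1_e32 v := by
    rw [h.apply_apply (SL21.e32 F) (isHomog_evenIncl _) isHomog_e32] <;>
      simp [superBracket, evenIncl, SL21.h1, SL21.e32, mul_add, add_mul, add_comm]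
  h2_e32 v := by
    rw [h.apply_apply 0 (isHomog_evenIncl _) isHomog_e32] <;>
      simp [superBracket, evenIncl, SL21.h2, SL21.e32, mul_add, add_mul]
  e12_e21 v := by
    rw [h.apply_apply (evenIncl F (SL21.h1 F) - evenIncl F (SL21.h2 F)) (isHomog_evenIncl _)
      isHomog_e21]
    · simp; abel
    · simp [superBracket, evenIncl, SL21.h1, SL21.h2, SL21.e12, SL21.e21]
  e12_e31 v := by
    rw [h.apply_apply (-SL21.e32 F) (isHomog_evenIncl _) isHomog_e31] <;>
      simp [superBracket, evenIncl, SL21.e12, SL21.e31, SL21.e32, sub_eq_neg_add]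
  e12_e32 v := by
    rw [h.apply_apply 0 (isHomog_evenIncl _) isHomog_e32] <;>
      simp [superBracket, evenIncl, SL21.e12, SL21.e32]
  e21_e31 v := by
    rw [h.apply_apply 0 isHomog_e21 isHomog_e31] <;>
      simp [superBracket, SL21.e21, SL21.e31]
  e21_e32 v := by
    rw [h.apply_apply (-SL21.e31 F) isHomog_e21 isHomog_e32] <;>
      simp [superBracket, SL21.e21, SL21.e31, SL21.e32, sub_eq_neg_add]
  e13_e12 v := by
    rw [h.apply_apply 0 isHomog_e13 (isHomog_evenIncl _)] <;>
      simp [superBracket, evenIncl, SL21.e12, SL21.e13]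
  e13_e21 v := by
    rw [h.apply_apply (-SL21.e23 F) isHomog_e13 isHomog_e21] <;>
      simp [superBracket, SL21.e21, SL21.e13, SL21.e23, sub_eq_neg_add]
  e23_e12 v := by
    rw [h.apply_apply (-SL21.e13 F) isHomog_e23 (isHomog_evenIncl _)] <;>
      simp [superBracket, evenIncl, SL21.e12, SL21.e13, SL21.e23, sub_eq_neg_add]
  e23_e21 v := by
    rw [h.apply_apply 0 isHomog_e23 isHomog_e21] <;>
      simp [superBracket, SL21.e21, SL21.e23]
  e13_e31 v := by
    rw [h.apply_apply (evenIncl F (SL21.h1 F)) isHomog_e13 isHomog_e31] <;>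
      simp [superBracket, evenIncl, SL21.h1, SL21.e13, SL21.e31, sub_eq_add_neg]
  e13_e32 v := by
    rw [h.apply_apply (evenIncl F (SL21.e12 F)) isHomog_e13 isHomog_e32] <;>
      simp [superBracket, evenIncl, SL21.e12, SL21.e13, SL21.e32, sub_eq_add_neg]
  e23_e31 v := by
    rw [h.apply_apply (SL21.e21 F) isHomog_e23 isHomog_e31] <;>
      simp [superBracket, SL21.e21, SL21.e23, SL21.e31, sub_eq_add_neg]
  e23_e32 v := by
    rw [h.apply_apply (evenIncl F (SL21.h2 F)) isHomog_e23 isHomog_e32] <;>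
      simp [superBracket, evenIncl, SL21.h2, SL21.e23, SL21.e32, sub_eq_add_neg]
  e32_e31 v := by
    rw [h.apply_apply 0 isHomog_e32 isHomog_e31] <;>
      simp [superBracket, SL21.e31, SL21.e32]
  e31_e31 v := h.sq_eq_zero two isHomog_e31 (by simp [SL21.e31]) v
  e32_e32 v := h.sq_eq_zero two isHomog_e32 (by simp [SL21.e32]) v
  e23_e13 v := by
    rw [h.apply_apply 0 isHomog_e23 isHomog_e13] <;>
      simp [superBracket, SL21.e13, SL21.e23]
  e13_e13 v := h.sq_eq_zero two isHomog_e13 (by simp [SL21.e13]) v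
  e23_e23 v := h.sq_eq_zero two isHomog_e23 (by simp [SL21.e23]) v

/-- The linear map `𝔤 → End V` of an `Action`. -/
def Action.rep (a : Action F V) : sl21 F →ₗ[F] Module.End F V :=
  cochain !![a.h1, a.e12, a.e13; a.e21, a.h2, a.e23; a.e31, a.e32, 0]

theorem Action.rep_ofRep (ρ : sl21 F →ₗ[F] Module.End F V) (h : IsSuperRep ρ)
    (two : (2 : F) ≠ 0) : (Action.ofRep ρ h two).rep = ρ := (eq_cochain ρ).symm

theorem Action.isSuperRep_rep (a : Action F V) : IsSuperRep a.rep := by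
  intro i j x y z hx hy hz
  have hz' : ∀ k l, z.1 k l = (superBracket i j x.1 y.1) k l := fun k l => by rw [hz]
  simp only [superBracket, Matrix.sub_apply, Matrix.smul_apply, Matrix.mul_apply,
    Fin.sum_univ_three, smul_eq_mul] at hz'
  have sx := supertrace_eq x
  have sy := supertrace_eq y
  ext v
  rcases parity_cases i with rfl | rfl <;> rcases parity_cases j with rfl | rfl
  · obtain ⟨x1, x2, x3, x4⟩ := entries_of_even hx
    obtain ⟨y1, y2, y3, y4⟩ := entries_of_even hy
    simp only [rep, cochain, LinearMap.coe_mk, AddHom.coe_mk, hz', x1, x2, x3, x4, y1, y2, y3, y4,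
      sx, sy, sgn_zero_left]
    simp
    module
  · obtain ⟨x1, x2, x3, x4⟩ := entries_of_even hx
    obtain ⟨y1, y2, y3, y4, y5⟩ := entries_of_odd hy
    simp only [rep, cochain, LinearMap.coe_mk, AddHom.coe_mk, hz', x1, x2, x3, x4, y1, y2, y3, y4,
      y5, sx, sgn_zero_left]
    simp
    module
  · obtain ⟨x1, x2, x3, x4, x5⟩ := entries_of_odd hx
    obtain ⟨y1, y2, y3, y4⟩ := entries_of_even hy
    simp only [rep, cochain, LinearMap.coe_mk, AddHom.coe_mk, hz', x1, x2, x3, x4, x5, y1, y2, y3,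
      y4, sy, sgn_zero_right]
    simp
    module
  · obtain ⟨x1, x2, x3, x4, x5⟩ := entries_of_odd hx
    obtain ⟨y1, y2, y3, y4, y5⟩ := entries_of_odd hy
    simp only [rep, cochain, LinearMap.coe_mk, AddHom.coe_mk, hz', x1, x2, x3, x4, x5, y1, y2, y3,
      y4, y5, sgn_one_one]
    simp
    module

end Rep

/-! ### Tools in characteristic `p` -/

section CharTools

variable {F : Type u} [Field F] (p : ℕ) [Fact p.Prime] [CharP F p]

/-- In characteristic `p`, `(ad a)^p = ad (a^p)`. -/
theorem ad_pow_char {A : Type v} [Ring A] [Algebra F A] (a x : A) :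
    ((LinearMap.mulLeft F a - LinearMap.mulRight F a) ^ p) x = a ^ p * x - x * a ^ p := by
  rcases subsingleton_or_nontrivial A with h | h
  · exact Subsingleton.elim _ _
  have : CharP (Module.End F A) p :=
    charP_of_injective_algebraMap (algebraMap F (Module.End F A)).injective p
  rw [sub_pow_char_of_commute p (show Commute (LinearMap.mulLeft F a) (LinearMap.mulRight F a) from
      LinearMap.ext fun y => (mul_assoc a y a).symm), LinearMap.pow_mulLeft,
    LinearMap.pow_mulRight]
  simp

/-- The `p`-th power of a derivation is a derivation. -/
theorem derivation_pow_char_mul {R : Type v} [CommRing R] [Algebra F R] (D : Derivation F R R)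
    (a b : R) : ((D : R →ₗ[F] R) ^ p) (a * b)
      = a * ((D : R →ₗ[F] R) ^ p) b + ((D : R →ₗ[F] R) ^ p) a * b := by
  have key : ∀ n : ℕ, ((LinearMap.mulLeft F (D : Module.End F R)
      - LinearMap.mulRight F (D : Module.End F R)) ^ n) (LinearMap.mulLeft F a)
      = LinearMap.mulLeft F (((D : Module.End F R) ^ n) a) := by
    intro n
    induction n with
    | zero => simp
    | succ n ih =>
      rw [pow_succ', Module.End.mul_apply, ih, pow_succ', Module.End.mul_apply]
      ext x
      simp
      ring
  have h := key p
  rw [ad_pow_char p] at h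
  have := LinearMap.congr_fun h b
  simp only [LinearMap.sub_apply, Module.End.mul_apply, LinearMap.mulLeft_apply] at this
  linear_combination this

/-- The `p`-th power of a derivation, as a derivation. -/
def derivationPowChar {R : Type v} [CommRing R] [Algebra F R] (D : Derivation F R R) :
    Derivation F R R :=
  Derivation.mk' ((D : R →ₗ[F] R) ^ p) fun a b => by
    rw [derivation_pow_char_mul p D]; simp [mul_comm]

variable {p}

theorem natCast_pow_char (k : ℕ) : (k : F) ^ p = k := by
  have := map_natCast (frobenius F p) k
  rwa [frobenius_def] at this

omit [CharP F p] in
theorem pow_pred_eq_one {x : F} (h : x ^ p = x) (hx : x ≠ 0) : x ^ (p - 1) = 1 := by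
  have hp : p = p - 1 + 1 := (Nat.succ_pred_prime Fact.out).symm
  rw [hp, pow_succ] at h
  exact mul_right_cancel₀ hx (by rw [h, one_mul])

omit [Fact p.Prime] in
theorem natCast_ne_zero_of_lt {k : ℕ} (h0 : k ≠ 0) (hk : k < p) : (k : F) ≠ 0 := by
  rw [Ne, CharP.cast_eq_zero_iff F p]
  exact fun h => absurd (Nat.le_of_dvd (Nat.pos_of_ne_zero h0) h) (by omega)

omit [Fact p.Prime] in
theorem eq_of_natCast_eq {k n : ℕ} (hk : k < p) (hn : n < p) (h : (k : F) = n) : k = n := by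
  have := (CharP.cast_eq_iff_mod_eq F p).1 h
  rwa [Nat.mod_eq_of_lt hk, Nat.mod_eq_of_lt hn] at this

theorem exists_natCast_eq {x : F} (hx : x ^ p = x) : ∃ n : ℕ, n < p ∧ (n : F) = x := by
  have : x ∈ (⊥ : Subfield F) := (Subfield.mem_bot_iff_pow_eq_self (F := F) (p := p)).2 hx
  rw [← ZMod.fieldRange_castHom_eq_bot p] at this
  obtain ⟨y, rfl⟩ := this
  exact ⟨y.val, ZMod.val_lt y, by simp⟩

end CharTools

/-! ### Modules over reduced enveloping algebras -/

section Env

variable {p : ℕ} {F : Type u} [Field F] {L : Submodule F (Matrix (Fin 3) (Fin 3) F)}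
  {χ : Module.Dual F (evenPart F)}

theorem Env.bracket {i j : ZMod 2} {x y z : L} (hx : IsHomog i (x : Matrix (Fin 3) (Fin 3) F))
    (hy : IsHomog j (y : Matrix (Fin 3) (Fin 3) F))
    (hz : (z : Matrix (Fin 3) (Fin 3) F) = superBracket i j x y) :
    ι p L χ z = ι p L χ x * ι p L χ y - sgn F i j • (ι p L χ y * ι p L χ x) := by
  have := RingQuot.mkAlgHom_rel F (EnvRel.bracket (p := p) (χ := χ) i j x y z hx hy hz)
  rw [map_sub, map_smul, map_mul, map_mul] at this
  exact this.symm

theorem Env.pow_char {w : evenPart F} {x z : L} (hx : (x : Matrix (Fin 3) (Fin 3) F) = w)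
    (hz : (z : Matrix (Fin 3) (Fin 3) F) = (w : Matrix (Fin 3) (Fin 3) F) ^ p) :
    ι p L χ x ^ p = ι p L χ z + algebraMap F _ (χ w ^ p) := by
  have := RingQuot.mkAlgHom_rel F (EnvRel.pPower (p := p) (χ := χ) w x z hx hz)
  rw [map_sub, map_pow, AlgHom.commutes] at this
  exact sub_eq_iff_eq_add'.1 this

/-- A representation that satisfies the `p`-power relations is one of `u(L, χ)`. -/
def Env.lift {V : Type v} [AddCommGroup V] [Module F V] (ρ : L →ₗ[F] Module.End F V)
    (hρ : IsSuperRep ρ)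
    (hp : ∀ (w : evenPart F) (x z : L), (x : Matrix (Fin 3) (Fin 3) F) = w →
      (z : Matrix (Fin 3) (Fin 3) F) = (w : Matrix (Fin 3) (Fin 3) F) ^ p →
      ρ x ^ p = ρ z + algebraMap F _ (χ w ^ p)) :
    Env p L χ →ₐ[F] Module.End F V :=
  RingQuot.liftAlgHom F ⟨TensorAlgebra.lift F ρ, by
    rintro _ _ (⟨i, j, x, y, z, hx, hy, hz⟩ | ⟨w, x, z, hx, hz⟩)
    · simp [hρ i j x y z hx hy hz]
    · rw [map_sub, map_pow, TensorAlgebra.lift_ι_apply, TensorAlgebra.lift_ι_apply,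
        hp w x z hx hz, AlgHom.commutes, add_sub_cancel_left]⟩

theorem Env.lift_ι {V : Type v} [AddCommGroup V] [Module F V] (ρ : L →ₗ[F] Module.End F V)
    (hρ : IsSuperRep ρ)
    (hp : ∀ (w : evenPart F) (x z : L), (x : Matrix (Fin 3) (Fin 3) F) = w →
      (z : Matrix (Fin 3) (Fin 3) F) = (w : Matrix (Fin 3) (Fin 3) F) ^ p →
      ρ x ^ p = ρ z + algebraMap F _ (χ w ^ p)) (x : L) :
    Env.lift ρ hρ hp (ι p L χ x) = ρ x :=
  (RingQuot.liftAlgHom_mkAlgHom_apply _ _ _ _).trans (TensorAlgebra.lift_ι_apply _ _)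

section Module

variable {X : Type v} [AddCommGroup X] [Module F X] [Module (Env p L χ) X]
  [IsScalarTower F (Env p L χ) X]

variable (p L χ X) in
/-- The action of `L` on a `u(L, χ)`-module. -/
def Env.toRep : L →ₗ[F] Module.End F X :=
  (Algebra.lsmul F F X).toLinearMap ∘ₗ ι p L χ

theorem Env.toRep_apply (x : L) (v : X) : toRep p L χ X x v = ι p L χ x • v := rfl

theorem Env.isSuperRep_toRep : IsSuperRep (toRep p L χ X) := by
  intro i j x y z hx hy hz
  ext v
  simp [toRep_apply, Env.bracket hx hy hz, sub_smul, mul_smul]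

theorem Env.toRep_pow (x : L) (n : ℕ) (v : X) :
    (toRep p L χ X x ^ n) v = ι p L χ x ^ n • v := by
  change ((Algebra.lsmul F F X (ι p L χ x)) ^ n) v = _
  rw [← map_pow]; rfl

theorem Env.toRep_pow_char {w : evenPart F} {x z : L}
    (hx : (x : Matrix (Fin 3) (Fin 3) F) = w)
    (hz : (z : Matrix (Fin 3) (Fin 3) F) = (w : Matrix (Fin 3) (Fin 3) F) ^ p) :
    toRep p L χ X x ^ p = toRep p L χ X z + algebraMap F _ (χ w ^ p) := by
  ext v
  rw [toRep_pow, Env.pow_char hx hz]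
  rw [add_smul, algebraMap_smul, LinearMap.add_apply, Module.algebraMap_end_apply, toRep_apply]

theorem Env.one_sub_pow_smul (x : L) (c : F) (n : ℕ) (v : X) :
    (1 - (ι p L χ x - algebraMap F (Env p L χ) c) ^ n) • v
      = (1 - (toRep p L χ X x - algebraMap F (Module.End F X) c) ^ n) v := by
  change Algebra.lsmul F F X _ v = _
  rw [map_sub, map_one, map_pow, map_sub, AlgHom.commutes]
  rfl

/-- A subspace stable under `L` is stable under `u(L, χ)`. -/
theorem Env.smul_mem {W : Submodule F X} (hW : ∀ (x : L), ∀ v ∈ W, ι p L χ x • v ∈ W)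
    (a : Env p L χ) {v : X} (hv : v ∈ W) : a • v ∈ W := by
  obtain ⟨t, rfl⟩ := RingQuot.mkAlgHom_surjective F (EnvRel p L χ) a
  change Env.ofTensor p L χ t • v ∈ W
  induction t using TensorAlgebra.induction generalizing v with
  | algebraMap r => rw [AlgHom.commutes, algebraMap_smul]; exact W.smul_mem r hv
  | ι x => exact hW x v hv
  | mul a b ha hb => rw [map_mul, mul_smul]; exact ha (hb hv)
  | add a b ha hb => rw [map_add, add_smul]; exact W.add_mem (ha hv) (hb hv)

/-- A subspace stable under `L`, as a `u(L, χ)`-submodule. -/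
def Env.submoduleOf (W : Submodule F X) (hW : ∀ (x : L), ∀ v ∈ W, ι p L χ x • v ∈ W) :
    Submodule (Env p L χ) X where
  carrier := W
  zero_mem' := W.zero_mem
  add_mem' := W.add_mem
  smul_mem' a _ hv := Env.smul_mem hW a hv

theorem Env.eq_top_of_span {v : X} (hv : Submodule.span (Env p L χ) {v} = ⊤) {W : Submodule F X}
    (hW : ∀ (x : L), ∀ v ∈ W, ι p L χ x • v ∈ W) (hvW : v ∈ W) : W = ⊤ := by
  have h : Submodule.span (Env p L χ) {v} ≤ Env.submoduleOf W hW := by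
    rw [Submodule.span_singleton_le_iff_mem]; exact hvW
  rw [hv] at h
  exact eq_top_iff.2 fun x _ => h (Submodule.mem_top (x := x))

end Module

end Env

/-! ### The largest proper submodule -/

section SumProper

variable {A : Type u} [Ring A] {X : Type v} [AddCommGroup X] [Module A X]

/-- If some `a` in the algebra projects a module with generator `v` onto the line of `v`, then the
sum of the proper submodules does not contain `v`: all proper submodules are killed by `a`. -/
theorem notMem_sumProper {F : Type w} [Field F] [Algebra F A] [Module F X] [IsScalarTower F A X]
    (a : A) {v : X} (hv : v ≠ 0) (hgen : Submodule.span A {v} = ⊤)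
    (ha : ∀ x : X, ∃ c : F, a • x = c • v) (hav : a • v = v) : v ∉ sumProper A X := by
  intro hmem
  have key : ∀ x ∈ sumProper A X, a • x = 0 := by
    intro x hx
    rw [sumProper, sSup_eq_iSup'] at hx
    induction hx using Submodule.iSup_induction' with
    | mem W x hx =>
      obtain ⟨c, hc⟩ := ha x
      by_cases h0 : c = 0
      · rw [hc, h0, zero_smul]
      exfalso
      apply W.2
      have h1 : c • v ∈ W.1 := hc ▸ W.1.smul_mem a hx
      have h2 : v ∈ W.1 := by
        have := W.1.smul_of_tower_mem c⁻¹ h1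
        rwa [smul_smul, inv_mul_cancel₀ h0, one_smul] at this
      exact eq_top_iff.2 (hgen.symm.le.trans ((Submodule.span_singleton_le_iff_mem _ _).2 h2))
    | zero => simp
    | add x y _ _ hx hy => rw [smul_add, hx, hy, add_zero]
  exact hv (by rw [← hav]; exact key v hmem)

theorem eq_bot_or_top_of_quotient_sumProper (W : Submodule A (X ⧸ sumProper A X)) :
    W = ⊥ ∨ W = ⊤ := by
  by_cases h : W = ⊤
  · exact Or.inr h
  left
  have h1 : W.comap (sumProper A X).mkQ ≠ ⊤ := by
    intro h'
    apply h
    rw [← Submodule.map_comap_eq_of_surjective (sumProper A X).mkQ_surjective W, h',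
      Submodule.map_top, Submodule.range_mkQ]
  have h2 : W.comap (sumProper A X).mkQ ≤ sumProper A X := le_sSup h1
  rw [eq_bot_iff]
  intro x hx
  obtain ⟨y, rfl⟩ := (sumProper A X).mkQ_surjective x
  exact (Submodule.Quotient.mk_eq_zero _).2 (h2 hx)

theorem span_mk_eq_top {v : X} (hv : Submodule.span A {v} = ⊤) (N : Submodule A X) :
    Submodule.span A {(Submodule.Quotient.mk v : X ⧸ N)} = ⊤ := by
  have := Submodule.map_span N.mkQ {v}
  rw [hv, Submodule.map_top, Submodule.range_mkQ, Set.image_singleton] at this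
  exact this.symm

end SumProper

/-! ### Maximal vectors -/

section Maximal

variable {F : Type u} [Field F] {V : Type v} [AddCommGroup V] [Module F V]

/-- `v` is a maximal vector of weight `l` for `𝔤₀`. -/
structure EvenAction.IsMaximal (a : EvenAction F V) (l : F × F) (v : V) : Prop where
  e12 : a.e12 v = 0
  h1 : a.h1 v = l.1 • v
  h2 : a.h2 v = l.2 • v

/-- The vectors `e₂₁ᵏ v`. -/
def EvenAction.vec (a : EvenAction F V) (v : V) (k : ℕ) : V := (a.e21 ^ k) v

namespace EvenAction

variable {a : EvenAction F V} {l : F × F} {v : V}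

@[simp] theorem vec_zero : a.vec v 0 = v := by simp [vec]

@[simp] theorem e21_vec (k : ℕ) : a.e21 (a.vec v k) = a.vec v (k + 1) := by
  simp [vec, pow_succ']

theorem vec_add (j k : ℕ) : a.vec (a.vec v j) k = a.vec v (k + j) := by
  simp [vec, pow_add]

theorem IsMaximal.h1_vec (h : a.IsMaximal l v) (k : ℕ) :
    a.h1 (a.vec v k) = (l.1 - k) • a.vec v k := by
  induction k with
  | zero => simp [h.h1]
  | succ k ih => rw [← e21_vec, a.h1_e21, ih, map_smul]; push_cast; module

theorem IsMaximal.h2_vec (h : a.IsMaximal l v) (k : ℕ) :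
    a.h2 (a.vec v k) = (l.2 + k) • a.vec v k := by
  induction k with
  | zero => simp [h.h2]
  | succ k ih => rw [← e21_vec, a.h2_e21, ih, map_smul]; push_cast; module

theorem IsMaximal.e12_vec_succ (h : a.IsMaximal l v) (k : ℕ) :
    a.e12 (a.vec v (k + 1)) = ((k + 1) * (l.1 - l.2 - k)) • a.vec v k := by
  induction k with
  | zero => rw [← e21_vec, a.e12_e21, vec_zero, h.e12, h.h1, h.h2]; simp; module
  | succ k ih =>
    rw [← e21_vec, a.e12_e21, ih, h.h1_vec, h.h2_vec, map_smul, e21_vec]; push_cast; module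

/-- The vectors `e₂₁ᵏ v` of a maximal vector `v` span a `𝔤₀`-submodule. -/
theorem IsMaximal.stable_span_vec (h : a.IsMaximal l v) {x : V}
    (hx : x ∈ Submodule.span F (Set.range (a.vec v))) :
    a.h1 x ∈ Submodule.span F (Set.range (a.vec v)) ∧
    a.h2 x ∈ Submodule.span F (Set.range (a.vec v)) ∧
    a.e12 x ∈ Submodule.span F (Set.range (a.vec v)) ∧
    a.e21 x ∈ Submodule.span F (Set.range (a.vec v)) := by
  have hm : ∀ k, a.vec v k ∈ Submodule.span F (Set.range (a.vec v)) :=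
    fun k => Submodule.subset_span ⟨k, rfl⟩
  induction hx using Submodule.span_induction with
  | mem x hx =>
    obtain ⟨k, rfl⟩ := hx
    refine ⟨?_, ?_, ?_, ?_⟩
    · rw [h.h1_vec]; exact Submodule.smul_mem _ _ (hm k)
    · rw [h.h2_vec]; exact Submodule.smul_mem _ _ (hm k)
    · cases k with
      | zero => rw [vec_zero, h.e12]; exact zero_mem _
      | succ k => rw [h.e12_vec_succ]; exact Submodule.smul_mem _ _ (hm k)
    · rw [e21_vec]; exact hm _
  | zero => simp
  | add x y _ _ hx hy =>
    simp only [map_add]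
    exact ⟨add_mem hx.1 hy.1, add_mem hx.2.1 hy.2.1, add_mem hx.2.2.1 hy.2.2.1,
      add_mem hx.2.2.2 hy.2.2.2⟩
  | smul c x _ hx =>
    simp only [map_smul]
    exact ⟨Submodule.smul_mem _ _ hx.1, Submodule.smul_mem _ _ hx.2.1,
      Submodule.smul_mem _ _ hx.2.2.1, Submodule.smul_mem _ _ hx.2.2.2⟩

end EvenAction

/-- For `n = p - 1` and `μ`, `c` that differ by an element of the prime field, the scalar is `1` if
`μ = c` and `0` otherwise, by Fermat. -/
theorem one_sub_pow_apply {f : Module.End F V} {x : V} {μ c : F} (hx : f x = μ • x) (n : ℕ) :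
    (1 - (f - algebraMap F _ c) ^ n) x = (1 - (μ - c) ^ n) • x := by
  have : ∀ n : ℕ, ((f - algebraMap F _ c) ^ n) x = (μ - c) ^ n • x := by
    intro n
    induction n with
    | zero => simp
    | succ n ih =>
      rw [pow_succ', Module.End.mul_apply, ih, map_smul, LinearMap.sub_apply, hx,
        Module.algebraMap_end_apply, ← sub_smul, smul_smul, pow_succ]
  rw [LinearMap.sub_apply, this, sub_smul, one_smul, Module.End.one_apply]

theorem exists_smul_of_mem_span {f : Module.End F V} {v : V} {S : Set V}
    (h : ∀ b ∈ S, ∃ c : F, f b = c • v) {x : V} (hx : x ∈ Submodule.span F S) :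
    ∃ c : F, f x = c • v := by
  have : Submodule.span F S ≤ (Submodule.span F {v}).comap f := by
    rw [Submodule.span_le]
    intro b hb
    obtain ⟨c, hc⟩ := h b hb
    exact Submodule.mem_span_singleton.2 ⟨c, hc.symm⟩
  obtain ⟨c, hc⟩ := Submodule.mem_span_singleton.1 (this hx)
  exact ⟨c, hc.symm⟩

/-- In a highest weight module, `1 - (h₁ - λ₁)^(p-1)` projects onto the line of the maximal
vector. -/
theorem EvenAction.IsMaximal.proj_vec {p : ℕ} [Fact p.Prime] [CharP F p] {a : EvenAction F V}
    {l : F × F} {v : V} (h : a.IsMaximal l v) (hp : a.e21 ^ p = 0) (k : ℕ) :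
    (1 - (a.h1 - algebraMap F _ l.1) ^ (p - 1)) (a.vec v k) = if k = 0 then v else 0 := by
  rw [one_sub_pow_apply (h.h1_vec k)]
  have h2 : p - 1 ≠ 0 := by have := (Fact.out : p.Prime).two_le; omega
  split_ifs with hk
  · subst hk; simp [zero_pow h2]
  · by_cases hkp : p ≤ k
    · rw [vec, pow_eq_zero_of_le hkp hp]; simp
    · rw [sub_sub_cancel_left, pow_pred_eq_one (p := p) _
        (neg_ne_zero.2 (natCast_ne_zero_of_lt hk (not_le.1 hkp))), sub_self, zero_smul]
      rw [← neg_one_mul, mul_pow, natCast_pow_char, neg_one_pow_char]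

end Maximal

/-! ### Restricted `𝔤₀`-modules with a prescribed highest weight -/

section Poly

variable {F : Type u} [Field F]

/-- A matrix acts on polynomials in the basis vectors of its natural module by a derivation. -/
def polyDer (w : Matrix (Fin 3) (Fin 3) F) :
    Derivation F (MvPolynomial (Fin 3) F) (MvPolynomial (Fin 3) F) :=
  MvPolynomial.mkDerivation F fun j => ∑ i, w i j • MvPolynomial.X i

theorem polyDer_X (w : Matrix (Fin 3) (Fin 3) F) (j : Fin 3) :
    polyDer w (MvPolynomial.X j) = ∑ i, w i j • MvPolynomial.X i :=
  MvPolynomial.mkDerivation_X _ _ _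

theorem polyDer_polyDer_X (x y : Matrix (Fin 3) (Fin 3) F) (j : Fin 3) :
    polyDer x (polyDer y (MvPolynomial.X j)) = polyDer (x * y) (MvPolynomial.X j) := by
  rw [polyDer_X, polyDer_X, map_sum]
  have : ∀ k, (polyDer x) (y k j • MvPolynomial.X k)
      = ∑ i, (x i k * y k j) • (MvPolynomial.X i : MvPolynomial (Fin 3) F) := fun k => by
    rw [Derivation.map_smul, polyDer_X, Finset.smul_sum]
    exact Finset.sum_congr rfl fun i _ => by rw [smul_smul, mul_comm]
  rw [Finset.sum_congr rfl fun k _ => this k, Finset.sum_comm]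
  exact Finset.sum_congr rfl fun i _ => by rw [Matrix.mul_apply, Finset.sum_smul]

/-- The action of `𝔤₀` on polynomials in three variables. -/
def polyRep (F : Type u) [Field F] : evenPart F →ₗ[F] Module.End F (MvPolynomial (Fin 3) F) where
  toFun w := (polyDer w.1 : MvPolynomial (Fin 3) F →ₗ[F] MvPolynomial (Fin 3) F)
  map_add' x y := by
    rw [← Derivation.coe_add_linearMap]
    congr 1
    exact MvPolynomial.derivation_ext fun i => by
      simp [polyDer_X, add_smul, Finset.sum_add_distrib]
  map_smul' c x := by
    rw [RingHom.id_apply, ← Derivation.coe_smul_linearMap]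
    congr 1
    exact MvPolynomial.derivation_ext fun i => by
      simp [polyDer_X, mul_smul, Finset.smul_sum]

theorem polyRep_apply (w : evenPart F) (f : MvPolynomial (Fin 3) F) :
    polyRep F w f = polyDer w.1 f := rfl

theorem eq_zero_of_even_odd {x : evenPart F} (hx : IsHomog 1 (x : Matrix (Fin 3) (Fin 3) F)) :
    x = 0 := by
  apply Subtype.ext
  ext a b
  by_cases h : idxParity a + idxParity b = 0
  · exact hx a b (by rw [h]; decide)
  · exact x.2.2 a b h

theorem isSuperRep_polyRep : IsSuperRep (polyRep F) := by
  intro i j x y z hx hy hz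
  rcases parity_cases i with rfl | rfl
  · rcases parity_cases j with rfl | rfl
    · refine LinearMap.ext fun f => ?_
      simp only [superBracket, sgn_zero_left, one_smul] at hz
      simp only [sgn_zero_left, one_smul, LinearMap.sub_apply, Module.End.mul_apply, polyRep_apply]
      rw [← Derivation.commutator_apply]
      congr 1
      refine MvPolynomial.derivation_ext fun i => ?_
      rw [Derivation.commutator_apply, polyDer_polyDer_X, polyDer_polyDer_X, hz]
      simp [polyDer_X, sub_smul]
    · obtain rfl := eq_zero_of_even_odd hy
      obtain rfl : z = 0 := Subtype.ext (by rw [hz]; simp [superBracket])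
      simp
  · obtain rfl := eq_zero_of_even_odd hx
    obtain rfl : z = 0 := Subtype.ext (by rw [hz]; simp [superBracket])
    simp

variable (p : ℕ) [Fact p.Prime] [CharP F p]

theorem polyRep_pow_char (w x z : evenPart F) (hx : (x : Matrix (Fin 3) (Fin 3) F) = w)
    (hz : (z : Matrix (Fin 3) (Fin 3) F) = (w : Matrix (Fin 3) (Fin 3) F) ^ p) :
    polyRep F x ^ p = polyRep F z + algebraMap F _ ((0 : Module.Dual F (evenPart F)) w ^ p) := by
  have hp : p ≠ 0 := (Fact.out : p.Prime).ne_zero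
  rw [LinearMap.zero_apply, zero_pow hp, map_zero, add_zero]
  obtain rfl : x = w := Subtype.ext hx
  have hpow : ∀ (n : ℕ) (j : Fin 3), (polyRep F x ^ n) (MvPolynomial.X j)
      = polyDer (x.1 ^ n) (MvPolynomial.X j) := by
    intro n j
    induction n with
    | zero => simp [polyDer_X, Matrix.one_apply]
    | succ n ih =>
      rw [pow_succ', Module.End.mul_apply, ih, polyRep_apply, polyDer_polyDer_X, pow_succ']
  have hD : derivationPowChar p (polyDer x.1) = polyDer z.1 :=
    MvPolynomial.derivation_ext fun j => (hpow p j).trans (by rw [hz])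
  exact LinearMap.ext fun f => DFunLike.congr_fun hD f

/-- The `u(𝔤₀, 0)`-module of polynomials in three variables. -/
def polyHom : Env p (evenPart F) 0 →ₐ[F] Module.End F (MvPolynomial (Fin 3) F) :=
  Env.lift (polyRep F) isSuperRep_polyRep (polyRep_pow_char p)

variable {p}

/-- The universal module with a maximal vector of weight `l` is nonzero for `χ = 0` and
`l ∈ 𝔽_p²`: it maps onto a module generated by a monomial. -/
theorem babyVerma_mk_one_ne_zero {l : F × F} (h1 : l.1 ^ p = l.1) (h2 : l.2 ^ p = l.2) :
    (Submodule.Quotient.mk 1 : BabyVerma p (0 : Module.Dual F (evenPart F)) l) ≠ 0 := by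
  obtain ⟨s, -, hs⟩ := exists_natCast_eq (p := p) h2
  obtain ⟨r, -, hr⟩ := exists_natCast_eq (p := p) (x := l.1 - l.2)
    (by rw [sub_pow_char, h1, h2])
  intro h
  rw [Submodule.Quotient.mk_eq_zero] at h
  obtain ⟨v, hvdef⟩ : ∃ v : MvPolynomial (Fin 3) F,
    v = MvPolynomial.X 0 ^ r * MvPolynomial.X 2 ^ s := ⟨_, rfl⟩
  have hv : v ≠ 0 := hvdef ▸ mul_ne_zero (pow_ne_zero _ (MvPolynomial.X_ne_zero _))
    (pow_ne_zero _ (MvPolynomial.X_ne_zero _))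
  have key : ∀ x ∈ Submodule.span (Env p (evenPart F) 0)
      {ι p (evenPart F) 0 (e12 F), ι p (evenPart F) 0 (SL21.h1 F) - algebraMap F _ l.1,
        ι p (evenPart F) 0 (SL21.h2 F) - algebraMap F _ l.2}, polyHom p x v = 0 := by
    intro x hx
    induction hx using Submodule.span_induction with
    | zero => simp
    | add x y _ _ hx hy => rw [map_add, LinearMap.add_apply, hx, hy, add_zero]
    | smul a x _ hx => rw [smul_eq_mul, map_mul, Module.End.mul_apply, hx, map_zero]
    | mem x hx =>
      have hX0 : ∀ w : Matrix (Fin 3) (Fin 3) F, polyDer w (MvPolynomial.X 0)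
        = w 0 0 • MvPolynomial.X 0 + w 1 0 • MvPolynomial.X 1 + w 2 0 • MvPolynomial.X 2 :=
        fun w => by rw [polyDer_X, Fin.sum_univ_three]
      have hX2 : ∀ w : Matrix (Fin 3) (Fin 3) F, polyDer w (MvPolynomial.X 2)
        = w 0 2 • MvPolynomial.X 0 + w 1 2 • MvPolynomial.X 1 + w 2 2 • MvPolynomial.X 2 :=
        fun w => by rw [polyDer_X, Fin.sum_univ_three]
      have hpw : ∀ n : ℕ, ∀ i : Fin 3, (n : MvPolynomial (Fin 3) F) * (MvPolynomial.X i ^ (n - 1)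
          * MvPolynomial.X i) = (n : MvPolynomial (Fin 3) F) * MvPolynomial.X i ^ n := by
        intro n i
        cases n with
        | zero => simp
        | succ n => simp [pow_succ]
      rcases hx with rfl | rfl | rfl
      · rw [polyHom, Env.lift_ι, polyRep_apply]
        simp [hvdef, Derivation.leibniz, Derivation.leibniz_pow, hX0, hX2, SL21.e12]
      · rw [map_sub, polyHom, Env.lift_ι, LinearMap.sub_apply, polyRep_apply, AlgHom.commutes,
          Module.algebraMap_end_apply, show l.1 = (r : F) + s by rw [hr, hs]; ring]
        simp [hvdef, Derivation.leibniz, Derivation.leibniz_pow, hX0, hX2, SL21.h1,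
          MvPolynomial.smul_eq_C_mul]
        linear_combination (MvPolynomial.X 2 ^ s) * hpw r 0 + (MvPolynomial.X 0 ^ r) * hpw s 2
      · rw [map_sub, polyHom, Env.lift_ι, LinearMap.sub_apply, polyRep_apply, AlgHom.commutes,
          Module.algebraMap_end_apply, ← hs]
        simp [hvdef, Derivation.leibniz, Derivation.leibniz_pow, hX0, hX2, SL21.h2,
          MvPolynomial.smul_eq_C_mul]
        linear_combination (MvPolynomial.X 0 ^ r) * hpw s 2
  have := key 1 h
  rw [map_one] at this
  exact hv this

end Poly

/-! ### The simple module `M(λ)` -/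

section EvenSimple

variable {p : ℕ} {F : Type u} [Field F] {χ : Module.Dual F (evenPart F)}

/-- The `𝔤₀`-operators of a `u(𝔤₀, χ)`-module. -/
def evenAct (p : ℕ) {F : Type u} [Field F] (χ : Module.Dual F (evenPart F)) (X : Type v)
    [AddCommGroup X] [Module F X] [Module (Env p (evenPart F) χ) X]
    [IsScalarTower F (Env p (evenPart F) χ) X] : EvenAction F X :=
  EvenAction.ofRep (Env.toRep p (evenPart F) χ X) Env.isSuperRep_toRep

variable {X : Type v} [AddCommGroup X] [Module F X] [Module (Env p (evenPart F) χ) X]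
  [IsScalarTower F (Env p (evenPart F) χ) X]

theorem span_vec_eq_top {l : F × F} {v : X} (h : (evenAct p χ X).IsMaximal l v)
    (hv : Submodule.span (Env p (evenPart F) χ) {v} = ⊤) :
    Submodule.span F (Set.range ((evenAct p χ X).vec v)) = ⊤ := by
  refine Env.eq_top_of_span hv (fun x y hy => ?_) (Submodule.subset_span ⟨0, by simp⟩)
  rw [← Env.toRep_apply, EvenAction.ofRep_apply _ Env.isSuperRep_toRep]
  obtain ⟨h1, h2, h3, h4⟩ := h.stable_span_vec hy
  simp only [LinearMap.add_apply, LinearMap.smul_apply]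
  exact add_mem (add_mem (add_mem (Submodule.smul_mem _ _ h1) (Submodule.smul_mem _ _ h2))
    (Submodule.smul_mem _ _ h3)) (Submodule.smul_mem _ _ h4)

theorem isMaximal_babyVerma (l : F × F) :
    (evenAct p χ (BabyVerma p χ l)).IsMaximal l (Submodule.Quotient.mk 1) := by
  have key : ∀ x ∈ ({ι p (evenPart F) χ (e12 F), ι p (evenPart F) χ (h1 F) - algebraMap F _ l.1,
        ι p (evenPart F) χ (h2 F) - algebraMap F _ l.2} : Set (Env p (evenPart F) χ)),
      (Submodule.Quotient.mk x : BabyVerma p χ l) = 0 := fun x hx =>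
    (Submodule.Quotient.mk_eq_zero _).2 (Submodule.subset_span hx)
  have hmk : ∀ x : Env p (evenPart F) χ, x • (Submodule.Quotient.mk 1 : BabyVerma p χ l)
      = Submodule.Quotient.mk x := fun x => by
    rw [← Submodule.Quotient.mk_smul, smul_eq_mul, mul_one]
  refine ⟨?_, ?_, ?_⟩
  · exact (hmk _).trans (key _ (by simp))
  · have := key (ι p (evenPart F) χ (h1 F) - algebraMap F _ l.1) (by simp)
    rw [← hmk, sub_smul, sub_eq_zero, algebraMap_smul] at this
    exact this
  · have := key (ι p (evenPart F) χ (h2 F) - algebraMap F _ l.2) (by simp)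
    rw [← hmk, sub_smul, sub_eq_zero, algebraMap_smul] at this
    exact this

theorem span_babyVerma (l : F × F) : Submodule.span (Env p (evenPart F) χ)
    {(Submodule.Quotient.mk 1 : BabyVerma p χ l)} = ⊤ :=
  span_mk_eq_top (by simp) _

theorem isMaximal_evenVec (l : F × F) :
    (evenAct p χ (EvenSimple p χ l)).IsMaximal l (evenVec p χ l) := by
  have h := isMaximal_babyVerma (p := p) (χ := χ) l
  exact ⟨congrArg Submodule.Quotient.mk h.e12, congrArg Submodule.Quotient.mk h.h1,
    congrArg Submodule.Quotient.mk h.h2⟩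

theorem span_evenVec (l : F × F) : Submodule.span (Env p (evenPart F) χ)
    {evenVec p χ l} = ⊤ :=
  span_mk_eq_top (span_babyVerma l) _

theorem e21₀_matrix_pow {n : ℕ} (hn : 2 ≤ n) :
    ((e21₀ F : Matrix (Fin 3) (Fin 3) F)) ^ n = 0 := by
  have : (e21₀ F : Matrix (Fin 3) (Fin 3) F) ^ 2 = 0 := by
    rw [pow_two]; simp [e21₀]
  exact pow_eq_zero_of_le hn this

variable [Fact p.Prime] [CharP F p]

omit [CharP F p] in
theorem evenAct_e21_pow (X : Type v) [AddCommGroup X] [Module F X]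
    [Module (Env p (evenPart F) 0) X] [IsScalarTower F (Env p (evenPart F) 0) X] :
    (evenAct p (0 : Module.Dual F (evenPart F)) X).e21 ^ p = 0 := by
  have hp : p.Prime := Fact.out
  have := Env.toRep_pow_char (p := p) (χ := 0) (X := X) (w := e21₀ F) (x := e21₀ F) (z := 0) rfl
    (e21₀_matrix_pow hp.two_le).symm
  rw [map_zero, zero_add, LinearMap.zero_apply, zero_pow hp.ne_zero, map_zero] at this
  exact this

theorem evenVec_ne_zero {l : F × F} (h1 : l.1 ^ p = l.1) (h2 : l.2 ^ p = l.2) :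
    evenVec p (0 : Module.Dual F (evenPart F)) l ≠ 0 := by
  intro h
  have h := (Submodule.Quotient.mk_eq_zero _).1 h
  have hm := isMaximal_babyVerma (p := p) (χ := 0) l
  have hproj := hm.proj_vec (evenAct_e21_pow _)
  have ha := fun x : BabyVerma p 0 l =>
    Env.one_sub_pow_smul (p := p) (χ := 0) (SL21.h1 F) l.1 (p - 1) x
  refine notMem_sumProper (F := F)
    (1 - (ι p (evenPart F) 0 (SL21.h1 F) - algebraMap F _ l.1) ^ (p - 1))
    (babyVerma_mk_one_ne_zero h1 h2) (span_babyVerma l) ?_ ?_ h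
  · intro x
    rw [ha]
    refine exists_smul_of_mem_span ?_
      (by rw [span_vec_eq_top hm (span_babyVerma l)]; trivial)
    rintro _ ⟨k, rfl⟩
    have := hproj k
    split_ifs at this
    · exact ⟨1, this.trans (one_smul _ _).symm⟩
    · exact ⟨0, this.trans (zero_smul _ _).symm⟩
  · rw [ha]
    exact hproj 0

end EvenSimple

/-! ### The `𝔤`-module `Λ(𝔤₋₁) ⊗ M` -/

section Induced

variable {F : Type u} [Field F] {M : Type v} [AddCommGroup M] [Module F M]

/-- A linear endomorphism of `M⁴` from its four components. -/
def ofComponents (f₀ f₁ f₂ f₃ : M × M × M × M →ₗ[F] M) : Module.End F (M × M × M × M) :=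
  f₀.prod (f₁.prod (f₂.prod f₃))

@[simp] theorem ofComponents_apply (f₀ f₁ f₂ f₃ : M × M × M × M →ₗ[F] M) (x : M × M × M × M) :
    ofComponents f₀ f₁ f₂ f₃ x = (f₀ x, f₁ x, f₂ x, f₃ x) := rfl

variable (F M) in
/-- The component of `1 ⊗ m`. -/
def π₀ : M × M × M × M →ₗ[F] M := LinearMap.fst F _ _

variable (F M) in
/-- The component of `e₃₁ ⊗ m`. -/
def π₁ : M × M × M × M →ₗ[F] M := LinearMap.fst F _ _ ∘ₗ LinearMap.snd F _ _

variable (F M) in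
/-- The component of `e₃₂ ⊗ m`. -/
def π₂ : M × M × M × M →ₗ[F] M :=
  LinearMap.fst F _ _ ∘ₗ LinearMap.snd F _ _ ∘ₗ LinearMap.snd F _ _

variable (F M) in
/-- The component of `e₃₁ e₃₂ ⊗ m`. -/
def π₃ : M × M × M × M →ₗ[F] M :=
  LinearMap.snd F _ _ ∘ₗ LinearMap.snd F _ _ ∘ₗ LinearMap.snd F _ _

@[simp] theorem π₀_apply (x : M × M × M × M) : π₀ F M x = x.1 := rfl
@[simp] theorem π₁_apply (x : M × M × M × M) : π₁ F M x = x.2.1 := rfl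
@[simp] theorem π₂_apply (x : M × M × M × M) : π₂ F M x = x.2.2.1 := rfl
@[simp] theorem π₃_apply (x : M × M × M × M) : π₃ F M x = x.2.2.2 := rfl

set_option maxHeartbeats 1000000 in
/-- The representation of `𝔤` on `Λ(𝔤₋₁) ⊗ M` induced from a representation `M` of `𝔤₀` on which
`𝔤₁` acts by zero; a vector is `1 ⊗ m₀ + e₃₁ ⊗ m₁ + e₃₂ ⊗ m₂ + e₃₁ e₃₂ ⊗ m₃`. -/
def EvenAction.induced (a : EvenAction F M) : Action F (M × M × M × M) where
  h1 := ofComponents (a.h1 ∘ₗ π₀ F M) (a.h1 ∘ₗ π₁ F M) (a.h1 ∘ₗ π₂ F M + π₂ F M)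
    (a.h1 ∘ₗ π₃ F M + π₃ F M)
  h2 := ofComponents (a.h2 ∘ₗ π₀ F M) (a.h2 ∘ₗ π₁ F M + π₁ F M) (a.h2 ∘ₗ π₂ F M)
    (a.h2 ∘ₗ π₃ F M + π₃ F M)
  e12 := ofComponents (a.e12 ∘ₗ π₀ F M) (a.e12 ∘ₗ π₁ F M) (a.e12 ∘ₗ π₂ F M - π₁ F M)
    (a.e12 ∘ₗ π₃ F M)
  e21 := ofComponents (a.e21 ∘ₗ π₀ F M) (a.e21 ∘ₗ π₁ F M - π₂ F M) (a.e21 ∘ₗ π₂ F M)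
    (a.e21 ∘ₗ π₃ F M)
  e13 := ofComponents (a.h1 ∘ₗ π₁ F M + a.e12 ∘ₗ π₂ F M) (-(a.e12 ∘ₗ π₃ F M))
    (a.h1 ∘ₗ π₃ F M + π₃ F M) 0
  e23 := ofComponents (a.e21 ∘ₗ π₁ F M + a.h2 ∘ₗ π₂ F M) (-(a.h2 ∘ₗ π₃ F M + π₃ F M))
    (a.e21 ∘ₗ π₃ F M) 0
  e31 := ofComponents 0 (π₀ F M) 0 (π₂ F M)
  e32 := ofComponents 0 0 (π₀ F M) (-π₁ F M)
  h1_e13 v := by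
    refine Prod.ext ?_ (Prod.ext ?_ (Prod.ext ?_ ?_)) <;> simp
  h2_e13 v := by
    refine Prod.ext ?_ (Prod.ext ?_ (Prod.ext ?_ ?_)) <;> simp <;> abel
  h1_e23 v := by
    refine Prod.ext ?_ (Prod.ext ?_ (Prod.ext ?_ ?_)) <;> simp <;> abel
  h2_e23 v := by
    refine Prod.ext ?_ (Prod.ext ?_ (Prod.ext ?_ ?_)) <;> simp
    abel
  h1_e31 v := by
    refine Prod.ext ?_ (Prod.ext ?_ (Prod.ext ?_ ?_)) <;> simp
  h2_e31 v := by
    refine Prod.ext ?_ (Prod.ext ?_ (Prod.ext ?_ ?_)) <;> simp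
  h1_e32 v := by
    refine Prod.ext ?_ (Prod.ext ?_ (Prod.ext ?_ ?_)) <;> simp
  h2_e32 v := by
    refine Prod.ext ?_ (Prod.ext ?_ (Prod.ext ?_ ?_)) <;> simp
    abel
  e12_e31 v := by
    refine Prod.ext ?_ (Prod.ext ?_ (Prod.ext ?_ ?_)) <;> simp
  e12_e32 v := by
    refine Prod.ext ?_ (Prod.ext ?_ (Prod.ext ?_ ?_)) <;> simp
  e21_e31 v := by
    refine Prod.ext ?_ (Prod.ext ?_ (Prod.ext ?_ ?_)) <;> simp
  e21_e32 v := by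
    refine Prod.ext ?_ (Prod.ext ?_ (Prod.ext ?_ ?_)) <;> simp
  e13_e12 v := by
    refine Prod.ext ?_ (Prod.ext ?_ (Prod.ext ?_ ?_)) <;> simp
  e13_e21 v := by
    refine Prod.ext ?_ (Prod.ext ?_ (Prod.ext ?_ ?_)) <;> simp <;> abel
  e23_e12 v := by
    refine Prod.ext ?_ (Prod.ext ?_ (Prod.ext ?_ ?_)) <;> simp <;> abel
  e23_e21 v := by
    refine Prod.ext ?_ (Prod.ext ?_ (Prod.ext ?_ ?_)) <;> simp
    abel
  e13_e31 v := by
    refine Prod.ext ?_ (Prod.ext ?_ (Prod.ext ?_ ?_)) <;> simp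
  e13_e32 v := by
    refine Prod.ext ?_ (Prod.ext ?_ (Prod.ext ?_ ?_)) <;> simp
    abel
  e23_e31 v := by
    refine Prod.ext ?_ (Prod.ext ?_ (Prod.ext ?_ ?_)) <;> simp
    abel
  e23_e32 v := by
    refine Prod.ext ?_ (Prod.ext ?_ (Prod.ext ?_ ?_)) <;> simp
    abel
  e32_e31 v := by
    refine Prod.ext ?_ (Prod.ext ?_ (Prod.ext ?_ ?_)) <;> simp
  e31_e31 v := by
    refine Prod.ext ?_ (Prod.ext ?_ (Prod.ext ?_ ?_)) <;> simp
  e32_e32 v := by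
    refine Prod.ext ?_ (Prod.ext ?_ (Prod.ext ?_ ?_)) <;> simp
  e23_e13 v := by
    refine Prod.ext ?_ (Prod.ext ?_ (Prod.ext ?_ ?_)) <;> simp
    abel
  e13_e13 v := by
    refine Prod.ext ?_ (Prod.ext ?_ (Prod.ext ?_ ?_)) <;> simp
  e23_e23 v := by
    refine Prod.ext ?_ (Prod.ext ?_ (Prod.ext ?_ ?_)) <;> simp
  h2_h1 v := by
    refine Prod.ext ?_ (Prod.ext ?_ (Prod.ext ?_ ?_)) <;> simp
    abel
  h1_e12 v := by
    refine Prod.ext ?_ (Prod.ext ?_ (Prod.ext ?_ ?_)) <;> simp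
  h2_e12 v := by
    refine Prod.ext ?_ (Prod.ext ?_ (Prod.ext ?_ ?_)) <;> simp
    abel
  h1_e21 v := by
    refine Prod.ext ?_ (Prod.ext ?_ (Prod.ext ?_ ?_)) <;> simp
    abel
  h2_e21 v := by
    refine Prod.ext ?_ (Prod.ext ?_ (Prod.ext ?_ ?_)) <;> simp
  e12_e21 v := by
    refine Prod.ext ?_ (Prod.ext ?_ (Prod.ext ?_ ?_)) <;> simp <;> abel

end Induced

section InducedPower

variable {F : Type u} [Field F] {M : Type v} [AddCommGroup M] [Module F M]

/-- The action of `f` on the right factor of `Λ(𝔤₋₁) ⊗ M`. -/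
def diagOp (f : Module.End F M) : Module.End F (M × M × M × M) :=
  ofComponents (f ∘ₗ π₀ F M) (f ∘ₗ π₁ F M) (f ∘ₗ π₂ F M) (f ∘ₗ π₃ F M)

variable (M) in
/-- Multiplication by `t` on the part of `Λ(𝔤₋₁) ⊗ M` of negative degree. -/
def negOp (t : F) : Module.End F (M × M × M × M) :=
  ofComponents 0 (t • π₁ F M) (t • π₂ F M) (t • π₃ F M)

variable (M) in
/-- The right multiplication of `𝔤₋₁` by the upper left block of a matrix, tensored with `M`. -/
def blockOp (w : Matrix (Fin 3) (Fin 3) F) : Module.End F (M × M × M × M) :=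
  ofComponents 0 (w 0 0 • π₁ F M + w 1 0 • π₂ F M) (w 0 1 • π₁ F M + w 1 1 • π₂ F M) 0

theorem diagOp_pow (f : Module.End F M) (n : ℕ) : diagOp f ^ n = diagOp (f ^ n) := by
  induction n with
  | zero => rfl
  | succ n ih => rw [pow_succ, ih, pow_succ]; rfl

theorem negOp_pow (t : F) {n : ℕ} (hn : n ≠ 0) : negOp M t ^ n = negOp M (t ^ n) := by
  induction n with
  | zero => exact absurd rfl hn
  | succ n ih =>
    rcases eq_or_ne n 0 with rfl | h
    · simp
    · rw [pow_succ, ih h, pow_succ]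
      refine LinearMap.ext fun x => ?_
      simp [negOp, smul_smul]

theorem blockOp_mul {x y : Matrix (Fin 3) (Fin 3) F} (hx : IsHomog 0 x) (hy : IsHomog 0 y) :
    blockOp M x * blockOp M y = blockOp M (y * x) := by
  obtain ⟨-, -, x3, x4⟩ := entries_of_even hx
  obtain ⟨y1, y2, -, -⟩ := entries_of_even hy
  refine LinearMap.ext fun v => Prod.ext ?_ (Prod.ext ?_ (Prod.ext ?_ ?_)) <;>
    simp [blockOp, Matrix.mul_apply, Fin.sum_univ_three, x3, x4, y1, y2] <;> module

theorem isHomog_zero_mul {x y : Matrix (Fin 3) (Fin 3) F} (hx : IsHomog 0 x) (hy : IsHomog 0 y) :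
    IsHomog 0 (x * y) := by
  intro a b hab
  rw [Matrix.mul_apply]
  refine Finset.sum_eq_zero fun c _ => ?_
  by_cases h : idxParity a + idxParity c = 0
  · have : idxParity c + idxParity b ≠ 0 := by
      intro h'
      apply hab
      generalize idxParity a = i at *
      generalize idxParity b = j at *
      generalize idxParity c = k at *
      decide +revert
    rw [hy _ _ this, mul_zero]
  · rw [hx _ _ h, zero_mul]

theorem isHomog_zero_pow {x : Matrix (Fin 3) (Fin 3) F} (hx : IsHomog 0 x) (n : ℕ) :
    IsHomog 0 (x ^ n) := by
  induction n with
  | zero =>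
    intro a b hab
    rw [pow_zero, Matrix.one_apply_ne]
    rintro rfl
    exact hab (CharTwo.add_self_eq_zero _)
  | succ n ih => rw [pow_succ]; exact isHomog_zero_mul ih hx

theorem blockOp_pow {x : Matrix (Fin 3) (Fin 3) F} (hx : IsHomog 0 x) {n : ℕ} (hn : n ≠ 0) :
    blockOp M x ^ n = blockOp M (x ^ n) := by
  induction n with
  | zero => exact absurd rfl hn
  | succ n ih =>
    rcases eq_or_ne n 0 with rfl | h
    · simp
    · rw [pow_succ', ih h, blockOp_mul hx (isHomog_zero_pow hx n), pow_succ]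

theorem pow_apply_two_two {x : Matrix (Fin 3) (Fin 3) F} (hx : IsHomog 0 x) (n : ℕ) :
    (x ^ n) 2 2 = x 2 2 ^ n := by
  induction n with
  | zero => simp
  | succ n ih =>
    obtain ⟨x1, x2, -, -⟩ := entries_of_even hx
    rw [pow_succ, Matrix.mul_apply, Fin.sum_univ_three, ih, x1, x2, pow_succ]
    simp

/-- An even element acts on `Λ(𝔤₋₁) ⊗ M` through both factors. -/
theorem induced_rep_of_even (ρ : evenPart F →ₗ[F] Module.End F M) (h : IsSuperRep ρ)
    {x : sl21 F} {w : evenPart F} (hx : (x : Matrix (Fin 3) (Fin 3) F) = w) :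
    (EvenAction.ofRep ρ h).induced.rep x
      = diagOp (ρ w) + (negOp M (w.1 2 2) - blockOp M w.1) := by
  obtain ⟨x1, x2, x3, x4⟩ := entries_of_even w.2.2
  have ht : w.1 2 2 = w.1 0 0 + w.1 1 1 := supertrace_eq (evenIncl F w)
  refine LinearMap.ext fun v => ?_
  rw [EvenAction.ofRep_apply ρ h w]
  generalize EvenAction.ofRep ρ h = a
  refine Prod.ext ?_ (Prod.ext ?_ (Prod.ext ?_ ?_)) <;>
    simp [Action.rep, cochain, EvenAction.induced, diagOp, negOp, blockOp, hx, x1, x2, x3, x4,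
      ht] <;> module

/-- If `M` is a `u(𝔤₀, χ)`-module, the `p`-power relations hold on `Λ(𝔤₋₁) ⊗ M`. -/
theorem induced_rep_pow_char {p : ℕ} [Fact p.Prime] [CharP F p] [Nontrivial M]
    {χ : Module.Dual F (evenPart F)} [Module (Env p (evenPart F) χ) M]
    [IsScalarTower F (Env p (evenPart F) χ) M] (w : evenPart F) (x z : sl21 F)
    (hx : (x : Matrix (Fin 3) (Fin 3) F) = w)
    (hz : (z : Matrix (Fin 3) (Fin 3) F) = (w : Matrix (Fin 3) (Fin 3) F) ^ p) :
    (evenAct p χ M).induced.rep x ^ p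
      = (evenAct p χ M).induced.rep z + algebraMap F _ (χ w ^ p) := by
  have hp : p ≠ 0 := (Fact.out : p.Prime).ne_zero
  have : CharP (Module.End F (M × M × M × M)) p :=
    charP_of_injective_algebraMap (algebraMap F (Module.End F (M × M × M × M))).injective p
  have hw0 := isHomog_of_mem_evenPart w
  obtain ⟨z', hz'⟩ : ∃ z' : evenPart F, (z : Matrix (Fin 3) (Fin 3) F) = z' :=
    ⟨⟨z.1, z.2, hz ▸ isHomog_zero_pow hw0 p⟩, rfl⟩
  have h1 : Commute (diagOp (Env.toRep p (evenPart F) χ M w))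
      (negOp M (w.1 2 2) - blockOp M w.1) := by
    refine LinearMap.ext fun v => ?_
    simp [diagOp, negOp, blockOp]
  have h2 : Commute (negOp M (w.1 2 2)) (blockOp M w.1) := by
    refine LinearMap.ext fun v => ?_
    simp [negOp, blockOp, smul_smul, mul_comm]
  rw [evenAct, induced_rep_of_even _ Env.isSuperRep_toRep hx,
    induced_rep_of_even _ Env.isSuperRep_toRep hz', add_pow_char_of_commute p h1,
    sub_pow_char_of_commute p h2, diagOp_pow, negOp_pow _ hp, blockOp_pow hw0 hp,
    Env.toRep_pow_char (w := w) rfl (hz'.symm.trans hz), ← hz', hz, pow_apply_two_two hw0]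
  have h3 : ∀ (f : Module.End F M) (c : F), diagOp (f + algebraMap F _ c)
      = diagOp f + algebraMap F _ c := fun f c => LinearMap.ext fun v => by
    simp [diagOp, Module.algebraMap_end_apply, Prod.smul_def]
  rw [h3]
  abel

end InducedPower

/-! ### The Kac module -/

section Kac

variable {p : ℕ} {F : Type u} [Field F] {χ : Module.Dual F (evenPart F)} {l : F × F}

/-- The class of `1 ⊗ v₀` in `Z^χ(λ)`. -/
def kacVec (p : ℕ) {F : Type u} [Field F] (χ : Module.Dual F (evenPart F)) (l : F × F) :
    Kac p χ l :=
  Submodule.Quotient.mk (1 ⊗ₜ[F] evenVec p χ l)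

theorem mk_mul_tmul {x : sl21 F} {w : evenPart F} (hx : (x : Matrix (Fin 3) (Fin 3) F) = w)
    (a : Env p (sl21 F) χ) (m : EvenSimple p χ l) :
    (Submodule.Quotient.mk ((a * ι p (sl21 F) χ x) ⊗ₜ[F] m) : Kac p χ l)
      = Submodule.Quotient.mk (a ⊗ₜ[F] (ι p (evenPart F) χ w • m)) := by
  rw [← sub_eq_zero, ← Submodule.Quotient.mk_sub, Submodule.Quotient.mk_eq_zero]
  exact Submodule.subset_span (Or.inl ⟨a, x, w, m, hx, rfl⟩)

theorem ι_smul_mk {x : sl21 F} {w : evenPart F} (hx : (x : Matrix (Fin 3) (Fin 3) F) = w)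
    (m : EvenSimple p χ l) :
    ι p (sl21 F) χ x • (Submodule.Quotient.mk (1 ⊗ₜ[F] m) : Kac p χ l)
      = Submodule.Quotient.mk (1 ⊗ₜ[F] (ι p (evenPart F) χ w • m)) := by
  rw [← mk_mul_tmul hx, one_mul, ← Submodule.Quotient.mk_smul, TensorProduct.smul_tmul',
    smul_eq_mul, mul_one]

theorem e13_smul_mk (m : EvenSimple p χ l) :
    ι p (sl21 F) χ (e13 F) • (Submodule.Quotient.mk (1 ⊗ₜ[F] m) : Kac p χ l) = 0 := by
  rw [← Submodule.Quotient.mk_smul, TensorProduct.smul_tmul', smul_eq_mul, mul_one,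
    Submodule.Quotient.mk_eq_zero]
  exact Submodule.subset_span (Or.inr ⟨1, m, Or.inl (by rw [one_mul])⟩)

theorem e23_smul_mk (m : EvenSimple p χ l) :
    ι p (sl21 F) χ (e23 F) • (Submodule.Quotient.mk (1 ⊗ₜ[F] m) : Kac p χ l) = 0 := by
  rw [← Submodule.Quotient.mk_smul, TensorProduct.smul_tmul', smul_eq_mul, mul_one,
    Submodule.Quotient.mk_eq_zero]
  exact Submodule.subset_span (Or.inr ⟨1, m, Or.inr (by rw [one_mul])⟩)

section Generic

variable {M : Type v} [AddCommGroup M] [Module F M] [Module (Env p (evenPart F) χ) M]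
  [IsScalarTower F (Env p (evenPart F) χ) M]

theorem span_mk_tmul (K : Submodule (Env p (sl21 F) χ) (Env p (sl21 F) χ ⊗[F] M))
    (hK : ∀ (w : evenPart F) (m : M), ι p (sl21 F) χ (evenIncl F w) • K.mkQ (1 ⊗ₜ[F] m)
      = K.mkQ (1 ⊗ₜ[F] (ι p (evenPart F) χ w • m)))
    {v : M} (hv : Submodule.span (Env p (evenPart F) χ) {v} = ⊤) :
    Submodule.span (Env p (sl21 F) χ) {K.mkQ (1 ⊗ₜ[F] v)} = ⊤ := by
  obtain ⟨S, hS⟩ : ∃ S, S = Submodule.span (Env p (sl21 F) χ) {K.mkQ (1 ⊗ₜ[F] v)} := ⟨_, rfl⟩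
  let N : Submodule F M :=
    { carrier := {m | K.mkQ (1 ⊗ₜ[F] m) ∈ S}
      zero_mem' := by simp
      add_mem' := fun {x y} hx hy => by
        simp only [Set.mem_ofPred_eq, TensorProduct.tmul_add, map_add] at *
        exact add_mem hx hy
      smul_mem' := fun c x hx => by
        simp only [Set.mem_ofPred_eq, TensorProduct.tmul_smul] at *
        have := S.smul_mem (algebraMap F (Env p (sl21 F) χ) c) hx
        rwa [← map_smul, algebraMap_smul] at this }
  have hN : N = ⊤ := by
    refine Env.eq_top_of_span hv (fun x m hm => ?_) ?_
    · change K.mkQ (1 ⊗ₜ[F] (ι p (evenPart F) χ x • m)) ∈ S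
      rw [← hK]
      exact S.smul_mem _ hm
    · change K.mkQ (1 ⊗ₜ[F] v) ∈ S
      rw [hS]
      exact Submodule.mem_span_singleton_self _
  rw [← hS, eq_top_iff]
  intro x _
  obtain ⟨t, rfl⟩ := K.mkQ_surjective x
  induction t using TensorProduct.induction_on with
  | zero => rw [map_zero]; exact zero_mem _
  | add x y hx hy => rw [map_add]; exact add_mem (hx trivial) (hy trivial)
  | tmul a m =>
    have hm : m ∈ N := hN ▸ Submodule.mem_top
    have : K.mkQ (a ⊗ₜ[F] m) = a • K.mkQ (1 ⊗ₜ[F] m) := by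
      rw [← map_smul, TensorProduct.smul_tmul', smul_eq_mul, mul_one]
    rw [this]
    exact S.smul_mem _ hm

/-- The map `u(𝔤, χ) ⊗ M → Λ(𝔤₋₁) ⊗ M`, which respects the defining relations of the Kac module
and does not kill `1 ⊗ m` for `m ≠ 0`. -/
theorem exists_map_induced [Fact p.Prime] [CharP F p] [Nontrivial M] :
    ∃ Φ : Env p (sl21 F) χ ⊗[F] M →ₗ[F] M × M × M × M,
      (∀ (b : Env p (sl21 F) χ) t, Φ t = 0 → Φ (b • t) = 0) ∧
      (∀ (b : Env p (sl21 F) χ) (x : sl21 F) (w : evenPart F) (m : M),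
        (x : Matrix (Fin 3) (Fin 3) F) = w →
        Φ ((b * ι p (sl21 F) χ x) ⊗ₜ[F] m) = Φ (b ⊗ₜ[F] (ι p (evenPart F) χ w • m))) ∧
      (∀ (b : Env p (sl21 F) χ) m, Φ ((b * ι p (sl21 F) χ (e13 F)) ⊗ₜ[F] m) = 0) ∧
      (∀ (b : Env p (sl21 F) χ) m, Φ ((b * ι p (sl21 F) χ (e23 F)) ⊗ₜ[F] m) = 0) ∧
      ∀ m, Φ (1 ⊗ₜ[F] m) = (m, 0, 0, 0) := by
  obtain ⟨a, ha⟩ : ∃ a, a = evenAct p χ M := ⟨_, rfl⟩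
  obtain ⟨f, hf⟩ : ∃ f : Env p (sl21 F) χ →ₐ[F] Module.End F (M × M × M × M),
      ∀ x, f (ι p (sl21 F) χ x) = a.induced.rep x :=
    ⟨Env.lift a.induced.rep a.induced.isSuperRep_rep (ha ▸ induced_rep_pow_char),
      Env.lift_ι _ _ _⟩
  let Φ : Env p (sl21 F) χ ⊗[F] M →ₗ[F] M × M × M × M :=
    TensorProduct.lift ((LinearMap.lcomp F (M × M × M × M) (LinearMap.inl F M (M × M × M)))
      ∘ₗ f.toLinearMap)
  have hΦ : ∀ b m, Φ (b ⊗ₜ[F] m) = f b (m, 0, 0, 0) := fun b m => rfl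
  have hsmul : ∀ (b : Env p (sl21 F) χ) t, Φ (b • t) = f b (Φ t) := by
    intro b t
    induction t using TensorProduct.induction_on with
    | zero => simp
    | add x y hx hy => rw [smul_add, map_add, hx, hy, map_add, map_add]
    | tmul c m =>
      rw [TensorProduct.smul_tmul', hΦ, hΦ, smul_eq_mul, map_mul, Module.End.mul_apply]
  refine ⟨Φ, fun b t ht => by rw [hsmul, ht, map_zero], fun b x w m hx => ?_, fun b m => ?_,
    fun b m => ?_, fun m => by rw [hΦ, map_one, Module.End.one_apply]⟩
  · have : a.induced.rep x (m, 0, 0, 0) = (ι p (evenPart F) χ w • m, 0, 0, 0) := by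
      rw [ha, evenAct, induced_rep_of_even _ Env.isSuperRep_toRep hx]
      simp [diagOp, negOp, blockOp, Env.toRep_apply]
    rw [hΦ, hΦ, map_mul, Module.End.mul_apply, hf, this]
  · have : a.induced.rep (e13 F) (m, 0, 0, 0) = 0 := by
      simp [Action.rep, cochain, e13, EvenAction.induced]
    rw [hΦ, map_mul, Module.End.mul_apply, hf, this, map_zero]
  · have : a.induced.rep (e23 F) (m, 0, 0, 0) = 0 := by
      simp [Action.rep, cochain, e23, EvenAction.induced]
    rw [hΦ, map_mul, Module.End.mul_apply, hf, this, map_zero]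

end Generic

theorem span_kacVec : Submodule.span (Env p (sl21 F) χ) {kacVec p χ l} = ⊤ :=
  span_mk_tmul (kacRel p χ l) (fun w m => ι_smul_mk (x := evenIncl F w) rfl m) (span_evenVec l)

theorem kacVec_ne_zero [Fact p.Prime] [CharP F p]
    (hv : evenVec p χ l ≠ 0) : kacVec p χ l ≠ 0 := by
  intro h
  have h := (Submodule.Quotient.mk_eq_zero _).1 h
  have : Nontrivial (EvenSimple p χ l) := ⟨_, _, hv⟩
  obtain ⟨Φ, hsmul, h0, h1, h2, hone⟩ :=
    exists_map_induced (p := p) (χ := χ) (M := EvenSimple p χ l)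
  have key : ∀ t ∈ kacRel p χ l, Φ t = 0 := by
    intro t ht
    induction ht using Submodule.span_induction with
    | zero => exact map_zero _
    | add x y _ _ hx hy => rw [map_add, hx, hy, add_zero]
    | smul b x _ hx => exact hsmul b x hx
    | mem x hx =>
      rcases hx with ⟨b, x, x₀, m, hx, rfl⟩ | ⟨b, m, rfl | rfl⟩
      · rw [map_sub, h0 b x x₀ m hx, sub_self]
      · exact h1 b m
      · exact h2 b m
  exact hv (congrArg Prod.fst ((hone _).symm.trans (key _ h)))

end Kac

/-! ### Highest weight modules over `𝔤` -/

section HighestWeight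

variable {F : Type u} [Field F] {V : Type v} [AddCommGroup V] [Module F V]

/-- `v` is a maximal vector of weight `l` for `𝔤`. -/
structure Action.IsMaximal (a : Action F V) (l : F × F) (v : V) : Prop
    extends EvenAction.IsMaximal a.toEvenAction l v where
  e13 : a.e13 v = 0
  e23 : a.e23 v = 0

/-- `W` is stable under the operators of `𝔤`. -/
structure Action.Stable (a : Action F V) (W : Submodule F V) : Prop where
  h1 : ∀ x ∈ W, a.h1 x ∈ W
  h2 : ∀ x ∈ W, a.h2 x ∈ W
  e12 : ∀ x ∈ W, a.e12 x ∈ W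
  e21 : ∀ x ∈ W, a.e21 x ∈ W
  e13 : ∀ x ∈ W, a.e13 x ∈ W
  e23 : ∀ x ∈ W, a.e23 x ∈ W
  e31 : ∀ x ∈ W, a.e31 x ∈ W
  e32 : ∀ x ∈ W, a.e32 x ∈ W

theorem Action.Stable.rep_mem {a : Action F V} {W : Submodule F V} (h : a.Stable W) (x : sl21 F)
    {v : V} (hv : v ∈ W) : a.rep x v ∈ W := by
  simp only [Action.rep, cochain, LinearMap.coe_mk, AddHom.coe_mk, LinearMap.add_apply,
    LinearMap.smul_apply]
  have := h.h1 v hv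
  have := h.h2 v hv
  have := h.e12 v hv
  have := h.e21 v hv
  have := h.e13 v hv
  have := h.e23 v hv
  have := h.e31 v hv
  have := h.e32 v hv
  exact add_mem (add_mem (add_mem (add_mem (add_mem (add_mem (add_mem
    (W.smul_mem _ ‹_›) (W.smul_mem _ ‹_›)) (W.smul_mem _ ‹_›)) (W.smul_mem _ ‹_›))
    (W.smul_mem _ ‹_›)) (W.smul_mem _ ‹_›)) (W.smul_mem _ ‹_›)) (W.smul_mem _ ‹_›)

namespace Action

/-- The vectors `e₃₁ⁱ e₃₂ʲ e₂₁ᵏ v` with `i, j ≤ 1`. -/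
def monomials (a : Action F V) (v : V) : Set V :=
  {x | ∃ k, x = a.vec v k ∨ x = a.e31 (a.vec v k) ∨ x = a.e32 (a.vec v k) ∨
    x = a.e31 (a.e32 (a.vec v k))}

variable {a : Action F V} {l : F × F} {v : V}

theorem IsMaximal.e13_e23_vec (h : a.IsMaximal l v) (k : ℕ) :
    a.e13 (a.vec v k) = 0 ∧ a.e23 (a.vec v k) = 0 := by
  induction k with
  | zero => simp [h.e13, h.e23]
  | succ k ih => rw [← EvenAction.e21_vec, a.e13_e21, a.e23_e21, ih.1, ih.2]; simp

theorem IsMaximal.e13_vec (h : a.IsMaximal l v) (k : ℕ) : a.e13 (a.vec v k) = 0 :=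
  (h.e13_e23_vec k).1

theorem IsMaximal.e23_vec (h : a.IsMaximal l v) (k : ℕ) : a.e23 (a.vec v k) = 0 :=
  (h.e13_e23_vec k).2

theorem IsMaximal.e12_vec (h : a.IsMaximal l v) (k : ℕ) :
    a.e12 (a.vec v k) = (k * (l.1 - l.2 - k + 1)) • a.vec v (k - 1) := by
  cases k with
  | zero => simp [h.e12]
  | succ k => rw [h.e12_vec_succ]; push_cast; congr 1; ring

theorem stable_span {S : Set V} {W : Submodule F V} (hW : W = Submodule.span F S)
    (h1 : ∀ x ∈ S, a.h1 x ∈ W) (h2 : ∀ x ∈ S, a.h2 x ∈ W)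
    (e12 : ∀ x ∈ S, a.e12 x ∈ W) (e21 : ∀ x ∈ S, a.e21 x ∈ W) (e13 : ∀ x ∈ S, a.e13 x ∈ W)
    (e23 : ∀ x ∈ S, a.e23 x ∈ W) (e31 : ∀ x ∈ S, a.e31 x ∈ W) (e32 : ∀ x ∈ S, a.e32 x ∈ W) :
    a.Stable W := by
  have key : ∀ f : Module.End F V, (∀ x ∈ S, f x ∈ W) → ∀ x ∈ W, f x ∈ W := by
    intro f hf x hx
    have : W ≤ W.comap f := by
      conv_lhs => rw [hW]
      exact Submodule.span_le.2 hf
    exact this hx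
  exact ⟨key _ h1, key _ h2, key _ e12, key _ e21, key _ e13, key _ e23, key _ e31, key _ e32⟩

/-- The monomials in a maximal vector span a submodule. -/
theorem IsMaximal.stable_monomials (h : a.IsMaximal l v) :
    a.Stable (Submodule.span F (a.monomials v)) := by
  obtain ⟨W, hW⟩ : ∃ W, W = Submodule.span F (a.monomials v) := ⟨_, rfl⟩
  rw [← hW]
  have m0 : ∀ k, a.vec v k ∈ W := fun k => hW ▸ Submodule.subset_span ⟨k, by simp⟩
  have m1 : ∀ k, a.e31 (a.vec v k) ∈ W := fun k => hW ▸ Submodule.subset_span ⟨k, by simp⟩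
  have m2 : ∀ k, a.e32 (a.vec v k) ∈ W := fun k => hW ▸ Submodule.subset_span ⟨k, by simp⟩
  have m3 : ∀ k, a.e31 (a.e32 (a.vec v k)) ∈ W := fun k =>
    hW ▸ Submodule.subset_span ⟨k, by simp⟩
  refine stable_span hW ?_ ?_ ?_ ?_ ?_ ?_ ?_ ?_ <;> rintro _ ⟨k, rfl | rfl | rfl | rfl⟩ <;>
    (try simp only [a.h1_e31, a.h1_e32, a.h2_e31, a.h2_e32, a.e12_e31, a.e12_e32, a.e21_e31, a.e21_e32,
      a.e13_e31, a.e13_e32, a.e23_e31, a.e23_e32, a.e32_e31, a.e31_e31, a.e32_e32,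
      h.h1_vec, h.h2_vec, h.e12_vec, h.e13_vec, h.e23_vec, EvenAction.e21_vec,
      map_smul, map_add, map_sub, map_zero, neg_zero]) <;>
    first
    | exact zero_mem _
    | (repeat' first
         | apply add_mem
         | apply sub_mem
         | apply neg_mem
         | apply Submodule.smul_mem
         | apply m0
         | apply m1
         | apply m2
         | apply m3
         | apply zero_mem)

end Action

end HighestWeight

/-! ### The simple module `S(λ)` for `χ = 0` -/

section Simple

variable {p : ℕ} {F : Type u} [Field F] {χ : Module.Dual F (evenPart F)}

/-- The `𝔤`-operators of a `u(𝔤, χ)`-module. -/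
def act (p : ℕ) {F : Type u} [Field F] (χ : Module.Dual F (evenPart F)) (two : (2 : F) ≠ 0)
    (X : Type v) [AddCommGroup X] [Module F X] [Module (Env p (sl21 F) χ) X]
    [IsScalarTower F (Env p (sl21 F) χ) X] : Action F X :=
  Action.ofRep (Env.toRep p (sl21 F) χ X) Env.isSuperRep_toRep two

section

variable {X : Type v} [AddCommGroup X] [Module F X] [Module (Env p (sl21 F) χ) X]
  [IsScalarTower F (Env p (sl21 F) χ) X] (two : (2 : F) ≠ 0)

theorem rep_act : (act p χ two X).rep = Env.toRep p (sl21 F) χ X := Action.rep_ofRep _ _ _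

theorem Action.Stable.ι_smul_mem {two : (2 : F) ≠ 0} {W : Submodule F X}
    (hW : (act p χ two X).Stable W) (x : sl21 F) (v : X) (hv : v ∈ W) :
    ι p (sl21 F) χ x • v ∈ W := by
  rw [← Env.toRep_apply, ← rep_act two]
  exact hW.rep_mem x hv

theorem span_monomials_eq_top {l : F × F} {v : X} (h : (act p χ two X).IsMaximal l v)
    (hv : Submodule.span (Env p (sl21 F) χ) {v} = ⊤) :
    Submodule.span F ((act p χ two X).monomials v) = ⊤ :=
  Env.eq_top_of_span hv h.stable_monomials.ι_smul_mem
    (Submodule.subset_span ⟨0, Or.inl (by simp)⟩)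

end

variable (two : (2 : F) ≠ 0) {l : F × F}

theorem isMaximal_kacVec : (act p χ two (Kac p χ l)).IsMaximal l (kacVec p χ l) := by
  have h := isMaximal_evenVec (p := p) (χ := χ) l
  refine ⟨⟨?_, ?_, ?_⟩, e13_smul_mk _, e23_smul_mk _⟩
  · refine (ι_smul_mk (w := e12 F) rfl _).trans ?_
    have h0 : ι p (evenPart F) χ (e12 F) • evenVec p χ l = 0 := h.e12
    rw [h0, TensorProduct.tmul_zero]; rfl
  · refine (ι_smul_mk (w := h1 F) rfl _).trans ?_
    have h0 : ι p (evenPart F) χ (h1 F) • evenVec p χ l = l.1 • evenVec p χ l := h.h1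
    rw [h0, TensorProduct.tmul_smul]; rfl
  · refine (ι_smul_mk (w := h2 F) rfl _).trans ?_
    have h0 : ι p (evenPart F) χ (h2 F) • evenVec p χ l = l.2 • evenVec p χ l := h.h2
    rw [h0, TensorProduct.tmul_smul]; rfl

theorem isMaximal_simpleVec : (act p χ two (Simple p χ l)).IsMaximal l (simpleVec p χ l) := by
  have h := isMaximal_kacVec (p := p) (χ := χ) (l := l) two
  exact ⟨⟨congrArg Submodule.Quotient.mk h.e12, congrArg Submodule.Quotient.mk h.h1,
    congrArg Submodule.Quotient.mk h.h2⟩, congrArg Submodule.Quotient.mk h.e13,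
    congrArg Submodule.Quotient.mk h.e23⟩

theorem span_simpleVec : Submodule.span (Env p (sl21 F) χ) {simpleVec p χ l} = ⊤ :=
  span_mk_eq_top span_kacVec _

/-- A simple restricted `𝔤`-module with a maximal vector `v` of weight `l`. -/
structure Action.IsSimpleHighestWeight {V : Type v} [AddCommGroup V] [Module F V] (p : ℕ)
    (a : Action F V) (l : F × F) (v : V) : Prop
    extends toMaximal : a.IsMaximal l v where
  ne_zero : v ≠ 0
  simple : ∀ W : Submodule F V, a.Stable W → W = ⊥ ∨ W = ⊤
  e21_pow : a.e21 ^ p = 0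
  h1_pow : a.h1 ^ p = a.h1
  h2_pow : a.h2 ^ p = a.h2

theorem h1_matrix_pow {n : ℕ} (hn : n ≠ 0) :
    ((h1 F : Matrix (Fin 3) (Fin 3) F)) ^ n = h1 F := by
  have h : IsIdempotentElem (h1 F : Matrix (Fin 3) (Fin 3) F) := by
    simp [IsIdempotentElem, h1, mul_add, add_mul]
  exact h.pow_eq hn

theorem h2_matrix_pow {n : ℕ} (hn : n ≠ 0) :
    ((h2 F : Matrix (Fin 3) (Fin 3) F)) ^ n = h2 F := by
  have h : IsIdempotentElem (h2 F : Matrix (Fin 3) (Fin 3) F) := by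
    simp [IsIdempotentElem, h2, mul_add, add_mul]
  exact h.pow_eq hn

section

variable {X : Type v} [AddCommGroup X] [Module F X] [Module (Env p (sl21 F) χ) X]
  [IsScalarTower F (Env p (sl21 F) χ) X] [Fact p.Prime]

theorem act_e21_pow : (act p χ two X).e21 ^ p = algebraMap F _ (χ (e21₀ F) ^ p) := by
  have := Env.toRep_pow_char (p := p) (χ := χ) (X := X) (w := e21₀ F) (x := e21 F) (z := 0) rfl
    (e21₀_matrix_pow (Fact.out : p.Prime).two_le).symm
  rw [map_zero, zero_add] at this
  exact this

theorem act_h1_pow :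
    (act p χ two X).h1 ^ p = (act p χ two X).h1 + algebraMap F _ (χ (h1 F) ^ p) :=
  Env.toRep_pow_char (p := p) (χ := χ) (X := X) (w := h1 F) (x := evenIncl F (h1 F))
    (z := evenIncl F (h1 F)) rfl (h1_matrix_pow (Fact.out : p.Prime).ne_zero).symm

theorem act_h2_pow :
    (act p χ two X).h2 ^ p = (act p χ two X).h2 + algebraMap F _ (χ (h2 F) ^ p) :=
  Env.toRep_pow_char (p := p) (χ := χ) (X := X) (w := h2 F) (x := evenIncl F (h2 F))
    (z := evenIncl F (h2 F)) rfl (h2_matrix_pow (Fact.out : p.Prime).ne_zero).symm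

end

/-- A polynomial in `h₁` and `h₁ + h₂`, which projects a restricted highest weight module of highest
weight `l` onto the line of the maximal vector. -/
def Action.proj {V : Type v} [AddCommGroup V] [Module F V] (p : ℕ) (a : Action F V) (l : F × F) :
    Module.End F V :=
  (1 - (a.h1 + a.h2 - algebraMap F (Module.End F V) (l.1 + l.2)) ^ (p - 1))
    * (1 - (a.h1 - algebraMap F (Module.End F V) l.1) ^ (p - 1))

section Proj

variable {V : Type v} [AddCommGroup V] [Module F V] {a : Action F V} {v : V}

theorem Action.IsMaximal.sum_h_vec (h : a.IsMaximal l v) (k : ℕ) :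
    (a.h1 + a.h2) (a.vec v k) = (l.1 + l.2) • a.vec v k := by
  rw [LinearMap.add_apply, h.h1_vec, h.h2_vec]; module

theorem Action.sum_h_e31 {x : V} {c : F} (hx : (a.h1 + a.h2) x = c • x) :
    (a.h1 + a.h2) (a.e31 x) = (c + 1) • a.e31 x := by
  rw [LinearMap.add_apply] at *
  rw [a.h1_e31, a.h2_e31, add_smul, ← map_smul, ← hx, map_add]; module

theorem Action.sum_h_e32 {x : V} {c : F} (hx : (a.h1 + a.h2) x = c • x) :
    (a.h1 + a.h2) (a.e32 x) = (c + 1) • a.e32 x := by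
  rw [LinearMap.add_apply] at *
  rw [a.h1_e32, a.h2_e32, add_smul, ← map_smul, ← hx, map_add]; module

variable [Fact p.Prime]

theorem Action.proj_of_eigen {x : V} {c t : F} (hx : (a.h1 + a.h2) x = c • x)
    (hc : c - (l.1 + l.2) = t) (ht : t ≠ 0) (htp : t ^ p = t) : a.proj p l x = 0 := by
  have hcomm : Commute (1 - (a.h1 + a.h2 - algebraMap F (Module.End F V) (l.1 + l.2)) ^ (p - 1))
      (1 - (a.h1 - algebraMap F (Module.End F V) l.1) ^ (p - 1)) := by
    have : Commute (a.h1 + a.h2) a.h1 := LinearMap.ext fun x => by simp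
    refine (Commute.one_left _).sub_left ((Commute.one_right _).sub_right ?_)
    refine Commute.pow_pow ?_ _ _
    exact ((this.sub_right (Algebra.commutes _ _).symm)).sub_left (Algebra.commutes _ _)
  rw [proj, hcomm.eq, Module.End.mul_apply, one_sub_pow_apply hx, hc, pow_pred_eq_one htp ht]
  simp

theorem Action.IsMaximal.proj_vec [CharP F p] (h : a.IsMaximal l v) (hp : a.e21 ^ p = 0) (k : ℕ) :
    a.proj p l (a.vec v k) = if k = 0 then v else 0 := by
  have hp1 : p - 1 ≠ 0 := by have := (Fact.out : p.Prime).two_le; omega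
  rw [Action.proj, Module.End.mul_apply, EvenAction.IsMaximal.proj_vec h.toIsMaximal hp k]
  split_ifs
  · have := h.sum_h_vec 0
    rw [EvenAction.vec_zero] at this
    rw [one_sub_pow_apply this, sub_self, zero_pow hp1, sub_zero, one_smul]
  · rw [map_zero]

theorem Action.IsMaximal.proj_e31_vec (h : a.IsMaximal l v) (k : ℕ) :
    a.proj p l (a.e31 (a.vec v k)) = 0 :=
  Action.proj_of_eigen (Action.sum_h_e31 (h.sum_h_vec k)) (t := 1) (by ring) one_ne_zero
    (one_pow _)

theorem Action.IsMaximal.proj_e32_vec (h : a.IsMaximal l v) (k : ℕ) :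
    a.proj p l (a.e32 (a.vec v k)) = 0 :=
  Action.proj_of_eigen (Action.sum_h_e32 (h.sum_h_vec k)) (t := 1) (by ring) one_ne_zero
    (one_pow _)

theorem Action.IsMaximal.proj_e31_e32_vec [CharP F p] (two : (2 : F) ≠ 0) (h : a.IsMaximal l v)
    (k : ℕ) : a.proj p l (a.e31 (a.e32 (a.vec v k))) = 0 :=
  Action.proj_of_eigen (Action.sum_h_e31 (Action.sum_h_e32 (h.sum_h_vec k))) (t := 2) (by ring)
    two (by exact_mod_cast natCast_pow_char (F := F) (p := p) 2)

end Proj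

variable [Fact p.Prime] [CharP F p]

section

variable {X : Type v} [AddCommGroup X] [Module F X] [Module (Env p (sl21 F) 0) X]
  [IsScalarTower F (Env p (sl21 F) 0) X]

/-- Every proper submodule lies in the kernel of the projector to the line of the maximal vector, so
that this vector is not in the sum of the proper submodules. -/
theorem notMem_sumProper_of_isMaximal {two : (2 : F) ≠ 0} {v : X} (hv : v ≠ 0)
    (hgen : Submodule.span (Env p (sl21 F) 0) {v} = ⊤) (hm : (act p 0 two X).IsMaximal l v) :
    v ∉ sumProper (Env p (sl21 F) 0) X := by
  have he : (act p 0 two X).e21 ^ p = 0 := by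
    rw [act_e21_pow, LinearMap.zero_apply, zero_pow (Fact.out : p.Prime).ne_zero, map_zero]
  have ha : ∀ x : X,
      ((1 - (ι p (sl21 F) 0 (evenIncl F (SL21.h1 F) + evenIncl F (SL21.h2 F))
        - algebraMap F _ (l.1 + l.2)) ^ (p - 1))
        * (1 - (ι p (sl21 F) 0 (evenIncl F (SL21.h1 F)) - algebraMap F _ l.1) ^ (p - 1))) • x
      = (act p 0 two X).proj p l x := by
    intro x
    rw [mul_smul, Env.one_sub_pow_smul, Env.one_sub_pow_smul, map_add]
    rfl
  refine notMem_sumProper (F := F) _ hv hgen (fun x => ?_) ((ha _).trans ?_)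
  · rw [ha]
    refine exists_smul_of_mem_span (S := (act p 0 two X).monomials v) ?_
      (by rw [span_monomials_eq_top two hm hgen]; trivial)
    rintro _ ⟨k, rfl | rfl | rfl | rfl⟩
    · rw [hm.proj_vec he]
      split_ifs
      · exact ⟨1, (one_smul _ _).symm⟩
      · exact ⟨0, (zero_smul _ _).symm⟩
    · exact ⟨0, by rw [hm.proj_e31_vec, zero_smul]⟩
    · exact ⟨0, by rw [hm.proj_e32_vec, zero_smul]⟩
    · exact ⟨0, by rw [hm.proj_e31_e32_vec two, zero_smul]⟩
  · exact hm.proj_vec he 0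

end

end Simple

/-! ### The structure of atypical simple modules -/

section Structure

variable {F : Type u} [Field F] {V : Type v} [AddCommGroup V] [Module F V]

/-- An eigenvector in the span of eigenvectors lies in the span of those of the same eigenvalue. -/
theorem mem_span_of_eigen {f : Module.End F V} {ι : Type w} {b : ι → V} {μ : ι → F}
    (hb : ∀ i, f (b i) = μ i • b i) {x : V} (hx : x ∈ Submodule.span F (Set.range b)) {ν : F}
    (hfx : f x = ν • x) : x ∈ Submodule.span F (b '' {i | μ i = ν}) := by
  have hsplit : Submodule.span F (Set.range b) =
      Submodule.span F (b '' {i | μ i = ν}) ⊔ Submodule.span F (b '' {i | μ i ≠ ν}) := by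
    rw [← Submodule.span_union, ← Set.image_union, ← Set.image_univ]
    congr 2
    ext i
    simp [em]
  rw [hsplit] at hx
  obtain ⟨y, hy, z, hz, rfl⟩ := Submodule.mem_sup.1 hx
  have hy' : y ∈ f.eigenspace ν := by
    refine (Submodule.span_le.2 ?_) hy
    rintro _ ⟨i, hi, rfl⟩
    exact Module.End.mem_eigenspace_iff.2 (by rw [hb i, hi])
  have hz1 : z ∈ f.eigenspace ν := by
    have := sub_mem (Module.End.mem_eigenspace_iff.2 hfx) hy'
    rwa [add_sub_cancel_left] at this
  have hz2 : z ∈ ⨆ j ≠ ν, f.eigenspace j := by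
    refine (Submodule.span_le.2 ?_) hz
    rintro _ ⟨i, hi, rfl⟩
    exact Submodule.mem_iSup_of_mem (μ i) (Submodule.mem_iSup_of_mem hi
      (Module.End.mem_eigenspace_iff.2 (hb i)))
  have hz0 := (Submodule.disjoint_def.1 (Module.End.eigenspaces_iSupIndep f ν)) z hz1 hz2
  rw [hz0, add_zero]
  exact hy

theorem eq_zero_of_eigen {f : Module.End F V} {x : V} {μ ν : F} (h1 : f x = μ • x)
    (h2 : f x = ν • x) (h : μ ≠ ν) : x = 0 := by
  have : (μ - ν) • x = 0 := by rw [sub_smul, ← h1, ← h2, sub_self]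
  exact (smul_eq_zero.1 this).resolve_left (sub_ne_zero.2 h)

theorem two_ne_zero_of_lt {p : ℕ} [CharP F p] (hp : 2 < p) : (2 : F) ≠ 0 := by
  exact_mod_cast natCast_ne_zero_of_lt (F := F) (p := p) two_ne_zero hp

variable {p : ℕ} [Fact p.Prime] [CharP F p] {a : Action F V} {l : F × F} {v : V}

namespace Action

/-- The part of `V` spanned by the vectors `e₂₁ᵏ v`. -/
def degZero (a : Action F V) (v : V) : Submodule F V := Submodule.span F (Set.range (a.vec v))

/-- The part of `V` spanned by the vectors `e₃₁ e₂₁ᵏ v` and `e₃₂ e₂₁ᵏ v`. -/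
def degOne (a : Action F V) (v : V) : Submodule F V :=
  Submodule.span F {x | ∃ k, x = a.e31 (a.vec v k) ∨ x = a.e32 (a.vec v k)}

namespace IsSimpleHighestWeight

omit [Fact p.Prime] [CharP F p] in
theorem span_of_isMaximal (h : a.IsSimpleHighestWeight p l v) {x : V} {m : F × F}
    (hx : a.IsMaximal m x) (hx0 : x ≠ 0) : Submodule.span F (a.monomials x) = ⊤ := by
  refine (h.simple _ hx.stable_monomials).resolve_left fun hbot => hx0 ?_
  have : x ∈ Submodule.span F (a.monomials x) :=
    Submodule.subset_span ⟨0, Or.inl (EvenAction.vec_zero).symm⟩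
  rw [hbot] at this
  exact this

omit [Fact p.Prime] [CharP F p] in
theorem span_monomials (h : a.IsSimpleHighestWeight p l v) :
    Submodule.span F (a.monomials v) = ⊤ := h.span_of_isMaximal h.toMaximal h.ne_zero

theorem proj_self (h : a.IsSimpleHighestWeight p l v) : a.proj p l v = v :=
  h.toMaximal.proj_vec h.e21_pow 0

/-- A singular vector `e₂₁ᵏ v` with `k > 0` vanishes: the submodule it generates is killed by the
projection onto the line of `v`. -/
theorem vec_eq_zero_of_isMaximal (h : a.IsSimpleHighestWeight p l v) (two : (2 : F) ≠ 0) {k : ℕ}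
    (hk : k ≠ 0) {m : F × F} (hm : a.IsMaximal m (a.vec v k)) : a.vec v k = 0 := by
  by_contra h0
  have htop := h.span_of_isMaximal hm h0
  have hle : Submodule.span F (a.monomials (a.vec v k)) ≤ LinearMap.ker (a.proj p l) := by
    rw [Submodule.span_le]
    rintro _ ⟨j, rfl | rfl | rfl | rfl⟩ <;> simp only [EvenAction.vec_add, SetLike.mem_coe,
      LinearMap.mem_ker]
    · rw [h.toMaximal.proj_vec h.e21_pow, if_neg (by omega)]
    · exact h.toMaximal.proj_e31_vec _
    · exact h.toMaximal.proj_e32_vec _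
    · exact h.toMaximal.proj_e31_e32_vec two _
  rw [htop] at hle
  have : a.proj p l v = 0 := hle trivial
  exact h.ne_zero (h.proj_self.symm.trans this)

theorem vec_eq_zero (h : a.IsSimpleHighestWeight p l v) (two : (2 : F) ≠ 0) {r : ℕ}
    (hl : (r : F) = l.1 - l.2) {k : ℕ} (hk : r < k) : a.vec v k = 0 := by
  have h1 : a.vec v (r + 1) = 0 := by
    refine h.vec_eq_zero_of_isMaximal two (m := (l.1 - (r + 1 : ℕ), l.2 + (r + 1 : ℕ)))
      (Nat.succ_ne_zero r) ⟨⟨?_, h.h1_vec _, h.h2_vec _⟩, h.toMaximal.e13_vec _,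
        h.toMaximal.e23_vec _⟩
    rw [h.toMaximal.e12_vec_succ, ← hl, sub_self, mul_zero, zero_smul]
  obtain ⟨j, rfl⟩ := Nat.exists_eq_add_of_lt hk
  have : r + j + 1 = j + (r + 1) := by ring
  rw [this, ← EvenAction.vec_add, h1, EvenAction.vec, map_zero]

omit [Fact p.Prime] [CharP F p] in
theorem vec_eq_zero_of_le (h : a.IsSimpleHighestWeight p l v) {k : ℕ} (hk : p ≤ k) :
    a.vec v k = 0 := by
  rw [EvenAction.vec, pow_eq_zero_of_le hk h.e21_pow, LinearMap.zero_apply]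

/-- The map `x ↦ (component of e₃₁ x along v)` vanishes. -/
theorem proj_e31 (h : a.IsSimpleHighestWeight p l v) (two : (2 : F) ≠ 0) (x : V) :
    a.proj p l (a.e31 x) = 0 := by
  have hx : x ∈ Submodule.span F (a.monomials v) := h.span_monomials ▸ Submodule.mem_top
  induction hx using Submodule.span_induction with
  | zero => simp
  | add x y _ _ hx hy => rw [map_add, map_add, hx, hy, add_zero]
  | smul c x _ hx => rw [map_smul, map_smul, hx, smul_zero]
  | mem x hx =>
    obtain ⟨k, rfl | rfl | rfl | rfl⟩ := hx
    · exact h.toMaximal.proj_e31_vec _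
    · rw [a.e31_e31, map_zero]
    · exact h.toMaximal.proj_e31_e32_vec two _
    · rw [a.e31_e31, map_zero]

theorem proj_e32 (h : a.IsSimpleHighestWeight p l v) (two : (2 : F) ≠ 0) (x : V) :
    a.proj p l (a.e32 x) = 0 := by
  have hx : x ∈ Submodule.span F (a.monomials v) := h.span_monomials ▸ Submodule.mem_top
  induction hx using Submodule.span_induction with
  | zero => simp
  | add x y _ _ hx hy => rw [map_add, map_add, hx, hy, add_zero]
  | smul c x _ hx => rw [map_smul, map_smul, hx, smul_zero]
  | mem x hx =>
    obtain ⟨k, rfl | rfl | rfl | rfl⟩ := hx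
    · exact h.toMaximal.proj_e32_vec _
    · rw [a.e32_e31, map_neg, h.toMaximal.proj_e31_e32_vec two, neg_zero]
    · rw [a.e32_e32, map_zero]
    · rw [a.e32_e31, a.e32_e32, map_zero, neg_zero, map_zero]

end IsSimpleHighestWeight

/-- The image `𝔤₋₁ V`. -/
def negPart (a : Action F V) : Submodule F V := LinearMap.range a.e31 ⊔ LinearMap.range a.e32

theorem e31_mem_negPart (a : Action F V) (x : V) : a.e31 x ∈ a.negPart :=
  Submodule.mem_sup_left ⟨x, rfl⟩

theorem e32_mem_negPart (a : Action F V) (x : V) : a.e32 x ∈ a.negPart :=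
  Submodule.mem_sup_right ⟨x, rfl⟩

theorem map_mem_negPart (a : Action F V) {f : Module.End F V} (h1 : ∀ y, f (a.e31 y) ∈ a.negPart)
    (h2 : ∀ y, f (a.e32 y) ∈ a.negPart) {x : V} (hx : x ∈ a.negPart) : f x ∈ a.negPart := by
  obtain ⟨_, ⟨y, rfl⟩, _, ⟨z, rfl⟩, rfl⟩ := Submodule.mem_sup.1 hx
  rw [map_add]
  exact add_mem (h1 y) (h2 z)

theorem e13_h1 (a : Action F V) (x : V) : a.e13 (a.h1 x) = a.h1 (a.e13 x) := (a.h1_e13 x).symm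

theorem e23_h1 (a : Action F V) (x : V) : a.e23 (a.h1 x) = a.h1 (a.e23 x) + a.e23 x := by
  rw [a.h1_e23]; abel

theorem e13_h2 (a : Action F V) (x : V) : a.e13 (a.h2 x) = a.h2 (a.e13 x) + a.e13 x := by
  rw [a.h2_e13]; abel

theorem e23_h2 (a : Action F V) (x : V) : a.e23 (a.h2 x) = a.h2 (a.e23 x) := (a.h2_e23 x).symm

/-- A vector of negative degree that `U(𝔤₁)` keeps in negative degree vanishes in a simple
module. -/
theorem IsSimpleHighestWeight.eq_zero_of_negPart (h : a.IsSimpleHighestWeight p l v)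
    (two : (2 : F) ≠ 0) {x : V} (hx : x ∈ a.negPart) (h13 : a.e13 x ∈ a.negPart)
    (h23 : a.e23 x ∈ a.negPart) (h2313 : a.e23 (a.e13 x) ∈ a.negPart) : x = 0 := by
  have n1 : ∀ {x}, x ∈ a.negPart → a.h1 x ∈ a.negPart := a.map_mem_negPart
    (fun y => by rw [a.h1_e31]; exact a.e31_mem_negPart _)
    (fun y => by rw [a.h1_e32]; exact add_mem (a.e32_mem_negPart _) (a.e32_mem_negPart _))
  have n2 : ∀ {x}, x ∈ a.negPart → a.h2 x ∈ a.negPart := a.map_mem_negPart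
    (fun y => by rw [a.h2_e31]; exact add_mem (a.e31_mem_negPart _) (a.e31_mem_negPart _))
    (fun y => by rw [a.h2_e32]; exact a.e32_mem_negPart _)
  have n12 : ∀ {x}, x ∈ a.negPart → a.e12 x ∈ a.negPart := a.map_mem_negPart
    (fun y => by rw [a.e12_e31]; exact sub_mem (a.e31_mem_negPart _) (a.e32_mem_negPart _))
    (fun y => by rw [a.e12_e32]; exact a.e32_mem_negPart _)
  have n21 : ∀ {x}, x ∈ a.negPart → a.e21 x ∈ a.negPart := a.map_mem_negPart
    (fun y => by rw [a.e21_e31]; exact a.e31_mem_negPart _)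
    (fun y => by rw [a.e21_e32]; exact sub_mem (a.e32_mem_negPart _) (a.e31_mem_negPart _))
  have m1 := a.e31_mem_negPart
  have m2 := a.e32_mem_negPart
  let W : Submodule F V := a.negPart ⊓ a.negPart.comap a.e13 ⊓ a.negPart.comap a.e23 ⊓
    a.negPart.comap (a.e23 * a.e13)
  have hW : ∀ {x}, x ∈ W ↔ ((x ∈ a.negPart ∧ a.e13 x ∈ a.negPart) ∧ a.e23 x ∈ a.negPart) ∧
    a.e23 (a.e13 x) ∈ a.negPart := Iff.rfl
  have hst : a.Stable W := by
    constructor <;> intro x hx <;> rw [hW] at hx ⊢ <;> obtain ⟨⟨⟨hx, h13⟩, h23⟩, h2313⟩ := hx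
    all_goals
      have h1323 : a.e13 (a.e23 x) ∈ a.negPart := by
        rw [← neg_neg (a.e13 _), ← a.e23_e13]; exact neg_mem h2313
      simp only [e13_h1, e23_h1, e13_h2, e23_h2, a.e13_e12, a.e23_e12, a.e13_e21, a.e23_e21,
        a.e13_e31, a.e13_e32, a.e23_e31, a.e23_e32, a.e13_e13, a.e23_e23, a.e23_e13, map_add,
        map_sub, map_neg, map_zero, neg_zero, sub_zero]
      refine ⟨⟨⟨?_, ?_⟩, ?_⟩, ?_⟩
      all_goals
        repeat' first
          | exact zero_mem _
          | assumption
          | apply m1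
          | apply m2
          | apply add_mem
          | apply sub_mem
          | apply neg_mem
          | apply n1
          | apply n2
          | apply n12
          | apply n21
  rcases h.simple W hst with hbot | htop
  · have : x ∈ W := hW.2 ⟨⟨⟨hx, h13⟩, h23⟩, h2313⟩
    rw [hbot] at this
    exact this
  · exfalso
    have hv : v ∈ W := htop ▸ Submodule.mem_top
    obtain ⟨_, ⟨y, rfl⟩, _, ⟨z, rfl⟩, hyz⟩ := Submodule.mem_sup.1 (hW.1 hv).1.1.1
    apply h.ne_zero
    rw [← h.proj_self]
    conv_lhs => rw [← hyz]
    rw [map_add, h.proj_e31 two, h.proj_e32 two, add_zero]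

end Action

end Structure

section Atypical

variable {F : Type u} [Field F] {V : Type v} [AddCommGroup V] [Module F V]
  {p : ℕ} {a : Action F V} {l : F × F} {v : V}

namespace Action

theorem vec_mem_degZero (a : Action F V) (v : V) (k : ℕ) : a.vec v k ∈ a.degZero v :=
  Submodule.subset_span ⟨k, rfl⟩

theorem self_mem_degZero (a : Action F V) (v : V) : v ∈ a.degZero v := by
  simpa using a.vec_mem_degZero v 0

theorem e31_vec_mem_degOne (a : Action F V) (v : V) (k : ℕ) : a.e31 (a.vec v k) ∈ a.degOne v :=
  Submodule.subset_span ⟨k, Or.inl rfl⟩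

theorem e32_vec_mem_degOne (a : Action F V) (v : V) (k : ℕ) : a.e32 (a.vec v k) ∈ a.degOne v :=
  Submodule.subset_span ⟨k, Or.inr rfl⟩

theorem degOne_le_negPart (a : Action F V) (v : V) : a.degOne v ≤ a.negPart := by
  rw [degOne, Submodule.span_le]
  rintro _ ⟨k, rfl | rfl⟩
  · exact a.e31_mem_negPart _
  · exact a.e32_mem_negPart _

namespace IsMaximal

theorem e13_e31_vec (h : a.IsMaximal l v) (k : ℕ) :
    a.e13 (a.e31 (a.vec v k)) = (l.1 - k) • a.vec v k := by
  rw [a.e13_e31, h.e13_vec, map_zero, sub_zero, h.h1_vec]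

theorem e23_e31_vec (h : a.IsMaximal l v) (k : ℕ) :
    a.e23 (a.e31 (a.vec v k)) = a.vec v (k + 1) := by
  rw [a.e23_e31, h.e23_vec, map_zero, sub_zero, EvenAction.e21_vec]

theorem e13_e32_vec (h : a.IsMaximal l v) (k : ℕ) :
    a.e13 (a.e32 (a.vec v k)) = (k * (l.1 - l.2 - k + 1)) • a.vec v (k - 1) := by
  rw [a.e13_e32, h.e13_vec, map_zero, sub_zero, h.e12_vec]

theorem e23_e32_vec (h : a.IsMaximal l v) (k : ℕ) :
    a.e23 (a.e32 (a.vec v k)) = (l.2 + k) • a.vec v k := by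
  rw [a.e23_e32, h.e23_vec, map_zero, sub_zero, h.h2_vec]

theorem e13_degZero (h : a.IsMaximal l v) {x : V} (hx : x ∈ a.degZero v) : a.e13 x = 0 := by
  have : a.degZero v ≤ LinearMap.ker a.e13 := by
    rw [degZero, Submodule.span_le]; rintro _ ⟨k, rfl⟩; exact h.e13_vec k
  exact this hx

theorem e23_degZero (h : a.IsMaximal l v) {x : V} (hx : x ∈ a.degZero v) : a.e23 x = 0 := by
  have : a.degZero v ≤ LinearMap.ker a.e23 := by
    rw [degZero, Submodule.span_le]; rintro _ ⟨k, rfl⟩; exact h.e23_vec k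
  exact this hx

theorem sum_h_degZero (h : a.IsMaximal l v) {x : V} (hx : x ∈ a.degZero v) :
    (a.h1 + a.h2) x = (l.1 + l.2) • x := by
  rw [← Module.End.mem_eigenspace_iff]
  have : a.degZero v ≤ (a.h1 + a.h2).eigenspace (l.1 + l.2) := by
    rw [degZero, Submodule.span_le]; rintro _ ⟨k, rfl⟩
    exact Module.End.mem_eigenspace_iff.2 (h.sum_h_vec k)
  exact this hx

theorem sum_h_degOne (h : a.IsMaximal l v) {x : V} (hx : x ∈ a.degOne v) :
    (a.h1 + a.h2) x = (l.1 + l.2 + 1) • x := by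
  rw [← Module.End.mem_eigenspace_iff]
  have : a.degOne v ≤ (a.h1 + a.h2).eigenspace (l.1 + l.2 + 1) := by
    rw [degOne, Submodule.span_le]; rintro _ ⟨k, rfl | rfl⟩
    · exact Module.End.mem_eigenspace_iff.2 (sum_h_e31 (h.sum_h_vec k))
    · exact Module.End.mem_eigenspace_iff.2 (sum_h_e32 (h.sum_h_vec k))
  exact this hx

end IsMaximal

/-- The hypotheses on an atypical simple restricted module in characteristic `p > 2`. -/
structure IsAtypical {F : Type u} [Field F] {V : Type v} [AddCommGroup V] [Module F V]
    (p : ℕ) (a : Action F V) (l : F × F) (v : V) : Prop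
    extends toSimple : a.IsSimpleHighestWeight p l v where
  two : (2 : F) ≠ 0
  atypical : l.2 * (l.1 + 1) = 0

namespace IsAtypical

variable [Fact p.Prime] [CharP F p]

theorem e31_e32 (h : a.IsAtypical p l v) (x : V) : a.e31 (a.e32 x) = 0 := by
  have h0 : a.e31 (a.e32 v) = 0 := by
    apply h.toSimple.eq_zero_of_negPart h.two (a.e31_mem_negPart _)
    · rw [a.e13_e31, a.h1_e32, a.e13_e32, h.h1, h.e12, h.toMaximal.e13, map_zero, sub_zero,
        map_zero, sub_zero, map_smul]
      exact add_mem (Submodule.smul_mem _ _ (a.e32_mem_negPart _)) (a.e32_mem_negPart _)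
    · rw [a.e23_e31, a.e21_e32]
      exact sub_mem (sub_mem (a.e32_mem_negPart _) (a.e31_mem_negPart _)) (a.e31_mem_negPart _)
    · rw [a.e13_e31, a.h1_e32, a.e13_e32, h.h1, h.e12, h.toMaximal.e13, map_zero, sub_zero,
        map_zero, sub_zero, map_smul, map_add, map_smul, a.e23_e32, h.toMaximal.e23, map_zero,
        sub_zero, h.h2]
      have : l.1 • l.2 • v + l.2 • v = (l.2 * (l.1 + 1)) • v := by module
      rw [this, h.atypical, zero_smul]
      exact zero_mem _
  have hk : ∀ k, a.e31 (a.e32 (a.vec v k)) = 0 := by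
    intro k
    induction k with
    | zero => rw [EvenAction.vec_zero, h0]
    | succ k ih =>
      have : a.e32 (a.vec v (k + 1)) = a.e21 (a.e32 (a.vec v k)) + a.e31 (a.vec v k) := by
        rw [a.e21_e32, EvenAction.e21_vec]; abel
      rw [this, map_add, a.e31_e31, ← a.e21_e31, ih, map_zero, add_zero]
  have hx : x ∈ Submodule.span F (a.monomials v) := h.toSimple.span_monomials ▸ Submodule.mem_top
  have hle : Submodule.span F (a.monomials v) ≤ LinearMap.ker (a.e31 * a.e32) := by
    rw [Submodule.span_le]
    rintro _ ⟨k, rfl | rfl | rfl | rfl⟩ <;> simp only [SetLike.mem_coe, LinearMap.mem_ker,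
      Module.End.mul_apply]
    · exact hk k
    · rw [a.e32_e31, map_neg, a.e31_e31, neg_zero]
    · rw [a.e32_e32, map_zero]
    · rw [hk k, map_zero, map_zero]
  exact hle hx

theorem exists_add (h : a.IsAtypical p l v) (x : V) :
    ∃ y ∈ a.degZero v, ∃ z ∈ a.degOne v, x = y + z := by
  have hx : x ∈ Submodule.span F (a.monomials v) := h.toSimple.span_monomials ▸ Submodule.mem_top
  have hle : Submodule.span F (a.monomials v) ≤ a.degZero v ⊔ a.degOne v := by
    rw [Submodule.span_le]
    rintro _ ⟨k, rfl | rfl | rfl | rfl⟩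
    · exact Submodule.mem_sup_left (a.vec_mem_degZero v k)
    · exact Submodule.mem_sup_right (a.e31_vec_mem_degOne v k)
    · exact Submodule.mem_sup_right (a.e32_vec_mem_degOne v k)
    · rw [h.e31_e32]; exact zero_mem _
  obtain ⟨y, hy, z, hz, hyz⟩ := Submodule.mem_sup.1 (hle hx)
  exact ⟨y, hy, z, hz, hyz.symm⟩

theorem e31_mem_degOne (h : a.IsAtypical p l v) (x : V) : a.e31 x ∈ a.degOne v := by
  have hx : x ∈ Submodule.span F (a.monomials v) := h.toSimple.span_monomials ▸ Submodule.mem_top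
  have hle : Submodule.span F (a.monomials v) ≤ (a.degOne v).comap a.e31 := by
    rw [Submodule.span_le]
    rintro _ ⟨k, rfl | rfl | rfl | rfl⟩ <;> simp only [SetLike.mem_coe, Submodule.mem_comap]
    · exact a.e31_vec_mem_degOne v k
    · rw [a.e31_e31]; exact zero_mem _
    · rw [h.e31_e32]; exact zero_mem _
    · rw [a.e31_e31]; exact zero_mem _
  exact hle hx

theorem e32_mem_degOne (h : a.IsAtypical p l v) (x : V) : a.e32 x ∈ a.degOne v := by
  have hx : x ∈ Submodule.span F (a.monomials v) := h.toSimple.span_monomials ▸ Submodule.mem_top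
  have hle : Submodule.span F (a.monomials v) ≤ (a.degOne v).comap a.e32 := by
    rw [Submodule.span_le]
    rintro _ ⟨k, rfl | rfl | rfl | rfl⟩ <;> simp only [SetLike.mem_coe, Submodule.mem_comap]
    · exact a.e32_vec_mem_degOne v k
    · rw [a.e32_e31, h.e31_e32, neg_zero]; exact zero_mem _
    · rw [a.e32_e32]; exact zero_mem _
    · rw [h.e31_e32, map_zero]; exact zero_mem _
  exact hle hx

/-- Vectors of degree `-1` are determined by their images under `𝔤₁`. -/
theorem degOne_ext (h : a.IsAtypical p l v) {x y : V} (hx : x ∈ a.degOne v)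
    (hy : y ∈ a.degOne v) (h13 : a.e13 x = a.e13 y) (h23 : a.e23 x = a.e23 y) : x = y := by
  have h1 : a.e13 (x - y) = 0 := by rw [map_sub, h13, sub_self]
  have h2 : a.e23 (x - y) = 0 := by rw [map_sub, h23, sub_self]
  rw [← sub_eq_zero]
  refine h.toSimple.eq_zero_of_negPart h.two (a.degOne_le_negPart v (sub_mem hx hy)) ?_ ?_ ?_
  · rw [h1]; exact zero_mem _
  · rw [h2]; exact zero_mem _
  · rw [h1, map_zero]; exact zero_mem _

theorem e31_degOne (h : a.IsAtypical p l v) {x : V} (hx : x ∈ a.degOne v) : a.e31 x = 0 := by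
  have : a.degOne v ≤ LinearMap.ker a.e31 := by
    rw [degOne, Submodule.span_le]
    rintro _ ⟨k, rfl | rfl⟩
    · exact a.e31_e31 _
    · exact h.e31_e32 _
  exact this hx

theorem e32_degOne (h : a.IsAtypical p l v) {x : V} (hx : x ∈ a.degOne v) : a.e32 x = 0 := by
  have : a.degOne v ≤ LinearMap.ker a.e32 := by
    rw [degOne, Submodule.span_le]
    rintro _ ⟨k, rfl | rfl⟩
    · change a.e32 (a.e31 _) = 0
      rw [a.e32_e31, h.e31_e32, neg_zero]
    · exact a.e32_e32 _
  exact this hx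

/-- `h₁ + h₂` has at most two eigenvalues; they determine the degree. -/
theorem eq_add_of_sum_h (h : a.IsAtypical p l v) {x : V} {t : F} (hx : (a.h1 + a.h2) x = t • x) :
    ∃ y ∈ a.degZero v, ∃ z ∈ a.degOne v, x = y + z ∧
      (t - (l.1 + l.2)) • y = 0 ∧ (t - (l.1 + l.2 + 1)) • z = 0 := by
  obtain ⟨y, hy, z, hz, rfl⟩ := h.exists_add x
  have e1 := h.toMaximal.sum_h_degZero hy
  have e2 := h.toMaximal.sum_h_degOne hz
  rw [map_add, e1, e2] at hx
  -- both degrees vanish since `y` and `z` are eigenvectors of different eigenvalues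
  have k1 : (t - (l.1 + l.2)) • y = (l.1 + l.2 + 1 - t) • z := by
    linear_combination (norm := module) (-1 : F) • hx
  have k2 : (a.h1 + a.h2) ((t - (l.1 + l.2)) • y) = (l.1 + l.2) • ((t - (l.1 + l.2)) • y) := by
    rw [map_smul, e1, smul_comm]
  have k3 : (a.h1 + a.h2) ((t - (l.1 + l.2)) • y)
      = (l.1 + l.2 + 1) • ((t - (l.1 + l.2)) • y) := by
    rw [k1, map_smul, e2, smul_comm]
  have k4 := eq_zero_of_eigen k2 k3 (by simp)
  refine ⟨y, hy, z, hz, rfl, k4, ?_⟩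
  rw [k4] at k1
  rw [← neg_sub, neg_smul, ← k1, neg_zero]

theorem mem_degZero (h : a.IsAtypical p l v) {x : V} {t : F} (hx : (a.h1 + a.h2) x = t • x)
    (ht : t ≠ l.1 + l.2 + 1) : x ∈ a.degZero v := by
  obtain ⟨y, hy, z, hz, rfl, -, h2⟩ := h.eq_add_of_sum_h hx
  rw [(smul_eq_zero.1 h2).resolve_left (sub_ne_zero.2 ht), add_zero]
  exact hy

theorem mem_degOne (h : a.IsAtypical p l v) {x : V} {t : F} (hx : (a.h1 + a.h2) x = t • x)
    (ht : t ≠ l.1 + l.2) : x ∈ a.degOne v := by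
  obtain ⟨y, hy, z, hz, rfl, h1, -⟩ := h.eq_add_of_sum_h hx
  rw [(smul_eq_zero.1 h1).resolve_left (sub_ne_zero.2 ht), zero_add]
  exact hz

theorem eq_zero_of_sum_h (h : a.IsAtypical p l v) {x : V} {t : F} (hx : (a.h1 + a.h2) x = t • x)
    (h0 : t ≠ l.1 + l.2) (h1 : t ≠ l.1 + l.2 + 1) : x = 0 := by
  obtain ⟨y, hy, z, hz, rfl, k1, k2⟩ := h.eq_add_of_sum_h hx
  rw [(smul_eq_zero.1 k1).resolve_left (sub_ne_zero.2 h0),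
    (smul_eq_zero.1 k2).resolve_left (sub_ne_zero.2 h1), add_zero]

omit [Fact p.Prime] in
/-- The weight spaces of the degree `0` part are spanned by the vectors `e₂₁ᵏ v`. -/
theorem exists_smul_vec (h : a.IsAtypical p l v) {x : V} (hx : x ∈ a.degZero v) {t : F}
    (ht : a.h1 x = t • x) (hx0 : x ≠ 0) :
    ∃ k < p, l.1 - k = t ∧ ∃ c : F, x = c • a.vec v k := by
  have hx' : x ∈ Submodule.span F (Set.range fun k : Fin p => a.vec v k) := by
    have : a.degZero v ≤ Submodule.span F (Set.range fun k : Fin p => a.vec v k) := by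
      rw [degZero, Submodule.span_le]
      rintro _ ⟨k, rfl⟩
      by_cases hk : k < p
      · exact Submodule.subset_span ⟨⟨k, hk⟩, rfl⟩
      · rw [h.toSimple.vec_eq_zero_of_le (not_lt.1 hk)]; exact zero_mem _
    exact this hx
  have hmem := mem_span_of_eigen (f := a.h1) (μ := fun k : Fin p => l.1 - (k : ℕ))
    (fun k => h.h1_vec k) hx' ht
  by_cases hex : ∃ k : Fin p, l.1 - (k : ℕ) = t
  · obtain ⟨k, hk⟩ := hex
    have hset : {i : Fin p | l.1 - ((i : ℕ) : F) = t} = {k} := by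
      ext i
      simp only [Set.mem_ofPred_eq, Set.mem_singleton_iff]
      constructor
      · intro hi
        apply Fin.ext
        apply eq_of_natCast_eq (F := F) i.2 k.2
        linear_combination hk - hi
      · rintro rfl; exact hk
    rw [hset, Set.image_singleton, Submodule.mem_span_singleton] at hmem
    obtain ⟨c, hc⟩ := hmem
    exact ⟨k, k.2, hk, c, hc.symm⟩
  · exfalso
    have hset : {i : Fin p | l.1 - ((i : ℕ) : F) = t} = ∅ := by
      ext i
      simp only [Set.mem_ofPred_eq, Set.mem_empty_iff_false, iff_false]
      exact fun hi => hex ⟨i, hi⟩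
    rw [hset, Set.image_empty, Submodule.span_empty] at hmem
    exact hx0 hmem

theorem exists_highest (h : a.IsAtypical p l v) : ∃ r < p, (r : F) = l.1 - l.2 := by
  have h1 := congrArg (fun f => f v) h.h1_pow
  have h2 := congrArg (fun f => f v) h.h2_pow
  have hp : ∀ (f : Module.End F V) (c : F), f v = c • v → ∀ n : ℕ, (f ^ n) v = c ^ n • v := by
    intro f c hf n
    induction n with
    | zero => simp
    | succ n ih => rw [pow_succ', Module.End.mul_apply, ih, map_smul, hf, smul_smul, pow_succ]
  have e1 : l.1 ^ p = l.1 := by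
    simp only [hp _ _ h.h1 p, h.h1] at h1
    exact smul_left_injective F h.ne_zero h1
  have e2 : l.2 ^ p = l.2 := by
    simp only [hp _ _ h.h2 p, h.h2] at h2
    exact smul_left_injective F h.ne_zero h2
  exact exists_natCast_eq (p := p) (by rw [sub_pow_char, e1, e2])

/-- The singular vectors in degree `0` are the multiples of `v`. -/
theorem weight_eq_of_singular (h : a.IsAtypical p l v) {x : V} (hx : x ∈ a.degZero v) {t : F}
    (ht : a.h1 x = t • x) (h12 : a.e12 x = 0) (hx0 : x ≠ 0) : t = l.1 ∧ ∃ c : F, x = c • v := by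
  obtain ⟨k, hk, hkt, c, rfl⟩ := h.exists_smul_vec hx ht hx0
  obtain ⟨r, hr, hrl⟩ := h.exists_highest
  rcases Nat.eq_zero_or_pos k with rfl | hpos
  · exact ⟨by rw [← hkt]; simp, c, by rw [EvenAction.vec_zero]⟩
  exfalso
  apply hx0
  by_cases hrk : r < k
  · rw [h.toSimple.vec_eq_zero h.two hrl hrk, smul_zero]
  · obtain ⟨j, rfl⟩ : ∃ j, k = j + 1 := ⟨k - 1, by omega⟩
    rw [map_smul, h.e12_vec_succ, smul_smul, ← hrl, ← Nat.cast_sub (by omega)] at h12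
    have hne : ((j : F) + 1) * ((r - j : ℕ) : F) ≠ 0 := by
      refine mul_ne_zero ?_ (natCast_ne_zero_of_lt (p := p) (by omega) (by omega))
      exact_mod_cast natCast_ne_zero_of_lt (F := F) (p := p) (Nat.succ_ne_zero j) hk
    rcases smul_eq_zero.1 h12 with h0 | h0
    · rw [(mul_eq_zero.1 h0).resolve_right hne, zero_smul]
    · rw [← EvenAction.e21_vec, h0, map_zero, smul_zero]

end IsAtypical

end Action

end Atypical

/-! ### Cocycles -/

section Cocycle

variable {F : Type u} [Field F] {V : Type v} [AddCommGroup V] [Module F V]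

/-- A `1`-cocycle of `𝔤` with values in `V`, with the sign rule for even maps. -/
def IsCocycle (ρ : sl21 F →ₗ[F] Module.End F V) (ψ : sl21 F →ₗ[F] V) : Prop :=
  ∀ (i j : ZMod 2) (x y z : sl21 F),
    IsHomog i (x : Matrix (Fin 3) (Fin 3) F) → IsHomog j (y : Matrix (Fin 3) (Fin 3) F) →
    (z : Matrix (Fin 3) (Fin 3) F) = superBracket i j x y →
    ψ z = ρ x (ψ y) - sgn F i j • ρ y (ψ x)

/-- `ψ` is homogeneous of parity `k`. -/
def IsHomogMap (gr : ZMod 2 → Submodule F V) (k : ZMod 2) (ψ : sl21 F →ₗ[F] V) : Prop :=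
  ∀ (i : ZMod 2) (x : sl21 F), IsHomog i (x : Matrix (Fin 3) (Fin 3) F) → ψ x ∈ gr (k + i)

/-- The map `x ↦ (-1)^{k|x|} φ x`. -/
def signTwist (k : ZMod 2) (φ : sl21 F →ₗ[F] V) : sl21 F →ₗ[F] V :=
  cochain !![φ (evenIncl F (h1 F)), φ (evenIncl F (e12 F)), sgn F k 1 • φ (e13 F);
    φ (e21 F), φ (evenIncl F (h2 F)), sgn F k 1 • φ (e23 F);
    sgn F k 1 • φ (e31 F), sgn F k 1 • φ (e32 F), 0]

theorem signTwist_apply (k : ZMod 2) (φ : sl21 F →ₗ[F] V) {i : ZMod 2} {x : sl21 F}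
    (hx : IsHomog i (x : Matrix (Fin 3) (Fin 3) F)) : signTwist k φ x = sgn F k i • φ x := by
  conv_rhs => rw [eq_cochain φ]
  rcases parity_cases i with rfl | rfl
  · obtain ⟨x1, x2, x3, x4⟩ := entries_of_even hx
    simp [signTwist, cochain, x1, x2, x3, x4]
  · obtain ⟨x1, x2, x3, x4, -⟩ := entries_of_odd hx
    simp only [signTwist, cochain, LinearMap.coe_mk, AddHom.coe_mk, x1, x2, x3, x4]
    simp
    module

theorem sgn_mul_self (k : ZMod 2) : sgn F k 1 * sgn F k 1 = 1 := by
  rcases parity_cases k with rfl | rfl <;> simp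

theorem signTwist_signTwist (k : ZMod 2) (φ : sl21 F →ₗ[F] V) :
    signTwist k (signTwist k φ) = φ := by
  conv_rhs => rw [eq_cochain φ]
  rw [signTwist, signTwist_apply k φ (isHomog_evenIncl _), signTwist_apply k φ (isHomog_evenIncl _),
    signTwist_apply k φ (isHomog_evenIncl _), signTwist_apply k φ isHomog_e21,
    signTwist_apply k φ isHomog_e13, signTwist_apply k φ isHomog_e23,
    signTwist_apply k φ isHomog_e31, signTwist_apply k φ isHomog_e32]
  simp [smul_smul, sgn_mul_self]

theorem linearMap_ext_of_homog {φ ψ : sl21 F →ₗ[F] V}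
    (h : ∀ (i : ZMod 2) (x : sl21 F), IsHomog i (x : Matrix (Fin 3) (Fin 3) F) → φ x = ψ x) :
    φ = ψ := by
  rw [eq_cochain φ, eq_cochain ψ, h _ _ (isHomog_evenIncl _), h _ _ (isHomog_evenIncl _),
    h _ _ (isHomog_evenIncl _), h _ _ isHomog_e21, h _ _ isHomog_e13, h _ _ isHomog_e23,
    h _ _ isHomog_e31, h _ _ isHomog_e32]

theorem isHomog_superBracket {i j : ZMod 2} {x y : Matrix (Fin 3) (Fin 3) F} (hx : IsHomog i x)
    (hy : IsHomog j y) : IsHomog (i + j) (superBracket i j x y) := by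
  intro a b hab
  have key : ∀ (i j : ZMod 2) (x y : Matrix (Fin 3) (Fin 3) F), IsHomog i x → IsHomog j y →
      idxParity a + idxParity b ≠ i + j → (x * y) a b = 0 := by
    intro i j x y hx hy hab
    rw [Matrix.mul_apply]
    refine Finset.sum_eq_zero fun c _ => ?_
    by_cases h : idxParity a + idxParity c = i
    · have : idxParity c + idxParity b ≠ j := by
        intro h'
        apply hab
        rw [← h, ← h']
        generalize idxParity a = i
        generalize idxParity b = j
        generalize idxParity c = k
        decide +revert
      rw [hy _ _ this, mul_zero]
    · rw [hx _ _ h, zero_mul]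
  rw [superBracket, Matrix.sub_apply, Matrix.smul_apply, key i j x y hx hy hab,
    key j i y x hy hx (by rwa [add_comm j i]), smul_zero, sub_zero]

/-- Up to a sign twist, superderivations of either parity are cocycles. -/
theorem IsDerivation.isCocycle_signTwist {ρ : sl21 F →ₗ[F] Module.End F V}
    {gr : ZMod 2 → Submodule F V} {k : ZMod 2} {φ : sl21 F →ₗ[F] V} (h : IsDerivation ρ gr k φ) :
    IsCocycle ρ (signTwist k φ) := by
  intro i j x y z hx hy hz
  have hz' : IsHomog (i + j) (z : Matrix (Fin 3) (Fin 3) F) := hz ▸ isHomog_superBracket hx hy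
  rw [signTwist_apply k φ hx, signTwist_apply k φ hy, signTwist_apply k φ hz',
    h.2 i j x y z hx hy hz]
  rcases parity_cases k with rfl | rfl <;> rcases parity_cases i with rfl | rfl <;>
    rcases parity_cases j with rfl | rfl <;> simp [show (1 : ZMod 2) + 1 = 0 by decide]
  all_goals abel

theorem IsCocycle.isDerivation_signTwist {ρ : sl21 F →ₗ[F] Module.End F V}
    {gr : ZMod 2 → Submodule F V} {k : ZMod 2} {ψ : sl21 F →ₗ[F] V} (h : IsCocycle ρ ψ)
    (hg : IsHomogMap gr k ψ) : IsDerivation ρ gr k (signTwist k ψ) := by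
  refine ⟨fun i x hx => ?_, fun i j x y z hx hy hz => ?_⟩
  · rw [signTwist_apply k ψ hx]
    exact Submodule.smul_mem _ _ (hg i x hx)
  have hz' : IsHomog (i + j) (z : Matrix (Fin 3) (Fin 3) F) := hz ▸ isHomog_superBracket hx hy
  rw [signTwist_apply k ψ hx, signTwist_apply k ψ hy, signTwist_apply k ψ hz',
    h i j x y z hx hy hz]
  rcases parity_cases k with rfl | rfl <;> rcases parity_cases i with rfl | rfl <;>
    rcases parity_cases j with rfl | rfl <;> simp [show (1 : ZMod 2) + 1 = 0 by decide]
  all_goals abel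

theorem IsDerivation.isHomogMap_signTwist {ρ : sl21 F →ₗ[F] Module.End F V}
    {gr : ZMod 2 → Submodule F V} {k : ZMod 2} {φ : sl21 F →ₗ[F] V} (h : IsDerivation ρ gr k φ) :
    IsHomogMap gr k (signTwist k φ) := fun i x hx => by
  rw [signTwist_apply k φ hx]
  exact Submodule.smul_mem _ _ (h.1 i x hx)

/-- The grading is compatible with the action. -/
def IsGradedRep (ρ : sl21 F →ₗ[F] Module.End F V) (gr : ZMod 2 → Submodule F V) : Prop :=
  ∀ (i j : ZMod 2) (x : sl21 F), IsHomog i (x : Matrix (Fin 3) (Fin 3) F) →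
    ∀ m ∈ gr j, ρ x m ∈ gr (i + j)

theorem isCocycle_flip {ρ : sl21 F →ₗ[F] Module.End F V} (h : IsSuperRep ρ) (m : V) :
    IsCocycle ρ (ρ.flip m) := by
  intro i j x y z hx hy hz
  simp [h i j x y z hx hy hz]

theorem isHomogMap_flip {ρ : sl21 F →ₗ[F] Module.End F V} {gr : ZMod 2 → Submodule F V}
    (h : IsGradedRep ρ gr) {k : ZMod 2} {m : V} (hm : m ∈ gr k) : IsHomogMap gr k (ρ.flip m) :=
  fun i x hx => add_comm i k ▸ h i k x hx m hm

theorem sgn_comm (i j : ZMod 2) : sgn F i j = sgn F j i := by rw [sgn, sgn, mul_comm]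

theorem signTwist_flip_mem_Ider {ρ : sl21 F →ₗ[F] Module.End F V} {gr : ZMod 2 → Submodule F V}
    {k : ZMod 2} {m : V} (hm : m ∈ gr k) : signTwist k (ρ.flip m) ∈ Ider ρ gr :=
  Submodule.subset_span ⟨k, m, hm, fun i x hx => by
    rw [signTwist_apply k _ hx, sgn_comm, LinearMap.flip_apply]⟩

theorem Ider_le_Der {ρ : sl21 F →ₗ[F] Module.End F V} {gr : ZMod 2 → Submodule F V}
    (h : IsSuperRep ρ) (hg : IsGradedRep ρ gr) : Ider ρ gr ≤ Der ρ gr := by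
  refine Submodule.span_le.2 ?_
  rintro φ ⟨k, m, hm, hφ⟩
  have : φ = signTwist k (ρ.flip m) := linearMap_ext_of_homog fun i x hx => by
    rw [hφ i x hx, signTwist_apply k _ hx, sgn_comm, LinearMap.flip_apply]
  rw [this]
  exact Submodule.subset_span
    ⟨k, (isCocycle_flip h m).isDerivation_signTwist (isHomogMap_flip hg hm)⟩

/-- The extension of the trivial module by `V` that belongs to a cocycle. -/
def extRep (ρ : sl21 F →ₗ[F] Module.End F V) (ψ : sl21 F →ₗ[F] V) :
    sl21 F →ₗ[F] Module.End F (V × F) where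
  toFun x := (ρ x ∘ₗ LinearMap.fst F V F
    + (LinearMap.toSpanSingleton F V (ψ x)) ∘ₗ LinearMap.snd F V F).prod 0
  map_add' x y := by
    refine LinearMap.ext fun m => Prod.ext ?_ ?_ <;> simp
    abel
  map_smul' c x := by
    refine LinearMap.ext fun m => Prod.ext ?_ ?_ <;> simp
    module

@[simp] theorem extRep_apply (ρ : sl21 F →ₗ[F] Module.End F V) (ψ : sl21 F →ₗ[F] V) (x : sl21 F)
    (m : V × F) : extRep ρ ψ x m = (ρ x m.1 + m.2 • ψ x, 0) := rfl

theorem isSuperRep_extRep {ρ : sl21 F →ₗ[F] Module.End F V} {ψ : sl21 F →ₗ[F] V}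
    (hρ : IsSuperRep ρ) (hψ : IsCocycle ρ ψ) : IsSuperRep (extRep ρ ψ) := by
  intro i j x y z hx hy hz
  refine LinearMap.ext fun m => Prod.ext ?_ ?_
  · simp [hρ i j x y z hx hy hz, hψ i j x y z hx hy hz]
    module
  · simp

theorem isCocycle_of_isSuperRep_extRep {ρ : sl21 F →ₗ[F] Module.End F V} {ψ : sl21 F →ₗ[F] V}
    (h : IsSuperRep (extRep ρ ψ)) : IsCocycle ρ ψ := by
  intro i j x y z hx hy hz
  have := congrArg Prod.fst (LinearMap.congr_fun (h i j x y z hx hy hz) (0, 1))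
  simpa using this

/-- If a central operator acts on `V` by the scalar `c` and on the extension of the trivial module
by a map with value `m`, then `c ψ` is the inner derivation of `m`. -/
theorem rep_eq_smul_of_central {ρ : sl21 F →ₗ[F] Module.End F V} {ψ : sl21 F →ₗ[F] V}
    {Z : Module.End F (V × F)} {c : F} {m : V} (hZ : ∀ x, Commute Z (extRep ρ ψ x))
    (hc : ∀ w, Z (w, 0) = (c • w, 0)) (hm : Z (0, 1) = (m, 0)) (x : sl21 F) :
    ρ x m = c • ψ x := by
  have := LinearMap.congr_fun (hZ x).eq (0, 1)
  simp only [Module.End.mul_apply, hm, extRep_apply, map_zero, one_smul, zero_add, zero_smul,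
    add_zero, hc] at this
  exact (congrArg Prod.fst this).symm

/-! ### Central elements -/

theorem Action.commute_rep {a : Action F V} {Z : Module.End F V} (h1 : Commute Z a.h1)
    (h2 : Commute Z a.h2) (h3 : Commute Z a.e12) (h4 : Commute Z a.e21) (h5 : Commute Z a.e13)
    (h6 : Commute Z a.e23) (h7 : Commute Z a.e31) (h8 : Commute Z a.e32) (x : sl21 F) :
    Commute Z (a.rep x) := by
  have hs : ∀ {f : Module.End F V} (c : F), Commute Z f → Commute Z (c • f) :=
    fun c hf => hf.smul_right c
  exact ((((((((hs _ h1).add_right (hs _ h2)).add_right (hs _ h3)).add_right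
    (hs _ h5)).add_right (hs _ h4)).add_right (hs _ h6)).add_right (hs _ h7)).add_right (hs _ h8))

section Char

variable (p : ℕ) [Fact p.Prime] [CharP F p]

/-- If `[f, e] = s e` with `s` in the prime field, then `f^p - f` commutes with `e`. -/
theorem commute_pow_sub_self {f e : Module.End F V} {s : F} (hs : s ^ p = s)
    (h : ∀ x, f (e x) = e (f x) + s • e x) : Commute (f ^ p - f) e := by
  rcases subsingleton_or_nontrivial V with hV | hV
  · exact LinearMap.ext fun x => Subsingleton.elim _ _
  have : CharP (Module.End F V) p :=
    charP_of_injective_algebraMap (algebraMap F (Module.End F V)).injective p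
  have h1 : f * e = e * (f + algebraMap F _ s) := LinearMap.ext fun x => by
    simp [h, Module.algebraMap_end_apply]
  have hn : ∀ n : ℕ, f ^ n * e = e * (f + algebraMap F _ s) ^ n := by
    intro n
    induction n with
    | zero => simp
    | succ n ih => rw [pow_succ', mul_assoc, ih, ← mul_assoc, h1, mul_assoc, ← pow_succ']
  change (f ^ p - f) * e = e * (f ^ p - f)
  rw [sub_mul, hn, h1, add_pow_char_of_commute p (Algebra.commutes s f).symm, ← map_pow, hs]
  noncomm_ring

theorem Action.commute_h1_pow_sub (a : Action F V) (x : sl21 F) :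
    Commute (a.h1 ^ p - a.h1) (a.rep x) := by
  have hp : p ≠ 0 := (Fact.out : p.Prime).ne_zero
  have n1 : (-1 : F) ^ p = -1 := neg_one_pow_char F p
  apply Action.commute_rep
  · exact commute_pow_sub_self p (zero_pow hp) fun x => by simp
  · exact commute_pow_sub_self p (zero_pow hp) fun x => by simp
  · exact commute_pow_sub_self p (one_pow p) fun x => by simp
  · exact commute_pow_sub_self p n1 fun x => by simp [sub_eq_add_neg]
  · exact commute_pow_sub_self p (zero_pow hp) fun x => by simp
  · exact commute_pow_sub_self p n1 fun x => by simp [sub_eq_add_neg]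
  · exact commute_pow_sub_self p (zero_pow hp) fun x => by simp
  · exact commute_pow_sub_self p (one_pow p) fun x => by simp

theorem Action.commute_h2_pow_sub (a : Action F V) (x : sl21 F) :
    Commute (a.h2 ^ p - a.h2) (a.rep x) := by
  have hp : p ≠ 0 := (Fact.out : p.Prime).ne_zero
  have n1 : (-1 : F) ^ p = -1 := neg_one_pow_char F p
  apply Action.commute_rep
  · exact commute_pow_sub_self p (zero_pow hp) fun x => by simp
  · exact commute_pow_sub_self p (zero_pow hp) fun x => by simp
  · exact commute_pow_sub_self p n1 fun x => by simp [sub_eq_add_neg]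
  · exact commute_pow_sub_self p (one_pow p) fun x => by simp
  · exact commute_pow_sub_self p n1 fun x => by simp [sub_eq_add_neg]
  · exact commute_pow_sub_self p (zero_pow hp) fun x => by simp
  · exact commute_pow_sub_self p (one_pow p) fun x => by simp
  · exact commute_pow_sub_self p (zero_pow hp) fun x => by simp

theorem Action.commute_e21_pow (hp2 : 2 < p) (a : Action F V) (x : sl21 F) :
    Commute (a.e21 ^ p) (a.rep x) := by
  have key : ∀ e : Module.End F V, ((LinearMap.mulLeft F a.e21 - LinearMap.mulRight F a.e21) ^ 3) e
      = 0 → Commute (a.e21 ^ p) e := by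
    intro e he
    have h := ad_pow_char (F := F) p a.e21 e
    have h3 : p = p - 3 + 3 := by omega
    conv_lhs at h => rw [h3, pow_add, Module.End.mul_apply, he, map_zero]
    exact (sub_eq_zero.1 h.symm)
  apply Action.commute_rep <;> apply key <;> refine LinearMap.ext fun x => ?_ <;>
    simp [pow_succ]
  all_goals abel

end Char

/-- The quadratic Casimir operator; it acts on a highest weight module by `λ₂ (λ₁ + 1)`. -/
def Action.casimir (a : Action F V) : Module.End F V :=
  a.h1 * a.h2 + a.h2 - a.e21 * a.e12 - a.e31 * a.e13 - a.e32 * a.e23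

theorem Action.commute_casimir (a : Action F V) (x : sl21 F) : Commute a.casimir (a.rep x) := by
  apply Action.commute_rep <;> refine LinearMap.ext fun x => ?_ <;> simp [casimir]
  all_goals abel

end Cocycle

/-! ### Vanishing through central elements -/

section Vanishing

variable {F : Type u} [Field F] {V : Type v} [AddCommGroup V] [Module F V]

namespace Action

variable (a : Action F V)

@[simp] theorem rep_h1 : a.rep (evenIncl F (SL21.h1 F)) = a.h1 := by
  simp [rep, cochain, evenIncl, SL21.h1]

@[simp] theorem rep_h2 : a.rep (evenIncl F (SL21.h2 F)) = a.h2 := by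
  simp [rep, cochain, evenIncl, SL21.h2]

@[simp] theorem rep_e12 : a.rep (evenIncl F (SL21.e12 F)) = a.e12 := by
  simp [rep, cochain, evenIncl, SL21.e12]

@[simp] theorem rep_e21 : a.rep (SL21.e21 F) = a.e21 := by simp [rep, cochain, SL21.e21]

@[simp] theorem rep_e13 : a.rep (SL21.e13 F) = a.e13 := by simp [rep, cochain, SL21.e13]

@[simp] theorem rep_e23 : a.rep (SL21.e23 F) = a.e23 := by simp [rep, cochain, SL21.e23]

@[simp] theorem rep_e31 : a.rep (SL21.e31 F) = a.e31 := by simp [rep, cochain, SL21.e31]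

@[simp] theorem rep_e32 : a.rep (SL21.e32 F) = a.e32 := by simp [rep, cochain, SL21.e32]

end Action

/-- The operators on the extension of the trivial module by `V` that belongs to a cocycle. -/
def IsCocycle.ext {a : Action F V} {ψ : sl21 F →ₗ[F] V} (h : IsCocycle a.rep ψ)
    (two : (2 : F) ≠ 0) : Action F (V × F) :=
  Action.ofRep (extRep a.rep ψ) (isSuperRep_extRep a.isSuperRep_rep h) two

theorem IsCocycle.rep_ext {a : Action F V} {ψ : sl21 F →ₗ[F] V} (h : IsCocycle a.rep ψ)
    (two : (2 : F) ≠ 0) : (h.ext two).rep = extRep a.rep ψ := Action.rep_ofRep _ _ _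

section Pow

variable {f : Module.End F (V × F)} {g : Module.End F V} {u : V}

theorem ext_pow_apply_zero (hf : ∀ w, f w = (g w.1 + w.2 • u, 0)) (n : ℕ) (w : V) :
    (f ^ n) (w, 0) = ((g ^ n) w, 0) := by
  induction n with
  | zero => simp
  | succ n ih => rw [pow_succ', Module.End.mul_apply, ih, hf, pow_succ']; simp

theorem ext_pow_apply_one (hf : ∀ w, f w = (g w.1 + w.2 • u, 0)) {n : ℕ} (hn : n ≠ 0) :
    (f ^ n) (0, 1) = ((g ^ (n - 1)) u, 0) := by
  obtain ⟨n, rfl⟩ := Nat.exists_eq_succ_of_ne_zero hn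
  rw [Nat.succ_eq_add_one, pow_succ, Module.End.mul_apply, hf]
  simp [ext_pow_apply_zero hf]

end Pow

theorem IsGradedRep.pow_mem {ρ : sl21 F →ₗ[F] Module.End F V} {gr : ZMod 2 → Submodule F V}
    (hg : IsGradedRep ρ gr) {x : sl21 F} (hx : IsHomog 0 (x : Matrix (Fin 3) (Fin 3) F))
    {k : ZMod 2} {m : V} (hm : m ∈ gr k) (n : ℕ) : ((ρ x) ^ n) m ∈ gr k := by
  induction n with
  | zero => exact hm
  | succ n ih =>
    rw [pow_succ', Module.End.mul_apply]
    have := hg 0 k x hx _ ih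
    rwa [zero_add] at this

variable {a : Action F V} {ψ : sl21 F →ₗ[F] V} {gr : ZMod 2 → Submodule F V} {k : ZMod 2}

theorem IsHomogMap.mem_even (hk : IsHomogMap gr k ψ) {x : sl21 F}
    (hx : IsHomog 0 (x : Matrix (Fin 3) (Fin 3) F)) : ψ x ∈ gr k := by
  have := hk 0 x hx
  rwa [add_zero] at this

theorem eq_flip_of_smul {c : F} (hc : c ≠ 0) {m : V} (h : ∀ x, a.rep x m = c • ψ x) :
    ψ = a.rep.flip (c⁻¹ • m) := by
  ext x
  rw [map_smul, LinearMap.smul_apply, LinearMap.flip_apply, h, smul_smul, inv_mul_cancel₀ hc,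
    one_smul]

section Char

variable {p : ℕ} [Fact p.Prime] [CharP F p]

/-- The central element `h₁^p - h₁` maps the added vector of the extension to
`h₁^(p-1) ψ(h₁) - ψ(h₁)`; hence the cocycle times the scalar of this element is inner. -/
theorem rep_h1_pow_sub (two : (2 : F) ≠ 0) (hψ : IsCocycle a.rep ψ) {c : F}
    (hc : a.h1 ^ p = a.h1 + algebraMap F _ c) (x : sl21 F) :
    a.rep x ((a.h1 ^ (p - 1)) (ψ (evenIncl F (h1 F))) - ψ (evenIncl F (h1 F))) = c • ψ x := by
  have hf : ∀ w, (hψ.ext two).h1 w = (a.h1 w.1 + w.2 • ψ (evenIncl F (h1 F)), 0) := fun w => by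
    rw [← Action.rep_h1, hψ.rep_ext, extRep_apply, Action.rep_h1]
  refine rep_eq_smul_of_central (Z := (hψ.ext two).h1 ^ p - (hψ.ext two).h1)
    (fun x => ?_) (fun w => ?_) ?_ x
  · rw [← hψ.rep_ext two]; exact Action.commute_h1_pow_sub p _ x
  · rw [LinearMap.sub_apply, ext_pow_apply_zero hf, hf, hc]
    simp [Module.algebraMap_end_apply]
  · rw [LinearMap.sub_apply, ext_pow_apply_one hf (Fact.out : p.Prime).ne_zero, hf]
    simp

theorem rep_h2_pow_sub (two : (2 : F) ≠ 0) (hψ : IsCocycle a.rep ψ) {c : F}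
    (hc : a.h2 ^ p = a.h2 + algebraMap F _ c) (x : sl21 F) :
    a.rep x ((a.h2 ^ (p - 1)) (ψ (evenIncl F (h2 F))) - ψ (evenIncl F (h2 F))) = c • ψ x := by
  have hf : ∀ w, (hψ.ext two).h2 w = (a.h2 w.1 + w.2 • ψ (evenIncl F (h2 F)), 0) := fun w => by
    rw [← Action.rep_h2, hψ.rep_ext, extRep_apply, Action.rep_h2]
  refine rep_eq_smul_of_central (Z := (hψ.ext two).h2 ^ p - (hψ.ext two).h2)
    (fun x => ?_) (fun w => ?_) ?_ x
  · rw [← hψ.rep_ext two]; exact Action.commute_h2_pow_sub p _ x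
  · rw [LinearMap.sub_apply, ext_pow_apply_zero hf, hf, hc]
    simp [Module.algebraMap_end_apply]
  · rw [LinearMap.sub_apply, ext_pow_apply_one hf (Fact.out : p.Prime).ne_zero, hf]
    simp

theorem rep_e21_pow (hp2 : 2 < p) (hψ : IsCocycle a.rep ψ) {c : F}
    (hc : a.e21 ^ p = algebraMap F _ c) (x : sl21 F) :
    a.rep x ((a.e21 ^ (p - 1)) (ψ (e21 F))) = c • ψ x := by
  have two := two_ne_zero_of_lt (F := F) hp2
  have hf : ∀ w, (hψ.ext two).e21 w = (a.e21 w.1 + w.2 • ψ (e21 F), 0) := fun w => by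
    rw [← Action.rep_e21, hψ.rep_ext, extRep_apply, Action.rep_e21]
  refine rep_eq_smul_of_central (Z := (hψ.ext two).e21 ^ p)
    (fun x => ?_) (fun w => ?_) ?_ x
  · rw [← hψ.rep_ext two]; exact Action.commute_e21_pow p hp2 _ x
  · rw [ext_pow_apply_zero hf, hc, Module.algebraMap_end_apply]
  · rw [ext_pow_apply_one hf (Fact.out : p.Prime).ne_zero]

theorem exists_eq_flip_of_h1 (two : (2 : F) ≠ 0) (hg : IsGradedRep a.rep gr)
    (hψ : IsCocycle a.rep ψ) (hk : IsHomogMap gr k ψ) {c : F} (hc0 : c ≠ 0)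
    (hc : a.h1 ^ p = a.h1 + algebraMap F _ c) : ∃ m ∈ gr k, ψ = a.rep.flip m := by
  refine ⟨_, ?_, eq_flip_of_smul hc0 (rep_h1_pow_sub two hψ hc)⟩
  have hm := hk.mem_even (isHomog_evenIncl (h1 F))
  have := hg.pow_mem (isHomog_evenIncl (h1 F)) hm (p - 1)
  rw [Action.rep_h1] at this
  exact Submodule.smul_mem _ _ (sub_mem this hm)

theorem exists_eq_flip_of_h2 (two : (2 : F) ≠ 0) (hg : IsGradedRep a.rep gr)
    (hψ : IsCocycle a.rep ψ) (hk : IsHomogMap gr k ψ) {c : F} (hc0 : c ≠ 0)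
    (hc : a.h2 ^ p = a.h2 + algebraMap F _ c) : ∃ m ∈ gr k, ψ = a.rep.flip m := by
  refine ⟨_, ?_, eq_flip_of_smul hc0 (rep_h2_pow_sub two hψ hc)⟩
  have hm := hk.mem_even (isHomog_evenIncl (h2 F))
  have := hg.pow_mem (isHomog_evenIncl (h2 F)) hm (p - 1)
  rw [Action.rep_h2] at this
  exact Submodule.smul_mem _ _ (sub_mem this hm)

theorem exists_eq_flip_of_e21 (hp2 : 2 < p) (hg : IsGradedRep a.rep gr)
    (hψ : IsCocycle a.rep ψ) (hk : IsHomogMap gr k ψ) {c : F} (hc0 : c ≠ 0)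
    (hc : a.e21 ^ p = algebraMap F _ c) : ∃ m ∈ gr k, ψ = a.rep.flip m := by
  refine ⟨_, ?_, eq_flip_of_smul hc0 (rep_e21_pow hp2 hψ hc)⟩
  have := hg.pow_mem isHomog_e21 (hk.mem_even isHomog_e21) (p - 1)
  rw [Action.rep_e21] at this
  exact Submodule.smul_mem _ _ this

/-- If `V` is restricted and has no invariants, a cocycle agrees with an inner derivation on the
torus spanned by `h₁` and `h₂`. -/
theorem exists_eq_on_torus (hp2 : 2 < p) (hg : IsGradedRep a.rep gr) (hψ : IsCocycle a.rep ψ)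
    (hk : IsHomogMap gr k ψ) (h1p : a.h1 ^ p = a.h1) (h2p : a.h2 ^ p = a.h2)
    (hinv : ∀ m, (∀ x, a.rep x m = 0) → m = 0) :
    ∃ m ∈ gr k, ψ (evenIncl F (h1 F)) = a.h1 m ∧ ψ (evenIncl F (h2 F)) = a.h2 m := by
  have two := two_ne_zero_of_lt (F := F) hp2
  obtain ⟨u₁, hu₁⟩ : ∃ u, u = ψ (evenIncl F (h1 F)) := ⟨_, rfl⟩
  obtain ⟨u₂, hu₂⟩ : ∃ u, u = ψ (evenIncl F (h2 F)) := ⟨_, rfl⟩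
  have e1 : (a.h1 ^ (p - 1)) u₁ = u₁ := by
    rw [← sub_eq_zero]
    refine hinv _ fun x => ?_
    rw [hu₁, rep_h1_pow_sub two hψ (c := 0) (by rw [h1p, map_zero, add_zero]), zero_smul]
  have e2 : (a.h2 ^ (p - 1)) u₂ = u₂ := by
    rw [← sub_eq_zero]
    refine hinv _ fun x => ?_
    rw [hu₂, rep_h2_pow_sub two hψ (c := 0) (by rw [h2p, map_zero, add_zero]), zero_smul]
  have m1 : u₁ ∈ gr k := hu₁ ▸ hk.mem_even (isHomog_evenIncl (h1 F))
  have m2 : u₂ ∈ gr k := hu₂ ▸ hk.mem_even (isHomog_evenIncl (h2 F))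
  have s1 : ∀ (n : ℕ) (w : V), w ∈ gr k → (a.h1 ^ n) w ∈ gr k := fun n w hw => by
    rw [← a.rep_h1]; exact hg.pow_mem (isHomog_evenIncl (h1 F)) hw n
  have s2 : ∀ (n : ℕ) (w : V), w ∈ gr k → (a.h2 ^ n) w ∈ gr k := fun n w hw => by
    rw [← a.rep_h2]; exact hg.pow_mem (isHomog_evenIncl (h2 F)) hw n
  have hcomm : a.h1 u₂ = a.h2 u₁ := by
    have := hψ 0 0 (evenIncl F (h2 F)) (evenIncl F (h1 F)) 0 (isHomog_evenIncl _)
      (isHomog_evenIncl _) (by simp [superBracket, evenIncl, h1, h2, mul_add, add_mul])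
    rw [map_zero, sgn_zero_left, one_smul, a.rep_h1, a.rep_h2, ← hu₁, ← hu₂] at this
    exact (sub_eq_zero.1 this.symm).symm
  have hc12 : Commute a.h1 a.h2 := LinearMap.ext fun x => (a.h2_h1 x).symm
  have hp1 : p - 1 = p - 2 + 1 := by omega
  have hp0 : p - 1 + 1 = p := by omega
  obtain ⟨w, hw⟩ : ∃ w, w = u₂ - a.h2 ((a.h1 ^ (p - 2)) u₁) := ⟨_, rfl⟩
  have hw1 : a.h1 w = 0 := by
    have : a.h1 (a.h2 ((a.h1 ^ (p - 2)) u₁)) = a.h2 u₁ := by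
      rw [← a.h2_h1, ← Module.End.mul_apply a.h1, ← pow_succ', ← hp1, e1]
    rw [hw, map_sub, hcomm, this, sub_self]
  have hw2 : (a.h2 ^ (p - 1)) w = w := by
    rw [hw, map_sub, e2, ← Module.End.mul_apply _ a.h2, ← pow_succ, hp0, h2p]
  refine ⟨(a.h1 ^ (p - 2)) u₁ + (a.h2 ^ (p - 2)) w, ?_, ?_, ?_⟩
  · refine add_mem (s1 _ _ m1) (s2 _ _ (hw ▸ sub_mem m2 ?_))
    simpa using s2 1 _ (s1 _ _ m1)
  · rw [← hu₁, map_add, ← Module.End.mul_apply a.h1, ← pow_succ', ← hp1, e1,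
      ← Module.End.mul_apply a.h1, (hc12.pow_right (p - 2)).eq, Module.End.mul_apply, hw1,
      map_zero, add_zero]
  · rw [← hu₂, map_add, ← Module.End.mul_apply a.h2 (a.h2 ^ (p - 2)), ← pow_succ', ← hp1, hw2, hw]
    abel

end Char

theorem exists_eq_flip_of_casimir (two : (2 : F) ≠ 0) (hg : IsGradedRep a.rep gr)
    (hψ : IsCocycle a.rep ψ) (hk : IsHomogMap gr k ψ) {c : F} (hc0 : c ≠ 0)
    (hc : ∀ w, a.casimir w = c • w) : ∃ m ∈ gr k, ψ = a.rep.flip m := by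
  obtain ⟨E, hE⟩ : ∃ E, E = hψ.ext two := ⟨_, rfl⟩
  have hrep : E.rep = extRep a.rep ψ := hE ▸ hψ.rep_ext two
  have f1 : ∀ w, E.h1 w = (a.h1 w.1 + w.2 • ψ (evenIncl F (h1 F)), 0) := fun w => by
    rw [← E.rep_h1, hrep, extRep_apply, a.rep_h1]
  have f2 : ∀ w, E.h2 w = (a.h2 w.1 + w.2 • ψ (evenIncl F (h2 F)), 0) := fun w => by
    rw [← E.rep_h2, hrep, extRep_apply, a.rep_h2]
  have f3 : ∀ w, E.e12 w = (a.e12 w.1 + w.2 • ψ (evenIncl F (e12 F)), 0) := fun w => by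
    rw [← E.rep_e12, hrep, extRep_apply, a.rep_e12]
  have f4 : ∀ w, E.e21 w = (a.e21 w.1 + w.2 • ψ (e21 F), 0) := fun w => by
    rw [← E.rep_e21, hrep, extRep_apply, a.rep_e21]
  have f5 : ∀ w, E.e13 w = (a.e13 w.1 + w.2 • ψ (e13 F), 0) := fun w => by
    rw [← E.rep_e13, hrep, extRep_apply, a.rep_e13]
  have f6 : ∀ w, E.e23 w = (a.e23 w.1 + w.2 • ψ (e23 F), 0) := fun w => by
    rw [← E.rep_e23, hrep, extRep_apply, a.rep_e23]
  have f7 : ∀ w, E.e31 w = (a.e31 w.1 + w.2 • ψ (e31 F), 0) := fun w => by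
    rw [← E.rep_e31, hrep, extRep_apply, a.rep_e31]
  have f8 : ∀ w, E.e32 w = (a.e32 w.1 + w.2 • ψ (e32 F), 0) := fun w => by
    rw [← E.rep_e32, hrep, extRep_apply, a.rep_e32]
  have hval : ∀ w : V × F, E.casimir w = (a.casimir w.1 + w.2 • (a.h1 (ψ (evenIncl F (h2 F)))
      + ψ (evenIncl F (h2 F)) - a.e21 (ψ (evenIncl F (e12 F))) - a.e31 (ψ (e13 F))
      - a.e32 (ψ (e23 F))), 0) := by
    intro w
    simp only [Action.casimir, LinearMap.sub_apply, LinearMap.add_apply, Module.End.mul_apply,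
      f1, f2, f3, f4, f5, f6, f7, f8]
    refine Prod.ext ?_ ?_
    · simp
      module
    · simp
  refine ⟨c⁻¹ • (a.h1 (ψ (evenIncl F (h2 F))) + ψ (evenIncl F (h2 F))
    - a.e21 (ψ (evenIncl F (e12 F))) - a.e31 (ψ (e13 F)) - a.e32 (ψ (e23 F))), ?_, eq_flip_of_smul hc0 (rep_eq_smul_of_central (Z := E.casimir)
    (fun x => hrep ▸ E.commute_casimir x) (fun w => by rw [hval]; simp [hc])
    (by rw [hval]; simp only [map_zero, one_smul, zero_add]))⟩
  have odd : ∀ {x : sl21 F} {w : V}, IsHomog 1 (x : Matrix (Fin 3) (Fin 3) F) →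
      w ∈ gr (k + 1) → a.rep x w ∈ gr k := fun {x w} hx hw => by
    have := hg 1 _ x hx w hw
    rwa [add_left_comm, show (1 : ZMod 2) + 1 = 0 by decide, add_zero] at this
  have even : ∀ {x : sl21 F} {w : V}, IsHomog 0 (x : Matrix (Fin 3) (Fin 3) F) →
      w ∈ gr k → a.rep x w ∈ gr k := fun {x w} hx hw => by
    have := hg 0 _ x hx w hw
    rwa [zero_add] at this
  have g2 := hk.mem_even (isHomog_evenIncl (h2 F))
  have q1 := even (isHomog_evenIncl (h1 F)) g2
  have q2 := even isHomog_e21 (hk.mem_even (isHomog_evenIncl (e12 F)))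
  have q3 := odd isHomog_e31 (hk 1 _ isHomog_e13)
  have q4 := odd isHomog_e32 (hk 1 _ isHomog_e23)
  rw [a.rep_h1] at q1
  rw [a.rep_e21] at q2
  rw [a.rep_e31] at q3
  rw [a.rep_e32] at q4
  exact Submodule.smul_mem _ _ (sub_mem (sub_mem (sub_mem (add_mem q1 g2) q2) q3) q4)

/-- If every homogeneous cocycle is the coboundary of a vector of its parity, all derivations are
inner. -/
theorem Der_le_Ider (h : ∀ (k : ZMod 2) (ψ : sl21 F →ₗ[F] V), IsCocycle a.rep ψ →
    IsHomogMap gr k ψ → ∃ m ∈ gr k, ψ = a.rep.flip m) : Der a.rep gr ≤ Ider a.rep gr := by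
  refine Submodule.span_le.2 ?_
  rintro φ ⟨k, hφ⟩
  obtain ⟨m, hm, hψ⟩ := h k _ hφ.isCocycle_signTwist hφ.isHomogMap_signTwist
  rw [← signTwist_signTwist k φ, hψ]
  exact signTwist_flip_mem_Ider hm

end Vanishing

section General

variable {p : ℕ} {F : Type u} [Field F] {χ : Module.Dual F (evenPart F)} {l : F × F}

/-- The `ℤ₂`-grading of a module that is generated by an even vector `v`. -/
def generatedGrading {X : Type v} [AddCommGroup X] [Module F X] [Module (Env p (sl21 F) χ) X]
    (x : X) (i : ZMod 2) : Submodule F X :=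
  Submodule.span F {s | ∃ b : Env p (sl21 F) χ, IsMonomial p χ i b ∧ s = b • x}

section Generated

variable {X : Type v} [AddCommGroup X] [Module F X] [Module (Env p (sl21 F) χ) X]
  [IsScalarTower F (Env p (sl21 F) χ) X] {two : (2 : F) ≠ 0} {x : X}

theorem isGradedRep_generatedGrading :
    IsGradedRep (act p χ two X).rep (generatedGrading (χ := χ) (p := p) x) := by
  rw [rep_act]
  intro i j y hy m hm
  induction hm using Submodule.span_induction with
  | zero => rw [map_zero]; exact zero_mem _
  | add y z _ _ hy hz => rw [map_add]; exact add_mem hy hz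
  | smul c y _ hy => rw [map_smul]; exact Submodule.smul_mem _ _ hy
  | mem z hz =>
    obtain ⟨b, hb, rfl⟩ := hz
    refine Submodule.subset_span ⟨ι p (sl21 F) χ y * b, IsMonomial.mul i j y b hy hb, ?_⟩
    rw [Env.toRep_apply, mul_smul]

omit [IsScalarTower F (Env p (sl21 F) χ) X] in
theorem mem_generatedGrading : x ∈ generatedGrading (χ := χ) (p := p) x 0 :=
  Submodule.subset_span ⟨1, IsMonomial.one, (one_smul _ _).symm⟩

end Generated

/-- The Casimir element acts on a highest weight module of highest weight `λ` by `λ₂ (λ₁ + 1)`. -/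
theorem casimir_of_isMaximal {X : Type v} [AddCommGroup X] [Module F X]
    [Module (Env p (sl21 F) χ) X] [IsScalarTower F (Env p (sl21 F) χ) X] {two : (2 : F) ≠ 0}
    {v : X} (h : (act p χ two X).IsMaximal l v)
    (hgen : Submodule.span (Env p (sl21 F) χ) {v} = ⊤) (w : X) :
    (act p χ two X).casimir w = (l.2 * (l.1 + 1)) • w := by
  obtain ⟨a, ha⟩ : ∃ a, a = act p χ two X := ⟨_, rfl⟩
  have htop : LinearMap.ker (a.casimir - algebraMap F _ (l.2 * (l.1 + 1))) = ⊤ := by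
    refine Env.eq_top_of_span hgen (fun x y hy => ?_) ?_
    · rw [LinearMap.mem_ker, LinearMap.sub_apply, sub_eq_zero] at hy ⊢
      have hc := LinearMap.congr_fun (a.commute_casimir x).eq y
      rw [← Env.toRep_apply, ← rep_act two, ← ha]
      simp only [Module.End.mul_apply] at hc
      rw [hc, hy, Module.algebraMap_end_apply, Module.algebraMap_end_apply, map_smul]
    · subst ha
      rw [LinearMap.mem_ker, LinearMap.sub_apply, sub_eq_zero, Module.algebraMap_end_apply]
      simp only [Action.casimir, LinearMap.sub_apply, LinearMap.add_apply, Module.End.mul_apply,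
        h.e12, h.e13, h.e23, h.h1, h.h2, map_smul, map_zero, sub_zero]
      module
  have : w ∈ LinearMap.ker (a.casimir - algebraMap F _ (l.2 * (l.1 + 1))) := htop ▸ trivial
  rw [LinearMap.mem_ker, LinearMap.sub_apply, sub_eq_zero, Module.algebraMap_end_apply] at this
  rw [← ha, this]

variable [Fact p.Prime] [CharP F p]

theorem exists_ne_zero_of_ne_zero (hχ : χ ≠ 0) (h12 : χ (e12 F) = 0) :
    χ (h1 F) ≠ 0 ∨ χ (h2 F) ≠ 0 ∨ χ (e21₀ F) ≠ 0 := by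
  by_contra! hcon
  obtain ⟨c1, c2, c3⟩ := hcon
  apply hχ
  ext w
  have hw : w = w.1 0 0 • SL21.h1 F + w.1 1 1 • SL21.h2 F + w.1 0 1 • SL21.e12 F
      + w.1 1 0 • e21₀ F := by
    have h := supertrace_eq (evenIncl F w)
    obtain ⟨x1, x2, x3, x4⟩ := entries_of_even w.2.2
    simp only [evenIncl, LinearMap.coe_mk, AddHom.coe_mk] at h
    apply Subtype.ext
    ext a b
    fin_cases a <;> fin_cases b <;>
      simp [SL21.h1, SL21.h2, SL21.e12, e21₀, h, x1, x2, x3, x4]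
  rw [hw]
  simp [c1, c2, c3, h12]

/-- All derivations are inner if `χ ≠ 0`, by a central `p`-th power, or if `λ` is typical, by the
Casimir element. -/
theorem Der_le_Ider_of_central {X : Type v} [AddCommGroup X] [Module F X]
    [Module (Env p (sl21 F) χ) X] [IsScalarTower F (Env p (sl21 F) χ) X] {two : (2 : F) ≠ 0}
    {x : X} (hx : (act p χ two X).IsMaximal l x)
    (hgen : Submodule.span (Env p (sl21 F) χ) {x} = ⊤) (hp2 : 2 < p) (h12 : χ (e12 F) = 0)
    (h : χ ≠ 0 ∨ l.2 * (l.1 + 1) ≠ 0) :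
    Der (Env.toRep p (sl21 F) χ X) (generatedGrading (χ := χ) (p := p) x) ≤
      Ider (Env.toRep p (sl21 F) χ X) (generatedGrading (χ := χ) (p := p) x) := by
  rw [← rep_act two]
  have hp : p ≠ 0 := (Fact.out : p.Prime).ne_zero
  have hg := isGradedRep_generatedGrading (p := p) (χ := χ) (x := x) (two := two)
  refine Der_le_Ider fun k ψ hψ hk => ?_
  rcases h with hχ | hl
  · rcases exists_ne_zero_of_ne_zero hχ h12 with hc | hc | hc
    · exact exists_eq_flip_of_h1 two hg hψ hk (pow_ne_zero p hc) (act_h1_pow two)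
    · exact exists_eq_flip_of_h2 two hg hψ hk (pow_ne_zero p hc) (act_h2_pow two)
    · exact exists_eq_flip_of_e21 hp2 hg hψ hk (pow_ne_zero p hc) (act_e21_pow two)
  · exact exists_eq_flip_of_casimir two hg hψ hk hl (casimir_of_isMaximal hx hgen)

theorem simpleDer_le_simpleIder (hp2 : 2 < p) (h12 : χ (e12 F) = 0)
    (h : χ ≠ 0 ∨ l.2 * (l.1 + 1) ≠ 0) : simpleDer p χ l ≤ simpleIder p χ l :=
  Der_le_Ider_of_central (isMaximal_simpleVec (two_ne_zero_of_lt hp2)) span_simpleVec hp2 h12 h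

end General

/-! ### Cocycles that vanish on the torus -/

section Torus

variable {F : Type u} [Field F] {V : Type v} [AddCommGroup V] [Module F V]

/-- The conditions on the values `A, B, C₁, C₂, D₁, D₂` at `e₁₂, e₂₁, e₁₃, e₂₃, e₃₁, e₃₂` under
which the linear map that vanishes on `h₁` and `h₂` is a cocycle: the values are weight vectors and
satisfy one equation for each bracket of two root vectors. -/
structure IsTorusCocycle (a : Action F V) (A B C₁ C₂ D₁ D₂ : V) : Prop where
  h1_A : a.h1 A = A
  h2_A : a.h2 A = -A
  h1_B : a.h1 B = -B
  h2_B : a.h2 B = B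
  h1_C₁ : a.h1 C₁ = 0
  h2_C₁ : a.h2 C₁ = -C₁
  h1_C₂ : a.h1 C₂ = -C₂
  h2_C₂ : a.h2 C₂ = 0
  h1_D₁ : a.h1 D₁ = 0
  h2_D₁ : a.h2 D₁ = D₁
  h1_D₂ : a.h1 D₂ = D₂
  h2_D₂ : a.h2 D₂ = 0
  e12_B : a.e12 B = a.e21 A
  e12_D₁ : a.e12 D₁ = a.e31 A - D₂
  e12_D₂ : a.e12 D₂ = a.e32 A
  e21_D₁ : a.e21 D₁ = a.e31 B
  e21_D₂ : a.e21 D₂ = a.e32 B - D₁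
  e13_A : a.e13 A = a.e12 C₁
  e13_B : a.e13 B = a.e21 C₁ - C₂
  e23_A : a.e23 A = a.e12 C₂ - C₁
  e23_B : a.e23 B = a.e21 C₂
  e13_D₁ : a.e13 D₁ = -a.e31 C₁
  e13_D₂ : a.e13 D₂ = A - a.e32 C₁
  e23_D₁ : a.e23 D₁ = B - a.e31 C₂
  e23_D₂ : a.e23 D₂ = -a.e32 C₂
  e32_D₁ : a.e32 D₁ = -a.e31 D₂
  e31_D₁ : a.e31 D₁ = 0
  e32_D₂ : a.e32 D₂ = 0
  e23_C₁ : a.e23 C₁ = -a.e13 C₂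
  e13_C₁ : a.e13 C₁ = 0
  e23_C₂ : a.e23 C₂ = 0

variable {a : Action F V}

theorem IsCocycle.isTorusCocycle {ψ : sl21 F →ₗ[F] V} (hψ : IsCocycle a.rep ψ)
    (two : (2 : F) ≠ 0) (h1 : ψ (evenIncl F (h1 F)) = 0) (h2 : ψ (evenIncl F (h2 F)) = 0) :
    IsTorusCocycle a (ψ (evenIncl F (e12 F))) (ψ (e21 F)) (ψ (e13 F)) (ψ (e23 F)) (ψ (e31 F))
      (ψ (e32 F)) := by
  obtain ⟨E, hE⟩ : ∃ E, E = hψ.ext two := ⟨_, rfl⟩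
  have hrep : E.rep = extRep a.rep ψ := hE ▸ hψ.rep_ext two
  have f1 : ∀ w, E.h1 w = (a.h1 w.1, 0) := fun w => by
    rw [← E.rep_h1, hrep, extRep_apply, a.rep_h1, h1, smul_zero, add_zero]
  have f2 : ∀ w, E.h2 w = (a.h2 w.1, 0) := fun w => by
    rw [← E.rep_h2, hrep, extRep_apply, a.rep_h2, h2, smul_zero, add_zero]
  have f3 : ∀ w, E.e12 w = (a.e12 w.1 + w.2 • ψ (evenIncl F (e12 F)), 0) := fun w => by
    rw [← E.rep_e12, hrep, extRep_apply, a.rep_e12]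
  have f4 : ∀ w, E.e21 w = (a.e21 w.1 + w.2 • ψ (e21 F), 0) := fun w => by
    rw [← E.rep_e21, hrep, extRep_apply, a.rep_e21]
  have f5 : ∀ w, E.e13 w = (a.e13 w.1 + w.2 • ψ (e13 F), 0) := fun w => by
    rw [← E.rep_e13, hrep, extRep_apply, a.rep_e13]
  have f6 : ∀ w, E.e23 w = (a.e23 w.1 + w.2 • ψ (e23 F), 0) := fun w => by
    rw [← E.rep_e23, hrep, extRep_apply, a.rep_e23]
  have f7 : ∀ w, E.e31 w = (a.e31 w.1 + w.2 • ψ (e31 F), 0) := fun w => by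
    rw [← E.rep_e31, hrep, extRep_apply, a.rep_e31]
  have f8 : ∀ w, E.e32 w = (a.e32 w.1 + w.2 • ψ (e32 F), 0) := fun w => by
    rw [← E.rep_e32, hrep, extRep_apply, a.rep_e32]
  constructor
  · simpa [f1, f3] using congrArg Prod.fst (E.h1_e12 (0, 1))
  · simpa [f2, f3] using congrArg Prod.fst (E.h2_e12 (0, 1))
  · simpa [f1, f4] using congrArg Prod.fst (E.h1_e21 (0, 1))
  · simpa [f2, f4] using congrArg Prod.fst (E.h2_e21 (0, 1))
  · simpa [f1, f5] using congrArg Prod.fst (E.h1_e13 (0, 1))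
  · simpa [f2, f5] using congrArg Prod.fst (E.h2_e13 (0, 1))
  · simpa [f1, f6] using congrArg Prod.fst (E.h1_e23 (0, 1))
  · simpa [f2, f6] using congrArg Prod.fst (E.h2_e23 (0, 1))
  · simpa [f1, f7] using congrArg Prod.fst (E.h1_e31 (0, 1))
  · simpa [f2, f7] using congrArg Prod.fst (E.h2_e31 (0, 1))
  · simpa [f1, f8] using congrArg Prod.fst (E.h1_e32 (0, 1))
  · simpa [f2, f8] using congrArg Prod.fst (E.h2_e32 (0, 1))
  · simpa [f1, f2, f3, f4] using congrArg Prod.fst (E.e12_e21 (0, 1))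
  · simpa [f3, f7, f8] using congrArg Prod.fst (E.e12_e31 (0, 1))
  · simpa [f3, f8] using congrArg Prod.fst (E.e12_e32 (0, 1))
  · simpa [f4, f7] using congrArg Prod.fst (E.e21_e31 (0, 1))
  · simpa [f4, f7, f8] using congrArg Prod.fst (E.e21_e32 (0, 1))
  · simpa [f3, f5] using congrArg Prod.fst (E.e13_e12 (0, 1))
  · simpa [f4, f5, f6] using congrArg Prod.fst (E.e13_e21 (0, 1))
  · simpa [f3, f5, f6] using congrArg Prod.fst (E.e23_e12 (0, 1))
  · simpa [f4, f6] using congrArg Prod.fst (E.e23_e21 (0, 1))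
  · simpa [f1, f5, f7] using congrArg Prod.fst (E.e13_e31 (0, 1))
  · simpa [f3, f5, f8] using congrArg Prod.fst (E.e13_e32 (0, 1))
  · simpa [f4, f6, f7] using congrArg Prod.fst (E.e23_e31 (0, 1))
  · simpa [f2, f6, f8] using congrArg Prod.fst (E.e23_e32 (0, 1))
  · simpa [f7, f8] using congrArg Prod.fst (E.e32_e31 (0, 1))
  · simpa [f7] using congrArg Prod.fst (E.e31_e31 (0, 1))
  · simpa [f8] using congrArg Prod.fst (E.e32_e32 (0, 1))
  · simpa [f5, f6] using congrArg Prod.fst (E.e23_e13 (0, 1))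
  · simpa [f5] using congrArg Prod.fst (E.e13_e13 (0, 1))
  · simpa [f6] using congrArg Prod.fst (E.e23_e23 (0, 1))

/-- The operator `(w, t) ↦ (f w + t u, 0)` on the extension of the trivial module by `V`. -/
def extEnd (f : Module.End F V) (u : V) : Module.End F (V × F) :=
  (f ∘ₗ LinearMap.fst F V F + (LinearMap.toSpanSingleton F V u) ∘ₗ LinearMap.snd F V F).prod 0

@[simp] theorem extEnd_apply (f : Module.End F V) (u : V) (w : V × F) :
    extEnd f u w = (f w.1 + w.2 • u, 0) := rfl

variable {A B C₁ C₂ D₁ D₂ : V}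

/-- The operators on the extension of the trivial module by `V`. -/
def IsTorusCocycle.ext (h : IsTorusCocycle a A B C₁ C₂ D₁ D₂) : Action F (V × F) where
  h1 := extEnd a.h1 0
  h2 := extEnd a.h2 0
  e12 := extEnd a.e12 A
  e21 := extEnd a.e21 B
  e13 := extEnd a.e13 C₁
  e23 := extEnd a.e23 C₂
  e31 := extEnd a.e31 D₁
  e32 := extEnd a.e32 D₂
  h2_h1 w := by simp
  h1_e12 w := by simp [h.h1_A]; module
  h2_e12 w := by simp [h.h2_A]; module
  h1_e21 w := by simp [h.h1_B]; module
  h2_e21 w := by simp [h.h2_B]; module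
  e12_e21 w := by simp [h.e12_B]; module
  h1_e13 w := by simp [h.h1_C₁]
  h2_e13 w := by simp [h.h2_C₁]; module
  h1_e23 w := by simp [h.h1_C₂]; module
  h2_e23 w := by simp [h.h2_C₂]
  h1_e31 w := by simp [h.h1_D₁]
  h2_e31 w := by simp [h.h2_D₁]; module
  h1_e32 w := by simp [h.h1_D₂]; module
  h2_e32 w := by simp [h.h2_D₂]
  e12_e31 w := by simp [h.e12_D₁]; module
  e12_e32 w := by simp [h.e12_D₂]
  e21_e31 w := by simp [h.e21_D₁]
  e21_e32 w := by simp [h.e21_D₂]; module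
  e13_e12 w := by simp [h.e13_A]
  e13_e21 w := by simp [h.e13_B]; module
  e23_e12 w := by simp [h.e23_A]; module
  e23_e21 w := by simp [h.e23_B]
  e13_e31 w := by simp [h.e13_D₁]; module
  e13_e32 w := by simp [h.e13_D₂]; module
  e23_e31 w := by simp [h.e23_D₁]; module
  e23_e32 w := by simp [h.e23_D₂]; module
  e32_e31 w := by simp [h.e32_D₁]; module
  e31_e31 w := by simp [h.e31_D₁]
  e32_e32 w := by simp [h.e32_D₂]
  e23_e13 w := by simp [h.e23_C₁]; module
  e13_e13 w := by simp [h.e13_C₁]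
  e23_e23 w := by simp [h.e23_C₂]

theorem IsTorusCocycle.isCocycle (h : IsTorusCocycle a A B C₁ C₂ D₁ D₂) :
    IsCocycle a.rep (cochain !![0, A, C₁; B, 0, C₂; D₁, D₂, 0]) := by
  refine isCocycle_of_isSuperRep_extRep ?_
  have : extRep a.rep (cochain !![0, A, C₁; B, 0, C₂; D₁, D₂, 0]) = h.ext.rep := by
    refine LinearMap.ext fun x => LinearMap.ext fun w => Prod.ext ?_ ?_
    · simp [Action.rep, cochain, IsTorusCocycle.ext]
      module
    · simp [Action.rep, cochain, IsTorusCocycle.ext]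
  rw [this]
  exact h.ext.isSuperRep_rep

end Torus

/-! ### The grading -/

section Grading

variable {F : Type u} [Field F] {V : Type v} [AddCommGroup V] [Module F V]
  {p : ℕ} [Fact p.Prime] [CharP F p] {a : Action F V} {l : F × F} {v : V}

namespace Action

/-- The eigenspace of `h₁ + h₂` that contains the vectors of parity `i`. -/
def parityPart (a : Action F V) (l : F × F) (i : ZMod 2) : Submodule F V :=
  (a.h1 + a.h2).eigenspace (l.1 + l.2 + (i.val : F))

namespace IsAtypical

theorem isGradedRep_parityPart (h : a.IsAtypical p l v) : IsGradedRep a.rep (a.parityPart l) := by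
  have mem : ∀ {c : F} {y : V}, y ∈ (a.h1 + a.h2).eigenspace c ↔ a.h1 y + a.h2 y = c • y :=
    fun {c y} => Module.End.mem_eigenspace_iff
  intro i j x hx m hm
  have two := h.two
  rcases parity_cases i with rfl | rfl
  · rw [zero_add]
    rw [parityPart, mem] at hm ⊢
    obtain ⟨x1, x2, x3, x4⟩ := entries_of_even hx
    simp only [rep, cochain, LinearMap.coe_mk, AddHom.coe_mk, x1, x2, x3, x4]
    have q1 := congrArg a.h1 hm
    have q2 := congrArg a.h2 hm
    have q3 := congrArg a.e12 hm
    have q4 := congrArg a.e21 hm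
    simp at q1 q2 q3 q4 ⊢
    linear_combination (norm := module) (x : Matrix (Fin 3) (Fin 3) F) 0 0 • q1
      + (x : Matrix (Fin 3) (Fin 3) F) 1 1 • q2 + (x : Matrix (Fin 3) (Fin 3) F) 0 1 • q3
      + (x : Matrix (Fin 3) (Fin 3) F) 1 0 • q4
  · obtain ⟨x1, x2, x3, x4, -⟩ := entries_of_odd hx
    have hrep : a.rep x m = x.1 0 2 • a.e13 m + x.1 1 2 • a.e23 m + x.1 2 0 • a.e31 m
        + x.1 2 1 • a.e32 m := by
      simp [rep, cochain, x1, x2, x3, x4]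
    rw [hrep]
    have s13 : ∀ {c : F}, (a.h1 + a.h2) m = c • m → (a.h1 + a.h2) (a.e13 m) = (c - 1) • a.e13 m :=
      fun {c} hc => by
        have := congrArg a.e13 hc
        simp only [LinearMap.add_apply, map_add, map_smul, e13_h1, e13_h2] at this ⊢
        linear_combination (norm := module) this
    have s23 : ∀ {c : F}, (a.h1 + a.h2) m = c • m → (a.h1 + a.h2) (a.e23 m) = (c - 1) • a.e23 m :=
      fun {c} hc => by
        have := congrArg a.e23 hc
        simp only [LinearMap.add_apply, map_add, map_smul, e23_h1, e23_h2] at this ⊢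
        linear_combination (norm := module) this
    rcases parity_cases j with rfl | rfl
    · have hm' : (a.h1 + a.h2) m = (l.1 + l.2) • m := by
        simpa [parityPart, mem] using hm
      have hm0 := h.mem_degZero hm' (by simp)
      rw [h.toMaximal.e13_degZero hm0, h.toMaximal.e23_degZero hm0, smul_zero, smul_zero,
        zero_add, zero_add]
      have k : ((1 + 0 : ZMod 2).val : F) = 1 := by simp [show (1 : ZMod 2).val = 1 from rfl]
      rw [parityPart, k]
      exact add_mem (Submodule.smul_mem _ _ (Module.End.mem_eigenspace_iff.2 (sum_h_e31 hm')))
        (Submodule.smul_mem _ _ (Module.End.mem_eigenspace_iff.2 (sum_h_e32 hm')))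
    · have hm' : (a.h1 + a.h2) m = (l.1 + l.2 + 1) • m := by
        simpa [parityPart, mem, show (1 : ZMod 2).val = 1 from rfl] using hm
      have hm1 := h.mem_degOne hm' (by simp)
      rw [h.e31_degOne hm1, h.e32_degOne hm1, smul_zero, smul_zero, add_zero, add_zero]
      have k : ((1 + 1 : ZMod 2).val : F) = 0 := by
        rw [show (1 : ZMod 2) + 1 = 0 by decide]; simp
      have t13 := s13 hm'
      have t23 := s23 hm'
      rw [add_sub_cancel_right] at t13 t23
      rw [parityPart, k, add_zero]
      exact add_mem (Submodule.smul_mem _ _ (Module.End.mem_eigenspace_iff.2 t13))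
        (Submodule.smul_mem _ _ (Module.End.mem_eigenspace_iff.2 t23))

omit [Fact p.Prime] [CharP F p] in
theorem disjoint_parityPart : Disjoint (a.parityPart l 0) (a.parityPart l 1) := by
  rw [Submodule.disjoint_def]
  intro x h0 h1
  exact eq_zero_of_eigen (Module.End.mem_eigenspace_iff.1 h0) (Module.End.mem_eigenspace_iff.1 h1)
    (by simp [show (1 : ZMod 2).val = 1 from rfl])

end IsAtypical

end Action

/-- The grading of an atypical module refines the eigenspaces of `h₁ + h₂`. -/
theorem disjoint_generatedGrading {χ : Module.Dual F (evenPart F)} {X : Type v} [AddCommGroup X]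
    [Module F X] [Module (Env p (sl21 F) χ) X] [IsScalarTower F (Env p (sl21 F) χ) X]
    {two : (2 : F) ≠ 0} {x : X} (h : (act p χ two X).IsAtypical p l x) :
    Disjoint (generatedGrading (χ := χ) (p := p) x 0)
      (generatedGrading (χ := χ) (p := p) x 1) := by
  have hg := h.isGradedRep_parityPart
  rw [rep_act] at hg
  have hle : ∀ i, generatedGrading (χ := χ) (p := p) x i ≤ (act p χ two X).parityPart l i := by
    intro i
    refine Submodule.span_le.2 ?_
    rintro _ ⟨b, hb, rfl⟩
    induction hb with
    | one =>
      rw [one_smul]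
      refine Module.End.mem_eigenspace_iff.2 ?_
      rw [ZMod.val_zero, Nat.cast_zero, add_zero]
      exact h.toMaximal.sum_h_degZero ((act p χ two X).self_mem_degZero x)
    | mul i j y b hy _ ih =>
      rw [mul_smul, ← Env.toRep_apply]
      exact hg i j y hy _ ih
  exact Action.IsAtypical.disjoint_parityPart.mono (hle 0) (hle 1)

end Grading

/-! ### Classification of the cocycles that vanish on the torus -/

section Classification

variable {F : Type u} [Field F] {V : Type v} [AddCommGroup V] [Module F V]
  {p : ℕ} [Fact p.Prime] [CharP F p] {a : Action F V} {l : F × F} {v : V}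
  {A B C₁ C₂ D₁ D₂ : V}

section Weights

variable (h : IsTorusCocycle a A B C₁ C₂ D₁ D₂)

include h

theorem IsTorusCocycle.sum_A : (a.h1 + a.h2) A = (0 : F) • A := by
  rw [LinearMap.add_apply, h.h1_A, h.h2_A]; module

theorem IsTorusCocycle.sum_B : (a.h1 + a.h2) B = (0 : F) • B := by
  rw [LinearMap.add_apply, h.h1_B, h.h2_B]; module

theorem IsTorusCocycle.sum_C₁ : (a.h1 + a.h2) C₁ = (-1 : F) • C₁ := by
  rw [LinearMap.add_apply, h.h1_C₁, h.h2_C₁]; module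

theorem IsTorusCocycle.sum_C₂ : (a.h1 + a.h2) C₂ = (-1 : F) • C₂ := by
  rw [LinearMap.add_apply, h.h1_C₂, h.h2_C₂]; module

theorem IsTorusCocycle.sum_D₁ : (a.h1 + a.h2) D₁ = (1 : F) • D₁ := by
  rw [LinearMap.add_apply, h.h1_D₁, h.h2_D₁]; module

theorem IsTorusCocycle.sum_D₂ : (a.h1 + a.h2) D₂ = (1 : F) • D₂ := by
  rw [LinearMap.add_apply, h.h1_D₂, h.h2_D₂]; module

end Weights

theorem one_ne_neg_one (two : (2 : F) ≠ 0) : (1 : F) ≠ -1 := fun h =>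
  two (by linear_combination h)

namespace Action.IsAtypical

theorem e23_degOne_mem (h : a.IsAtypical p l v) {x : V} (hx : x ∈ a.degOne v) :
    a.e23 x ∈ a.degZero v := by
  have := h.toMaximal.sum_h_degOne hx
  refine h.mem_degZero (t := l.1 + l.2) ?_ (by simp)
  have k := congrArg a.e23 this
  simp only [LinearMap.add_apply, map_add, map_smul, e23_h1, e23_h2] at k ⊢
  linear_combination (norm := module) k

omit [Fact p.Prime] in
/-- The vectors `e₂₁ᵏ v` with `k ≤ λ₁ - λ₂` do not vanish. -/
theorem vec_ne_zero (h : a.IsAtypical p l v) {r : ℕ} (hr : r < p) (hl : (r : F) = l.1 - l.2)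
    {k : ℕ} (hk : k ≤ r) : a.vec v k ≠ 0 := by
  induction k with
  | zero => rw [EvenAction.vec_zero]; exact h.ne_zero
  | succ k ih =>
    intro h0
    have h12 := h.e12_vec_succ k
    rw [h0, map_zero, ← hl, ← Nat.cast_sub (by omega)] at h12
    have hne : ((k : F) + 1) * ((r - k : ℕ) : F) ≠ 0 := by
      refine mul_ne_zero ?_ (natCast_ne_zero_of_lt (p := p) (by omega) (by omega))
      exact_mod_cast natCast_ne_zero_of_lt (F := F) (p := p) (Nat.succ_ne_zero k) (by omega)
    exact (smul_ne_zero hne (ih (by omega))) h12.symm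

/-- A nonzero `D₂` is singular of degree `0`, hence a multiple of `v`, and its weight is `(1, 0)`. -/
theorem D_eq_of_ne (h : a.IsAtypical p l v) (hZ : IsTorusCocycle a A B C₁ C₂ D₁ D₂)
    (hc : l.1 + l.2 ≠ 0) (hA : A = 0) (hB : B = 0) :
    D₁ = -a.e21 D₂ ∧ (D₂ ≠ 0 → l = (1, 0)) ∧ ∃ c : F, D₂ = c • v := by
  have hD : D₁ = -a.e21 D₂ := by
    have := hZ.e21_D₂
    rw [hB, map_zero, zero_sub] at this
    rw [this, neg_neg]
  refine ⟨hD, ?_⟩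
  by_cases h0 : D₂ = 0
  · exact ⟨fun h' => absurd h0 h', 0, by rw [h0, zero_smul]⟩
  have hm := h.mem_degZero hZ.sum_D₂ (fun h' => hc (by linear_combination -h'))
  obtain ⟨h1, c, hc'⟩ := h.weight_eq_of_singular hm (t := 1) (by rw [hZ.h1_D₂, one_smul])
    (by rw [hZ.e12_D₂, hA, map_zero]) h0
  refine ⟨fun _ => Prod.ext h1.symm ?_, c, hc'⟩
  have := h.toMaximal.sum_h_degZero hm
  rw [hZ.sum_D₂] at this
  have k := smul_left_injective F h0 this
  linear_combination -k + h1

/-- A nonzero `C₁` has degree `-1`, and `e₂₃ C₁` is singular of weight `(-1, -1)`. -/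
theorem C_eq_of_ne (h : a.IsAtypical p l v) (hZ : IsTorusCocycle a A B C₁ C₂ D₁ D₂)
    (hc : l.1 + l.2 ≠ -1) (hA : A = 0) (hB : B = 0) :
    (C₁ = 0 ∧ C₂ = 0) ∨
      (l = (-1, -1) ∧ ∃ c : F, C₁ = c • a.e32 v ∧ C₂ = -(c • a.e31 v)) := by
  have hC2 : C₂ = a.e21 C₁ := by
    have := hZ.e13_B
    rw [hB, map_zero] at this
    exact (sub_eq_zero.1 this.symm).symm
  have hm := h.mem_degOne hZ.sum_C₁ hc.symm
  have h12 : a.e12 C₁ = 0 := by rw [← hZ.e13_A, hA, map_zero]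
  by_cases h0 : a.e23 C₁ = 0
  · left
    have : C₁ = 0 := h.degOne_ext hm (zero_mem _) (by rw [hZ.e13_C₁, map_zero])
      (by rw [h0, map_zero])
    exact ⟨this, by rw [hC2, this, map_zero]⟩
  right
  obtain ⟨h1, c, hc'⟩ := h.weight_eq_of_singular (h.e23_degOne_mem hm) (t := -1)
    (by rw [a.h1_e23, hZ.h1_C₁, map_zero, zero_sub, neg_one_smul])
    (by
      have := a.e23_e12 C₁
      rw [h12, map_zero, hZ.e13_C₁, sub_zero] at this
      exact this.symm) h0
  have hl2 : l.2 = -1 := by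
    have k1 := h.toMaximal.sum_h_degZero (h.e23_degOne_mem hm)
    rw [LinearMap.add_apply, a.h1_e23, a.h2_e23, hZ.h1_C₁, hZ.h2_C₁] at k1
    have k2 : (-2 : F) • a.e23 C₁ = (l.1 + l.2) • a.e23 C₁ := by
      rw [← k1, map_zero, map_neg]; module
    have k := smul_left_injective F h0 k2
    linear_combination -k + h1
  have hl : l = (-1, -1) := Prod.ext h1.symm hl2
  have hC1 : C₁ = -c • a.e32 v := by
    refine h.degOne_ext hm (Submodule.smul_mem _ _ (h.e32_mem_degOne v)) ?_ ?_
    · rw [hZ.e13_C₁, map_smul, a.e13_e32, h.e12, h.toMaximal.e13, map_zero, sub_zero, smul_zero]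
    · rw [hc', map_smul, a.e23_e32, h.h2, h.toMaximal.e23, map_zero, sub_zero, hl2]
      module
  refine ⟨hl, -c, hC1, ?_⟩
  have hv1 : a.e21 v = 0 := by
    have := h.toSimple.vec_eq_zero h.two (r := 0) (by rw [hl]; simp) zero_lt_one
    rwa [← zero_add 1, ← EvenAction.e21_vec, EvenAction.vec_zero] at this
  rw [hC2, hC1, map_smul, a.e21_e32, hv1, map_zero, zero_sub, smul_neg]

/-- If `λ₁ + λ₂` is neither `0` nor `-1`, then `A = B = 0`. -/
theorem torusCocycle_of_ne (h : a.IsAtypical p l v) (hZ : IsTorusCocycle a A B C₁ C₂ D₁ D₂)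
    (hc0 : l.1 + l.2 ≠ 0) (hc1 : l.1 + l.2 ≠ -1) : A = 0 ∧ B = 0 :=
  ⟨h.eq_zero_of_sum_h hZ.sum_A hc0.symm (fun h' => hc1 (by linear_combination -h')),
    h.eq_zero_of_sum_h hZ.sum_B hc0.symm (fun h' => hc1 (by linear_combination -h'))⟩

theorem natCast_pred : ((p - 1 : ℕ) : F) = -1 := by
  rw [Nat.cast_sub (Fact.out : p.Prime).one_lt.le, CharP.cast_eq_zero]; simp

omit [Fact p.Prime] in
theorem natCast_sub_two (hp2 : 2 < p) : ((p - 2 : ℕ) : F) = -2 := by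
  rw [Nat.cast_sub hp2.le, CharP.cast_eq_zero]; norm_num

/-- The parameter `c` belongs to `ψ₆` and `d` to `ψ₇`. -/
theorem torusCocycle_neg_one_one (h : a.IsAtypical p (-1, 1) v) (hp2 : 2 < p)
    (hZ : IsTorusCocycle a A B C₁ C₂ D₁ D₂) :
    ∃ c d : F, A = c • a.vec v (p - 2) ∧ B = d • v ∧ C₁ = 0 ∧ C₂ = 0 ∧ D₁ = d • a.e32 v ∧
      D₂ = c • a.e31 (a.vec v (p - 2)) := by
  have two := h.two
  have h1 : (1 : F) ≠ -1 := one_ne_neg_one two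
  have mA := h.mem_degZero hZ.sum_A (by simp)
  have mB := h.mem_degZero hZ.sum_B (by simp)
  have mD1 := h.mem_degOne hZ.sum_D₁ (by simp)
  have mD2 := h.mem_degOne hZ.sum_D₂ (by simp)
  have hC1 : C₁ = 0 := h.eq_zero_of_sum_h hZ.sum_C₁ (by simp) (by simpa using h1.symm)
  have hC2 : C₂ = 0 := h.eq_zero_of_sum_h hZ.sum_C₂ (by simp) (by simpa using h1.symm)
  obtain ⟨c, hA⟩ : ∃ c : F, A = c • a.vec v (p - 2) := by
    by_cases h0 : A = 0
    · exact ⟨0, by rw [h0, zero_smul]⟩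
    obtain ⟨k, hk, hkt, c, hc⟩ := h.exists_smul_vec mA (t := 1) (by rw [hZ.h1_A, one_smul]) h0
    have : k = p - 2 := eq_of_natCast_eq (F := F) hk (by omega)
      (by rw [natCast_sub_two hp2]; simp only at hkt; linear_combination -hkt)
    exact ⟨c, this ▸ hc⟩
  obtain ⟨d, hB⟩ : ∃ d : F, B = d • v := by
    by_cases h0 : B = 0
    · exact ⟨0, by rw [h0, zero_smul]⟩
    obtain ⟨k, hk, hkt, c, hc⟩ := h.exists_smul_vec mB (t := -1) (by rw [hZ.h1_B, neg_one_smul]) h0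
    have : k = 0 := eq_of_natCast_eq (F := F) hk (by omega)
      (by simp only at hkt; rw [Nat.cast_zero]; linear_combination -hkt)
    rw [this, EvenAction.vec_zero] at hc
    exact ⟨c, hc⟩
  refine ⟨c, d, hA, hB, hC1, hC2, ?_, ?_⟩
  · refine h.degOne_ext mD1 (Submodule.smul_mem _ _ (h.e32_mem_degOne v)) ?_ ?_
    · rw [hZ.e13_D₁, hC1, map_zero, neg_zero, map_smul, a.e13_e32, h.e12, h.toMaximal.e13,
        map_zero, sub_zero, smul_zero]
    · rw [hZ.e23_D₁, hC2, map_zero, sub_zero, hB, map_smul, a.e23_e32, h.h2, h.toMaximal.e23,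
        map_zero, sub_zero, one_smul]
  · refine h.degOne_ext mD2 (Submodule.smul_mem _ _ (h.e31_mem_degOne _)) ?_ ?_
    · rw [hZ.e13_D₂, hC1, map_zero, sub_zero, hA, map_smul, h.toMaximal.e13_e31_vec,
        natCast_sub_two hp2]
      module
    · rw [hZ.e23_D₂, hC2, map_zero, neg_zero, map_smul, h.toMaximal.e23_e31_vec,
        h.toSimple.vec_eq_zero two (r := p - 2) (by rw [natCast_sub_two hp2]; norm_num) (by omega),
        smul_zero]

/-- The parameter `c` belongs to `ψ₄` and `d` to `ψ₅`. -/
theorem torusCocycle_neg_one_zero (h : a.IsAtypical p (-1, 0) v)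
    (hZ : IsTorusCocycle a A B C₁ C₂ D₁ D₂) :
    ∃ c d : F, A = c • a.e32 (a.vec v (p - 1)) ∧ B = d • a.e31 v ∧ C₁ = c • a.vec v (p - 1) ∧
      C₂ = d • v ∧ D₁ = 0 ∧ D₂ = 0 := by
  have two := h.two
  have h1 : (1 : F) ≠ -1 := one_ne_neg_one two
  have hp1 := (Fact.out : p.Prime).one_lt
  have mC1 := h.mem_degZero hZ.sum_C₁ (by simp)
  have mC2 := h.mem_degZero hZ.sum_C₂ (by simp)
  have hD1 : D₁ = 0 := h.eq_zero_of_sum_h hZ.sum_D₁ (by simpa using h1) (by simp)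
  have hD2 : D₂ = 0 := h.eq_zero_of_sum_h hZ.sum_D₂ (by simpa using h1) (by simp)
  obtain ⟨c, hC1⟩ : ∃ c : F, C₁ = c • a.vec v (p - 1) := by
    by_cases h0 : C₁ = 0
    · exact ⟨0, by rw [h0, zero_smul]⟩
    obtain ⟨k, hk, hkt, c, hc⟩ := h.exists_smul_vec mC1 (t := 0) (by rw [hZ.h1_C₁, zero_smul]) h0
    have : k = p - 1 := eq_of_natCast_eq (F := F) hk (by omega)
      (by rw [natCast_pred]; simp only at hkt; linear_combination -hkt)
    exact ⟨c, this ▸ hc⟩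
  obtain ⟨d, hC2⟩ : ∃ d : F, C₂ = d • v := by
    by_cases h0 : C₂ = 0
    · exact ⟨0, by rw [h0, zero_smul]⟩
    obtain ⟨k, hk, hkt, c, hc⟩ := h.exists_smul_vec mC2 (t := -1)
      (by rw [hZ.h1_C₂, neg_one_smul]) h0
    have : k = 0 := eq_of_natCast_eq (F := F) hk (by omega)
      (by simp only at hkt; rw [Nat.cast_zero]; linear_combination -hkt)
    rw [this, EvenAction.vec_zero] at hc
    exact ⟨c, hc⟩
  refine ⟨c, d, ?_, ?_, hC1, hC2, hD1, hD2⟩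
  · have := hZ.e13_D₂
    rw [hD2, map_zero] at this
    rw [sub_eq_zero.1 this.symm, hC1, map_smul]
  · have := hZ.e23_D₁
    rw [hD1, map_zero] at this
    rw [sub_eq_zero.1 this.symm, hC2, map_smul]

/-! ### The explicit cocycles -/

theorem isTorusCocycle_neg_one_neg_one (h : a.IsAtypical p (-1, -1) v) :
    IsTorusCocycle a 0 0 (-a.e32 v) (a.e31 v) 0 0 := by
  have hv1 : a.e21 v = 0 := by
    have := h.toSimple.vec_eq_zero h.two (r := 0) (by simp) zero_lt_one
    rwa [← zero_add 1, ← EvenAction.e21_vec, EvenAction.vec_zero] at this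
  constructor <;> simp [h.h1, h.h2, h.e12, h.toMaximal.e13, h.toMaximal.e23, hv1, h.e31_e32]

theorem isTorusCocycle_one_zero (h : a.IsAtypical p (1, 0) v) :
    IsTorusCocycle a 0 0 0 0 (-a.e21 v) v := by
  have hv2 : a.e21 (a.e21 v) = 0 := by
    have := h.toSimple.vec_eq_zero h.two (r := 1) (k := 2) (by simp) (by omega)
    rwa [← one_add_one_eq_two, ← EvenAction.e21_vec, ← zero_add 1, ← EvenAction.e21_vec,
      EvenAction.vec_zero] at this
  have e1 : a.e31 (a.e21 v) = 0 := h.degOne_ext (h.e31_mem_degOne _) (zero_mem _)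
    (by simp [h.h1, h.toMaximal.e13, h.toMaximal.e23])
    (by simp [hv2, h.toMaximal.e23])
  have e2 : a.e32 v = 0 := h.degOne_ext (h.e32_mem_degOne _) (zero_mem _)
    (by simp [h.e12, h.toMaximal.e13]) (by simp [h.h2, h.toMaximal.e23])
  have e3 : a.e32 (a.e21 v) = a.e31 v := h.degOne_ext (h.e32_mem_degOne _) (h.e31_mem_degOne _)
    (by simp [h.h1, h.h2, h.e12, h.toMaximal.e13, h.toMaximal.e23])
    (by simp [h.h2, h.toMaximal.e23])
  constructor <;> simp [h.h1, h.h2, h.e12, h.toMaximal.e13, h.toMaximal.e23, hv2, e1, e2, e3]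

/-- Both sides have degree `-1`, where `e₁₃` and `e₂₃` together are injective. -/
theorem e32_vec_pred (h : a.IsAtypical p (-1, 0) v) (hp2 : 2 < p) :
    a.e32 (a.vec v (p - 1)) = -a.e31 (a.vec v (p - 2)) := by
  refine h.degOne_ext (h.e32_mem_degOne _) (neg_mem (h.e31_mem_degOne _)) ?_ ?_
  · rw [h.toMaximal.e13_e32_vec, map_neg, h.toMaximal.e13_e31_vec, natCast_sub_two hp2,
      natCast_pred, show p - 1 - 1 = p - 2 by omega]
    module
  · rw [h.toMaximal.e23_e32_vec, map_neg, h.toMaximal.e23_e31_vec,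
      natCast_pred, show p - 2 + 1 = p - 1 by omega]
    module

theorem e31_vec_pred (h : a.IsAtypical p (-1, 0) v) : a.e31 (a.vec v (p - 1)) = 0 := by
  have hp1 := (Fact.out : p.Prime).one_lt
  refine h.degOne_ext (h.e31_mem_degOne _) (zero_mem _) ?_ ?_
  · rw [h.toMaximal.e13_e31_vec, natCast_pred, map_zero, sub_self, zero_smul]
  · rw [h.toMaximal.e23_e31_vec, h.toSimple.vec_eq_zero_of_le (by omega), map_zero]

theorem e32_eq_zero (h : a.IsAtypical p (-1, 0) v) : a.e32 v = 0 :=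
  h.degOne_ext (h.e32_mem_degOne _) (zero_mem _)
    (by simp [h.e12, h.toMaximal.e13]) (by simp [h.h2, h.toMaximal.e23])

theorem isTorusCocycle_neg_one_zero_left (h : a.IsAtypical p (-1, 0) v) :
    IsTorusCocycle a (a.e32 (a.vec v (p - 1))) 0 (a.vec v (p - 1)) 0 0 0 := by
  have hp1 := (Fact.out : p.Prime).one_lt
  have k1 : a.h1 (a.vec v (p - 1)) = 0 := by rw [h.h1_vec, natCast_pred]; simp
  have k2 : a.h2 (a.vec v (p - 1)) = -a.vec v (p - 1) := by rw [h.h2_vec, natCast_pred]; simp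
  have k3 : a.e21 (a.vec v (p - 1)) = 0 := by
    rw [EvenAction.e21_vec, h.toSimple.vec_eq_zero_of_le (by omega)]
  constructor <;> simp [k1, k2, k3, h.toMaximal.e13_vec, h.toMaximal.e23_vec, h.e31_e32,
    h.e31_vec_pred]

theorem isTorusCocycle_neg_one_zero_right (h : a.IsAtypical p (-1, 0) v) :
    IsTorusCocycle a 0 (a.e31 v) 0 v 0 0 := by
  constructor <;> simp [h.h1, h.h2, h.e12, h.toMaximal.e13, h.toMaximal.e23,
    h.e32_eq_zero]

theorem isTorusCocycle_neg_one_one_left (h : a.IsAtypical p (-1, 1) v) (hp2 : 2 < p) :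
    IsTorusCocycle a (a.vec v (p - 2)) 0 0 0 0 (a.e31 (a.vec v (p - 2))) := by
  have k1 : a.h1 (a.vec v (p - 2)) = a.vec v (p - 2) := by
    rw [h.h1_vec, natCast_sub_two hp2]; module
  have k2 : a.h2 (a.vec v (p - 2)) = -a.vec v (p - 2) := by
    rw [h.h2_vec, natCast_sub_two hp2]; module
  have k3 : a.e21 (a.vec v (p - 2)) = 0 := by
    rw [EvenAction.e21_vec, h.toSimple.vec_eq_zero h.two (r := p - 2)
      (by rw [natCast_sub_two hp2]; norm_num) (by omega)]
  have k4 : a.e31 (a.e12 (a.vec v (p - 2))) = (2 : F) • a.e32 (a.vec v (p - 2)) := by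
    obtain ⟨j, hj⟩ : ∃ j, p - 2 = j + 1 := ⟨p - 3, by omega⟩
    have hj' : (j : F) = -3 := by
      have := natCast_sub_two (F := F) hp2
      rw [hj] at this; push_cast at this; linear_combination this
    have e : a.e32 (a.vec v (j + 1)) = -a.e31 (a.vec v j) := by
      refine h.degOne_ext (h.e32_mem_degOne _) (neg_mem (h.e31_mem_degOne _)) ?_ ?_
      · rw [h.toMaximal.e13_e32_vec, map_neg, h.toMaximal.e13_e31_vec, Nat.add_sub_cancel]
        push_cast; rw [hj']; module
      · rw [h.toMaximal.e23_e32_vec, map_neg, h.toMaximal.e23_e31_vec]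
        push_cast; rw [hj']; module
    rw [hj, h.e12_vec_succ, map_smul, e, hj']
    module
  constructor <;> simp [k1, k2, k3, h.toMaximal.e13_vec, h.toMaximal.e23_vec, h.e31_e32, k4]
  module

theorem isTorusCocycle_neg_one_one_right (h : a.IsAtypical p (-1, 1) v) :
    IsTorusCocycle a 0 v 0 0 (a.e32 v) 0 := by
  have e : a.e32 (a.e21 v) = (2 : F) • a.e31 v := by
    refine h.degOne_ext (h.e32_mem_degOne _)
      (Submodule.smul_mem _ _ (h.e31_mem_degOne _)) ?_ ?_
    · simp [h.h1, h.h2, h.e12, h.toMaximal.e13, h.toMaximal.e23]; module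
    · simp [h.h2, h.toMaximal.e23]; module
  constructor <;> simp [h.h1, h.h2, h.e12, h.toMaximal.e13, h.toMaximal.e23, h.e31_e32, e]
  module

end Action.IsAtypical

end Classification

/-! ### Derivations into atypical modules -/

section Derivations

variable {F : Type u} [Field F] {V : Type v} [AddCommGroup V] [Module F V]

theorem IsCocycle.sub {ρ : sl21 F →ₗ[F] Module.End F V} {φ ψ : sl21 F →ₗ[F] V}
    (hφ : IsCocycle ρ φ) (hψ : IsCocycle ρ ψ) : IsCocycle ρ (φ - ψ) := by
  intro i j x y z hx hy hz
  simp only [LinearMap.sub_apply, hφ i j x y z hx hy hz, hψ i j x y z hx hy hz, map_sub]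
  module

theorem IsHomogMap.sub {gr : ZMod 2 → Submodule F V} {k : ZMod 2} {φ ψ : sl21 F →ₗ[F] V}
    (hφ : IsHomogMap gr k φ) (hψ : IsHomogMap gr k ψ) : IsHomogMap gr k (φ - ψ) :=
  fun i x hx => sub_mem (hφ i x hx) (hψ i x hx)

theorem IsHomogMap.signTwist {gr : ZMod 2 → Submodule F V} {k : ZMod 2} {φ : sl21 F →ₗ[F] V}
    (hφ : IsHomogMap gr k φ) (j : ZMod 2) : IsHomogMap gr k (signTwist j φ) := fun i x hx => by
  rw [signTwist_apply j φ hx]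
  exact Submodule.smul_mem _ _ (hφ i x hx)

theorem signTwist_add (k : ZMod 2) (φ ψ : sl21 F →ₗ[F] V) :
    signTwist k (φ + ψ) = signTwist k φ + signTwist k ψ :=
  linearMap_ext_of_homog fun i x hx => by
    simp only [LinearMap.add_apply, signTwist_apply k _ hx, smul_add]

theorem signTwist_smul (k : ZMod 2) (c : F) (φ : sl21 F →ₗ[F] V) :
    signTwist k (c • φ) = c • signTwist k φ :=
  linearMap_ext_of_homog fun i x hx => by
    rw [LinearMap.smul_apply, signTwist_apply k _ hx, signTwist_apply k _ hx, LinearMap.smul_apply,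
      smul_comm]

theorem signTwist_zero (k : ZMod 2) : signTwist k (0 : sl21 F →ₗ[F] V) = 0 := by
  rw [← zero_smul F (0 : sl21 F →ₗ[F] V), signTwist_smul, zero_smul, zero_smul]

/-- A map that is homogeneous of both parities vanishes. -/
theorem eq_zero_of_isHomogMap {gr : ZMod 2 → Submodule F V} (hd : Disjoint (gr 0) (gr 1))
    {φ : sl21 F →ₗ[F] V} (h0 : IsHomogMap gr 0 φ) (h1 : IsHomogMap gr 1 φ) : φ = 0 := by
  rw [Submodule.disjoint_def] at hd
  refine linearMap_ext_of_homog fun i x hx => ?_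
  rcases parity_cases i with rfl | rfl
  · exact hd _ (h0 0 x hx) (h1 0 x hx)
  · exact hd _ (h1 1 x hx) (h0 1 x hx)

theorem mem_Ider_iff {ρ : sl21 F →ₗ[F] Module.End F V} {gr : ZMod 2 → Submodule F V}
    {φ : sl21 F →ₗ[F] V} : φ ∈ Ider ρ gr ↔ ∃ m ∈ gr 0, ∃ n ∈ gr 1,
      φ = signTwist 0 (ρ.flip m) + signTwist 1 (ρ.flip n) := by
  constructor
  · intro h
    induction h using Submodule.span_induction with
    | zero =>
      refine ⟨0, zero_mem _, 0, zero_mem _, ?_⟩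
      rw [map_zero, signTwist_zero, signTwist_zero, add_zero]
    | add φ ψ _ _ hφ hψ =>
      obtain ⟨m, hm, n, hn, rfl⟩ := hφ
      obtain ⟨m', hm', n', hn', rfl⟩ := hψ
      refine ⟨m + m', add_mem hm hm', n + n', add_mem hn hn', ?_⟩
      rw [map_add, map_add, signTwist_add, signTwist_add]
      abel
    | smul c φ _ hφ =>
      obtain ⟨m, hm, n, hn, rfl⟩ := hφ
      refine ⟨c • m, Submodule.smul_mem _ _ hm, c • n, Submodule.smul_mem _ _ hn, ?_⟩
      rw [map_smul, map_smul, signTwist_smul, signTwist_smul, smul_add]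
    | mem φ hφ =>
      obtain ⟨k, m, hm, hφ⟩ := hφ
      have : φ = signTwist k (ρ.flip m) := linearMap_ext_of_homog fun i x hx => by
        rw [hφ i x hx, signTwist_apply k _ hx, sgn_comm, LinearMap.flip_apply]
      rcases parity_cases k with rfl | rfl
      · exact ⟨m, hm, 0, zero_mem _, by rw [this, map_zero, signTwist_zero, add_zero]⟩
      · exact ⟨0, zero_mem _, m, hm, by rw [this, map_zero, signTwist_zero, zero_add]⟩
  · rintro ⟨m, hm, n, hn, rfl⟩
    exact add_mem (signTwist_flip_mem_Ider hm) (signTwist_flip_mem_Ider hn)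

variable {a : Action F V} {gr : ZMod 2 → Submodule F V}

/-- An inner derivation that vanishes on the torus is zero if `0` is not a weight of `V`. -/
theorem eq_zero_of_mem_Ider (hd : Disjoint (gr 0) (gr 1))
    (h0 : ∀ x, a.h1 x = 0 → a.h2 x = 0 → x = 0) {φ : sl21 F →ₗ[F] V} (hφ : φ ∈ Ider a.rep gr)
    (h1 : φ (evenIncl F (h1 F)) = 0) (h2 : φ (evenIncl F (h2 F)) = 0) : φ = 0 := by
  obtain ⟨m, hm, n, hn, rfl⟩ := mem_Ider_iff.1 hφ
  have val : ∀ w, (signTwist 0 (a.rep.flip m) + signTwist 1 (a.rep.flip n)) (evenIncl F w)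
      = a.rep (evenIncl F w) (m + n) := fun w => by
    rw [LinearMap.add_apply, signTwist_apply _ _ (isHomog_evenIncl w),
      signTwist_apply _ _ (isHomog_evenIncl w), sgn_zero_right, sgn_zero_right, one_smul, one_smul,
      LinearMap.flip_apply, LinearMap.flip_apply, map_add]
  rw [val, a.rep_h1] at h1
  rw [val, a.rep_h2] at h2
  have hmn := h0 _ h1 h2
  have hm0 : m = 0 := Submodule.disjoint_def.1 hd m hm (by
    rw [eq_neg_of_add_eq_zero_left hmn]; exact neg_mem hn)
  have hn0 : n = 0 := by rwa [hm0, zero_add] at hmn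
  refine linearMap_ext_of_homog fun i x hx => ?_
  rw [LinearMap.add_apply, signTwist_apply _ _ hx, signTwist_apply _ _ hx, hm0, hn0]
  simp

variable {p : ℕ} [Fact p.Prime] [CharP F p] {l : F × F} {v : V}

omit [Fact p.Prime] [CharP F p] in
/-- A nontrivial simple module has no invariants. -/
theorem Action.IsSimpleHighestWeight.eq_zero_of_invariant (h : a.IsSimpleHighestWeight p l v)
    (hl : l ≠ 0) (m : V) (hm : ∀ x, a.rep x m = 0) : m = 0 := by
  have e1 : a.h1 m = 0 := by rw [← a.rep_h1, hm]
  have e2 : a.h2 m = 0 := by rw [← a.rep_h2, hm]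
  have e3 : a.e12 m = 0 := by rw [← a.rep_e12, hm]
  have e4 : a.e21 m = 0 := by rw [← a.rep_e21, hm]
  have e5 : a.e13 m = 0 := by rw [← a.rep_e13, hm]
  have e6 : a.e23 m = 0 := by rw [← a.rep_e23, hm]
  have e7 : a.e31 m = 0 := by rw [← a.rep_e31, hm]
  have e8 : a.e32 m = 0 := by rw [← a.rep_e32, hm]
  by_contra h0
  have hmax : a.IsMaximal 0 m := ⟨⟨e3, by simp [e1], by simp [e2]⟩, e5, e6⟩
  have htop := h.span_of_isMaximal hmax h0
  have hle : Submodule.span F (a.monomials m) ≤ LinearMap.ker a.h1 ⊓ LinearMap.ker a.h2 := by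
    have hv : ∀ k, a.vec m k = 0 ∨ a.vec m k = m := fun k => by
      induction k with
      | zero => exact Or.inr EvenAction.vec_zero
      | succ k ih =>
        left
        rw [← EvenAction.e21_vec]
        rcases ih with h | h <;> rw [h]
        · rw [map_zero]
        · exact e4
    rw [Submodule.span_le]
    rintro _ ⟨k, rfl | rfl | rfl | rfl⟩ <;> rcases hv k with h | h <;> rw [h] <;>
      simp [e1, e2, e7, e8]
  have hmem : v ∈ LinearMap.ker a.h1 ⊓ LinearMap.ker a.h2 := hle (htop ▸ Submodule.mem_top)
  have k1 : a.h1 v = 0 := hmem.1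
  have k2 : a.h2 v = 0 := hmem.2
  rw [h.h1] at k1
  rw [h.h2] at k2
  exact hl (Prod.ext ((smul_eq_zero.1 k1).resolve_right h.ne_zero)
    ((smul_eq_zero.1 k2).resolve_right h.ne_zero))

namespace Action.IsAtypical

/-- Up to an inner derivation, a cocycle vanishes on the torus. -/
theorem exists_sub_flip (h : a.IsAtypical p l v) (hp2 : 2 < p) (hl : l ≠ 0)
    (hg : IsGradedRep a.rep gr) {k : ZMod 2} {ψ : sl21 F →ₗ[F] V} (hψ : IsCocycle a.rep ψ)
    (hk : IsHomogMap gr k ψ) : ∃ m ∈ gr k, IsCocycle a.rep (ψ - a.rep.flip m) ∧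
      IsHomogMap gr k (ψ - a.rep.flip m) ∧ (ψ - a.rep.flip m) (evenIncl F (SL21.h1 F)) = 0 ∧
      (ψ - a.rep.flip m) (evenIncl F (SL21.h2 F)) = 0 := by
  obtain ⟨m, hm, h1, h2⟩ := exists_eq_on_torus hp2 hg hψ hk h.h1_pow h.h2_pow
    (h.toSimple.eq_zero_of_invariant hl)
  refine ⟨m, hm, hψ.sub (isCocycle_flip a.isSuperRep_rep m), hk.sub (isHomogMap_flip hg hm), ?_, ?_⟩
  · rw [LinearMap.sub_apply, h1, LinearMap.flip_apply, a.rep_h1, sub_self]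
  · rw [LinearMap.sub_apply, h2, LinearMap.flip_apply, a.rep_h2, sub_self]

omit [Fact p.Prime] [CharP F p] in
theorem eq_cochain_of_torus {ψ : sl21 F →ₗ[F] V} (h1 : ψ (evenIncl F (SL21.h1 F)) = 0)
    (h2 : ψ (evenIncl F (SL21.h2 F)) = 0) :
    ψ = cochain !![0, ψ (evenIncl F (SL21.e12 F)), ψ (SL21.e13 F); ψ (SL21.e21 F), 0,
      ψ (SL21.e23 F); ψ (SL21.e31 F), ψ (SL21.e32 F), 0] := by
  conv_lhs => rw [eq_cochain ψ]
  rw [h1, h2]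

/-- The trivial module has no nonzero cocycles, since `𝔤` is perfect. -/
theorem isCocycle_eq_zero_of_trivial (h : a.IsAtypical p 0 v) {ψ : sl21 F →ₗ[F] V}
    (hψ : IsCocycle a.rep ψ) : ψ = 0 := by
  have hv1 : a.e21 v = 0 := by
    have := h.toSimple.vec_eq_zero h.two (r := 0) (by simp) zero_lt_one
    rwa [← zero_add 1, ← EvenAction.e21_vec, EvenAction.vec_zero] at this
  have e1 : a.e31 v = 0 := h.degOne_ext (h.e31_mem_degOne _) (zero_mem _)
    (by simp [h.h1, h.toMaximal.e13]) (by simp [hv1, h.toMaximal.e23])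
  have e2 : a.e32 v = 0 := h.degOne_ext (h.e32_mem_degOne _) (zero_mem _)
    (by simp [h.e12, h.toMaximal.e13]) (by simp [h.h2, h.toMaximal.e23])
  have hvk : ∀ k, a.vec v k = 0 ∨ a.vec v k = v := fun k => by
    rcases Nat.eq_zero_or_pos k with rfl | hk
    · exact Or.inr EvenAction.vec_zero
    · exact Or.inl (h.toSimple.vec_eq_zero h.two (r := 0) (by simp) hk)
  have hx : ∀ x : V, ∃ c : F, x = c • v := by
    intro x
    have hx : x ∈ Submodule.span F (a.monomials v) :=
      h.toSimple.span_monomials ▸ Submodule.mem_top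
    have hle : Submodule.span F (a.monomials v) ≤ Submodule.span F {v} := by
      rw [Submodule.span_le]
      rintro _ ⟨k, rfl | rfl | rfl | rfl⟩ <;> rcases hvk k with h | h <;> rw [h] <;>
        simp [e1, e2, Submodule.mem_span_singleton_self]
    obtain ⟨c, hc⟩ := Submodule.mem_span_singleton.1 (hle hx)
    exact ⟨c, hc.symm⟩
  have z : ∀ {f : Module.End F V}, f v = 0 → ∀ x, f x = 0 := fun {f} hf x => by
    obtain ⟨c, rfl⟩ := hx x
    rw [map_smul, hf, smul_zero]
  have z1 := z (f := a.h1) (by simp [h.h1])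
  have z2 := z (f := a.h2) (by simp [h.h2])
  have z3 := z (f := a.e12) h.e12
  have z4 := z (f := a.e21) hv1
  have z5 := z (f := a.e13) h.toMaximal.e13
  have z6 := z (f := a.e23) h.toMaximal.e23
  have z7 := z (f := a.e31) e1
  have z8 := z (f := a.e32) e2
  have H1 : ψ (evenIncl F (SL21.h1 F)) = 0 := by
    have := hψ 1 1 (SL21.e13 F) (SL21.e31 F) (evenIncl F (SL21.h1 F)) isHomog_e13 isHomog_e31
      (by simp [superBracket, evenIncl, SL21.h1, SL21.e13, SL21.e31])
    rw [this, a.rep_e13, a.rep_e31, z5, z7, smul_zero, sub_zero]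
  have H2 : ψ (evenIncl F (SL21.h2 F)) = 0 := by
    have := hψ 1 1 (SL21.e23 F) (SL21.e32 F) (evenIncl F (SL21.h2 F)) isHomog_e23 isHomog_e32
      (by simp [superBracket, evenIncl, SL21.h2, SL21.e23, SL21.e32])
    rw [this, a.rep_e23, a.rep_e32, z6, z8, smul_zero, sub_zero]
  have hZ := hψ.isTorusCocycle h.two H1 H2
  rw [eq_cochain_of_torus H1 H2, ← hZ.h1_A, ← hZ.h2_B, ← neg_neg (ψ (SL21.e13 F)), ← hZ.h2_C₁,
    ← neg_neg (ψ (SL21.e23 F)), ← hZ.h1_C₂, ← hZ.h2_D₁, ← hZ.h1_D₂]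
  ext x
  simp [cochain, z1, z2]

/-- Outside the four exceptional weights, all derivations are inner. -/
theorem Der_le_Ider (h : a.IsAtypical p l v) (hp2 : 2 < p) (hg : IsGradedRep a.rep gr)
    (h3 : l ≠ (-1, -1)) (h4 : l ≠ (-1, 0)) (h6 : l ≠ (-1, 1)) (h8 : l ≠ (1, 0)) :
    Der a.rep gr ≤ Ider a.rep gr := by
  refine SL21.Der_le_Ider fun k ψ hψ hk => ?_
  by_cases hl : l = 0
  · subst hl
    exact ⟨0, zero_mem _, by rw [h.isCocycle_eq_zero_of_trivial hψ, map_zero]⟩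
  obtain ⟨m, hm, hc, -, H1, H2⟩ := h.exists_sub_flip hp2 hl hg hψ hk
  refine ⟨m, hm, sub_eq_zero.1 ?_⟩
  have hZ := hc.isTorusCocycle h.two H1 H2
  have hat := h.atypical
  have c0 : l.1 + l.2 ≠ 0 := fun h0 => by
    rcases mul_eq_zero.1 hat with h' | h'
    · exact hl (Prod.ext (by rw [h', add_zero] at h0; exact h0) h')
    · exact h6 (Prod.ext (by linear_combination h') (by linear_combination h0 - h'))
  have c1 : l.1 + l.2 ≠ -1 := fun h0 => by
    rcases mul_eq_zero.1 hat with h' | h'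
    · exact h4 (Prod.ext (by rw [h', add_zero] at h0; exact h0) h')
    · exact h4 (Prod.ext (by linear_combination h') (by linear_combination h0 - h'))
  obtain ⟨hA, hB⟩ := h.torusCocycle_of_ne hZ c0 c1
  obtain ⟨hD1, hD2, -⟩ := h.D_eq_of_ne hZ c0 hA hB
  have hD2' : (ψ - a.rep.flip m) (SL21.e32 F) = 0 := by
    by_contra h'; exact h8 (hD2 h')
  rw [hD2', map_zero, neg_zero] at hD1
  rcases h.C_eq_of_ne hZ c1 hA hB with ⟨hC1, hC2⟩ | ⟨hl', -⟩
  · rw [eq_cochain_of_torus H1 H2, hA, hB, hC1, hC2, hD1, hD2']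
    ext x
    simp [cochain]
  · exact absurd hl' h3

/-- The derivations are the direct sum of the inner derivations and of a space of derivations of
one parity that vanish on the torus, provided this space contains all such derivations. -/
theorem Der_eq_Ider_sup_span (h : a.IsAtypical p l v) (hp2 : 2 < p)
    (hg : IsGradedRep a.rep gr)
    (hd : Disjoint (gr 0) (gr 1)) (h0 : ∀ x, a.h1 x = 0 → a.h2 x = 0 → x = 0) {k : ZMod 2}
    {s : Set (sl21 F →ₗ[F] V)} (hs : ∀ φ ∈ s, IsDerivation a.rep gr k φ ∧
      φ (evenIncl F (SL21.h1 F)) = 0 ∧ φ (evenIncl F (SL21.h2 F)) = 0)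
    (hs' : ∀ A B C₁ C₂ D₁ D₂, IsTorusCocycle a A B C₁ C₂ D₁ D₂ →
      signTwist k (cochain !![0, A, C₁; B, 0, C₂; D₁, D₂, 0]) ∈ Submodule.span F s) :
    Der a.rep gr = Ider a.rep gr ⊔ Submodule.span F s ∧
      Disjoint (Ider a.rep gr) (Submodule.span F s) := by
  have hl : l ≠ 0 := fun hl => h.ne_zero (h0 v (by simp [h.h1, hl]) (by simp [h.h2, hl]))
  have hspan : ∀ φ ∈ Submodule.span F s, IsHomogMap gr k φ ∧
      φ (evenIncl F (SL21.h1 F)) = 0 ∧ φ (evenIncl F (SL21.h2 F)) = 0 := by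
    intro φ hφ
    induction hφ using Submodule.span_induction with
    | zero => exact ⟨fun i x _ => zero_mem _, rfl, rfl⟩
    | add φ ψ _ _ hφ hψ =>
      exact ⟨fun i x hx => add_mem (hφ.1 i x hx) (hψ.1 i x hx),
        by rw [LinearMap.add_apply, hφ.2.1, hψ.2.1, add_zero],
        by rw [LinearMap.add_apply, hφ.2.2, hψ.2.2, add_zero]⟩
    | smul c φ _ hφ =>
      exact ⟨fun i x hx => Submodule.smul_mem _ _ (hφ.1 i x hx),
        by rw [LinearMap.smul_apply, hφ.2.1, smul_zero],
        by rw [LinearMap.smul_apply, hφ.2.2, smul_zero]⟩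
    | mem φ hφ => exact ⟨(hs φ hφ).1.1, (hs φ hφ).2⟩
  refine ⟨le_antisymm ?_ (sup_le (Ider_le_Der a.isSuperRep_rep hg) ?_), ?_⟩
  · refine Submodule.span_le.2 ?_
    rintro φ ⟨j, hφ⟩
    obtain ⟨m, hm, hc, hj, H1, H2⟩ :=
      h.exists_sub_flip hp2 hl hg hφ.isCocycle_signTwist hφ.isHomogMap_signTwist
    have hmem := hs' _ _ _ _ _ _ (hc.isTorusCocycle h.two H1 H2)
    rw [← eq_cochain_of_torus H1 H2] at hmem
    obtain ⟨ψ, hψ⟩ : ∃ ψ, ψ = signTwist j φ - a.rep.flip m := ⟨_, rfl⟩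
    rw [← hψ] at hc hj hmem
    have hφψ : φ = signTwist j (a.rep.flip m) + signTwist j ψ := by
      rw [← signTwist_add, hψ, add_sub_cancel, signTwist_signTwist]
    rw [hφψ]
    refine add_mem (Submodule.mem_sup_left (signTwist_flip_mem_Ider hm))
      (Submodule.mem_sup_right ?_)
    by_cases hjk : j = k
    · rw [hjk]; exact hmem
    -- a cocycle of the wrong parity is homogeneous of both parities
    · have k1 := (hspan _ hmem).1
      have k2 := hj.signTwist k
      have : signTwist k ψ = 0 := by
        rcases parity_cases j with rfl | rfl <;> rcases parity_cases k with rfl | rfl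
        · exact absurd rfl hjk
        · exact eq_zero_of_isHomogMap hd k2 k1
        · exact eq_zero_of_isHomogMap hd k1 k2
        · exact absurd rfl hjk
      have hψ0 : ψ = 0 := by
        rw [← signTwist_signTwist k ψ, this, signTwist_zero]
      rw [hψ0, signTwist_zero]
      exact zero_mem _
  · exact Submodule.span_le.2 fun φ hφ => Submodule.subset_span ⟨k, (hs φ hφ).1⟩
  · rw [Submodule.disjoint_def]
    intro φ h1 h2
    exact eq_zero_of_mem_Ider hd h0 h1 (hspan φ h2).2.1 (hspan φ h2).2.2

end Action.IsAtypical

end Derivations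

/-! ### The exceptional weights -/

section Exceptional

variable {F : Type u} [Field F] {V : Type v} [AddCommGroup V] [Module F V]

theorem isHomogMap_cochain {gr : ZMod 2 → Submodule F V} {k : ZMod 2} {A B C₁ C₂ D₁ D₂ : V}
    (hA : A ∈ gr k) (hB : B ∈ gr k) (hC₁ : C₁ ∈ gr (k + 1)) (hC₂ : C₂ ∈ gr (k + 1))
    (hD₁ : D₁ ∈ gr (k + 1)) (hD₂ : D₂ ∈ gr (k + 1)) :
    IsHomogMap gr k (cochain !![0, A, C₁; B, 0, C₂; D₁, D₂, 0]) := by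
  intro i x hx
  rcases parity_cases i with rfl | rfl
  · obtain ⟨x1, x2, x3, x4⟩ := entries_of_even hx
    rw [add_zero]
    simp only [cochain, LinearMap.coe_mk, AddHom.coe_mk, x1, x2, x3, x4]
    simpa using add_mem (Submodule.smul_mem _ _ hA) (Submodule.smul_mem _ _ hB)
  · obtain ⟨x1, x2, x3, x4, -⟩ := entries_of_odd hx
    simp only [cochain, LinearMap.coe_mk, AddHom.coe_mk, x1, x2, x3, x4]
    simpa using add_mem (add_mem (add_mem (Submodule.smul_mem _ _ hC₁) (Submodule.smul_mem _ _ hC₂))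
      (Submodule.smul_mem _ _ hD₁)) (Submodule.smul_mem _ _ hD₂)

theorem signTwist_zero_cochain (A B C₁ C₂ D₁ D₂ : V) :
    signTwist (0 : ZMod 2) (cochain (F := F) !![0, A, C₁; B, 0, C₂; D₁, D₂, 0])
      = cochain !![0, A, C₁; B, 0, C₂; D₁, D₂, 0] :=
  linearMap_ext_of_homog fun i x hx => by rw [signTwist_apply 0 _ hx, sgn_zero_left, one_smul]

theorem signTwist_one_cochain (A B C₁ C₂ D₁ D₂ : V) :
    signTwist (1 : ZMod 2) (cochain (F := F) !![0, A, C₁; B, 0, C₂; D₁, D₂, 0])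
      = cochain !![0, A, -C₁; B, 0, -C₂; -D₁, -D₂, 0] := by
  refine linearMap_ext_of_homog fun i x hx => ?_
  rw [signTwist_apply 1 _ hx]
  rcases parity_cases i with rfl | rfl
  · obtain ⟨x1, x2, x3, x4⟩ := entries_of_even hx
    simp [cochain, x1, x2, x3, x4]
  · obtain ⟨x1, x2, x3, x4, -⟩ := entries_of_odd hx
    simp [cochain, x2, x3]

theorem cochain_h1 (A B C₁ C₂ D₁ D₂ : V) :
    cochain !![0, A, C₁; B, 0, C₂; D₁, D₂, 0] (evenIncl F (h1 F)) = 0 := by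
  simp [cochain, evenIncl, h1]

theorem cochain_h2 (A B C₁ C₂ D₁ D₂ : V) :
    cochain !![0, A, C₁; B, 0, C₂; D₁, D₂, 0] (evenIncl F (h2 F)) = 0 := by
  simp [cochain, evenIncl, h2]

theorem rank_span_pair {W : Type w} [AddCommGroup W] [Module F W] {x y : W} (hx : x ≠ 0)
    (h : ∀ c : F, c • x ≠ y) : Module.rank F (Submodule.span F {x, y}) = 2 := by
  have hxy : x ≠ y := fun h' => h 1 (by rw [one_smul, h'])
  rw [rank_span_set ((linearIndepOn_pair_iff id hxy hx).2 h),
    Cardinal.mk_insert (by simpa using hxy), Cardinal.mk_singleton, one_add_one_eq_two]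

theorem rank_span_singleton {W : Type w} [AddCommGroup W] [Module F W] {x : W} (hx : x ≠ 0) :
    Module.rank F (Submodule.span F {x}) = 1 := by
  rw [rank_span_set (LinearIndepOn.singleton (v := id) hx), Cardinal.mk_singleton]

theorem rank_H1 {ρ : sl21 F →ₗ[F] Module.End F V} {gr : ZMod 2 → Submodule F V}
    {S : Submodule F (sl21 F →ₗ[F] V)} (h : Der ρ gr = Ider ρ gr ⊔ S)
    (hd : Disjoint (Ider ρ gr) S) : Module.rank F (H1 ρ gr) = Module.rank F S := by
  have e := LinearMap.quotientInfEquivSupQuotient S (Ider ρ gr)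
  have hbot : (S ⊓ Ider ρ gr).submoduleOf S = ⊥ := by
    rw [inf_comm, hd.eq_bot, Submodule.submoduleOf, Submodule.comap_bot, Submodule.ker_subtype]
  unfold H1
  rw [h, sup_comm]
  exact ((Submodule.quotEquivOfEqBot _ hbot).symm.trans e).rank_eq.symm

theorem rank_H1_eq_zero {ρ : sl21 F →ₗ[F] Module.End F V} {gr : ZMod 2 → Submodule F V}
    (h : Der ρ gr ≤ Ider ρ gr) : Module.rank F (H1 ρ gr) = 0 := by
  have : (Ider ρ gr).submoduleOf (Der ρ gr) = ⊤ := Submodule.submoduleOf_eq_top.2 h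
  unfold H1
  rw [this]
  exact rank_subsingleton' F _

variable {p : ℕ} [Fact p.Prime] [CharP F p] {a : Action F V} {l : F × F} {v : V}
  {gr : ZMod 2 → Submodule F V}

theorem vec_mem (hg : IsGradedRep a.rep gr) (hv : v ∈ gr 0) (k : ℕ) : a.vec v k ∈ gr 0 := by
  have := hg.pow_mem isHomog_e21 hv k
  rwa [a.rep_e21] at this

theorem e31_mem (hg : IsGradedRep a.rep gr) {x : V} (hx : x ∈ gr 0) : a.e31 x ∈ gr 1 := by
  have := hg 1 0 _ isHomog_e31 x hx
  rwa [a.rep_e31, add_zero] at this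

theorem e32_mem (hg : IsGradedRep a.rep gr) {x : V} (hx : x ∈ gr 0) : a.e32 x ∈ gr 1 := by
  have := hg 1 0 _ isHomog_e32 x hx
  rwa [a.rep_e32, add_zero] at this

theorem IsTorusCocycle.isDerivation_zero {A B C₁ C₂ D₁ D₂ : V}
    (hZ : IsTorusCocycle a A B C₁ C₂ D₁ D₂) (hA : A ∈ gr 0) (hB : B ∈ gr 0) (hC₁ : C₁ ∈ gr 1)
    (hC₂ : C₂ ∈ gr 1) (hD₁ : D₁ ∈ gr 1) (hD₂ : D₂ ∈ gr 1) :
    IsDerivation a.rep gr 0 (cochain !![0, A, C₁; B, 0, C₂; D₁, D₂, 0]) := by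
  rw [← signTwist_zero_cochain]
  exact hZ.isCocycle.isDerivation_signTwist (isHomogMap_cochain hA hB hC₁ hC₂ hD₁ hD₂)

theorem IsTorusCocycle.isDerivation_one {A B C₁ C₂ D₁ D₂ : V}
    (hZ : IsTorusCocycle a A B C₁ C₂ D₁ D₂) (hA : A ∈ gr 1) (hB : B ∈ gr 1) (hC₁ : C₁ ∈ gr 0)
    (hC₂ : C₂ ∈ gr 0) (hD₁ : D₁ ∈ gr 0) (hD₂ : D₂ ∈ gr 0) :
    IsDerivation a.rep gr 1 (cochain !![0, -A, C₁; -B, 0, C₂; D₁, D₂, 0]) := by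
  have h11 : (1 : ZMod 2) + 1 = 0 := by decide
  have hneg : IsTorusCocycle a (-A) (-B) (-C₁) (-C₂) (-D₁) (-D₂) := by
    constructor <;> simp only [map_neg, neg_neg, neg_zero, hZ.h1_A, hZ.h2_A, hZ.h1_B,
      hZ.h2_B, hZ.h1_C₁, hZ.h2_C₁, hZ.h1_C₂, hZ.h2_C₂, hZ.h1_D₁, hZ.h2_D₁, hZ.h1_D₂, hZ.h2_D₂,
      hZ.e12_B, hZ.e12_D₁, hZ.e12_D₂, hZ.e21_D₁, hZ.e21_D₂, hZ.e13_A, hZ.e13_B, hZ.e23_A,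
      hZ.e23_B, hZ.e13_D₁, hZ.e13_D₂, hZ.e23_D₁, hZ.e23_D₂, hZ.e32_D₁, hZ.e31_D₁, hZ.e32_D₂,
      hZ.e23_C₁, hZ.e13_C₁, hZ.e23_C₂] <;> abel
  have := hneg.isCocycle.isDerivation_signTwist (gr := gr) (k := 1)
    (isHomogMap_cochain (neg_mem hA) (neg_mem hB) (by rw [h11]; exact neg_mem hC₁)
      (by rw [h11]; exact neg_mem hC₂) (by rw [h11]; exact neg_mem hD₁)
      (by rw [h11]; exact neg_mem hD₂))
  rwa [signTwist_one_cochain, neg_neg, neg_neg, neg_neg, neg_neg] at this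

namespace Action.IsAtypical

section ZeroWeight

theorem sum_h_eq_zero {x : V} (h1 : a.h1 x = 0) (h2 : a.h2 x = 0) :
    (a.h1 + a.h2) x = (0 : F) • x := by
  rw [LinearMap.add_apply, h1, h2, add_zero, zero_smul]

theorem zeroWeight_neg_one_neg_one (h : a.IsAtypical p (-1, -1) v) {x : V} (h1 : a.h1 x = 0)
    (h2 : a.h2 x = 0) : x = 0 :=
  h.eq_zero_of_sum_h (sum_h_eq_zero h1 h2)
    (fun h' => h.two (by simp only at h'; linear_combination h'))
    (fun h' => one_ne_zero (α := F) (by simp only at h'; linear_combination h'))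

theorem zeroWeight_one_zero (h : a.IsAtypical p (1, 0) v) {x : V} (h1 : a.h1 x = 0)
    (h2 : a.h2 x = 0) : x = 0 :=
  h.eq_zero_of_sum_h (sum_h_eq_zero h1 h2)
    (fun h' => one_ne_zero (α := F) (by simp only at h'; linear_combination -h'))
    (fun h' => h.two (by simp only at h'; linear_combination -h'))

theorem zeroWeight_neg_one_one (h : a.IsAtypical p (-1, 1) v) (hp2 : 2 < p) {x : V}
    (h1 : a.h1 x = 0) (h2 : a.h2 x = 0) : x = 0 := by
  by_contra h0
  have hm := h.mem_degZero (sum_h_eq_zero h1 h2) (by simp)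
  obtain ⟨k, hk, hkt, c, hc⟩ := h.exists_smul_vec hm (t := 0) (by rw [h1, zero_smul]) h0
  have : k = p - 1 := eq_of_natCast_eq (F := F) hk (by omega)
    (by rw [natCast_pred]; simp only at hkt; linear_combination -hkt)
  rw [this, h.toSimple.vec_eq_zero h.two (r := p - 2)
    (by rw [natCast_sub_two hp2]; norm_num) (by omega), smul_zero] at hc
  exact h0 hc

theorem zeroWeight_neg_one_zero (h : a.IsAtypical p (-1, 0) v) {x : V}
    (h1 : a.h1 x = 0) (h2 : a.h2 x = 0) : x = 0 := by
  have hm := h.mem_degOne (sum_h_eq_zero h1 h2) (by simp)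
  have hp1 := (Fact.out : p.Prime).one_lt
  obtain ⟨b, hb⟩ : ∃ b : Fin p ⊕ Fin p → V,
      b = Sum.elim (fun k : Fin p => a.e31 (a.vec v k)) (fun k : Fin p => a.e32 (a.vec v k)) := ⟨_, rfl⟩
  obtain ⟨μ, hμ⟩ : ∃ μ : Fin p ⊕ Fin p → F,
      μ = Sum.elim (fun k : Fin p => -1 - ((k : ℕ) : F)) (fun k : Fin p => -((k : ℕ) : F)) := ⟨_, rfl⟩
  have heig : ∀ i, a.h1 (b i) = μ i • b i := by
    rintro (k | k)
    · simp [hb, hμ, h.h1_vec]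
    · simp [hb, hμ, h.h1_vec]; module
  have hspan : x ∈ Submodule.span F (Set.range b) := by
    have : a.degOne v ≤ Submodule.span F (Set.range b) := by
      rw [degOne, Submodule.span_le]
      rintro _ ⟨k, rfl | rfl⟩ <;> by_cases hk : k < p
      · exact Submodule.subset_span ⟨Sum.inl ⟨k, hk⟩, by simp [hb]⟩
      · rw [h.toSimple.vec_eq_zero_of_le (not_lt.1 hk), map_zero]; exact zero_mem _
      · exact Submodule.subset_span ⟨Sum.inr ⟨k, hk⟩, by simp [hb]⟩
      · rw [h.toSimple.vec_eq_zero_of_le (not_lt.1 hk), map_zero]; exact zero_mem _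
    exact this hm
  have hmem := mem_span_of_eigen heig hspan (ν := 0) (by rw [h1, zero_smul])
  -- the only vectors of weight `0` among the `b i` are `e₃₁ e₂₁ᵖ⁻¹ v = 0` and `e₃₂ v = 0`
  have hle : Submodule.span F (b '' {i | μ i = 0}) ≤ ⊥ := by
    rw [Submodule.span_le]
    rintro _ ⟨k | k, hk, rfl⟩ <;> simp only [Set.mem_ofPred_eq, hμ, Sum.elim_inl, Sum.elim_inr] at hk
    · have : (k : ℕ) = p - 1 := eq_of_natCast_eq (F := F) k.2 (by omega)
        (by rw [natCast_pred]; linear_combination -hk)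
      simp [hb, this, h.e31_vec_pred]
    · have : (k : ℕ) = 0 := eq_of_natCast_eq (F := F) k.2 (by omega)
        (by rw [Nat.cast_zero]; linear_combination -hk)
      simp [hb, this, h.e32_eq_zero]
  exact (Submodule.mem_bot F).1 (hle hmem)

end ZeroWeight

variable (hp2 : 2 < p) (hg : IsGradedRep a.rep gr) (hd : Disjoint (gr 0) (gr 1)) (hv : v ∈ gr 0)

include hp2 hg hd hv

/-- The weight of `ψ₃`. -/
theorem Der_neg_one_neg_one (h : a.IsAtypical p (-1, -1) v) :
    Der a.rep gr = Ider a.rep gr ⊔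
        Submodule.span F {cochain !![0, 0, -a.e32 v; 0, 0, a.e31 v; 0, 0, 0]} ∧
      Module.rank F (H1 a.rep gr) = 1 := by
  have key := h.Der_eq_Ider_sup_span hp2 hg hd
    (fun x h1 h2 => h.zeroWeight_neg_one_neg_one h1 h2)
    (s := {cochain !![0, 0, -a.e32 v; 0, 0, a.e31 v; 0, 0, 0]}) (k := 0)
    (by
      rintro _ rfl
      exact ⟨h.isTorusCocycle_neg_one_neg_one.isDerivation_zero (zero_mem _) (zero_mem _)
        (neg_mem (e32_mem hg hv)) (e31_mem hg hv) (zero_mem _) (zero_mem _), cochain_h1 ..,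
        cochain_h2 ..⟩)
    (by
      intro A B C₁ C₂ D₁ D₂ hZ
      have c0 : (-1 : F) + -1 ≠ 0 := fun h' => h.two (by linear_combination -h')
      have c1 : (-1 : F) + -1 ≠ -1 := by simp
      obtain ⟨rfl, rfl⟩ := h.torusCocycle_of_ne hZ c0 c1
      obtain ⟨rfl, hD2, -⟩ := h.D_eq_of_ne hZ c0 rfl rfl
      have : D₂ = 0 := by
        by_contra h'
        have := congrArg Prod.snd (hD2 h')
        simp at this
      subst this
      rw [signTwist_zero_cochain, Submodule.mem_span_singleton]
      rcases h.C_eq_of_ne hZ c1 rfl rfl with ⟨rfl, rfl⟩ | ⟨-, c, rfl, rfl⟩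
      · exact ⟨0, by ext x; simp [cochain]⟩
      · exact ⟨-c, by ext x; simp [cochain]; module⟩)
  refine ⟨key.1, ?_⟩
  rw [rank_H1 key.1 key.2]
  refine rank_span_singleton fun h0 => h.ne_zero ?_
  have := LinearMap.congr_fun h0 (SL21.e13 F)
  have h32 : a.e32 v = 0 := by simpa [cochain, SL21.e13] using this
  have := a.e23_e32 v
  rw [h32, map_zero, h.h2, h.toMaximal.e23, map_zero] at this
  simpa using this.symm

/-- The weight of `ψ₈`. -/
theorem Der_one_zero (h : a.IsAtypical p (1, 0) v) :
    Der a.rep gr = Ider a.rep gr ⊔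
        Submodule.span F {cochain !![0, 0, 0; 0, 0, 0; -a.e21 v, v, 0]} ∧
      Module.rank F (H1 a.rep gr) = 1 := by
  have hv1 : a.e21 v ∈ gr 0 := by
    have := vec_mem hg hv 1
    rwa [← zero_add 1, ← EvenAction.e21_vec, EvenAction.vec_zero] at this
  have key := h.Der_eq_Ider_sup_span hp2 hg hd
    (fun x h1 h2 => h.zeroWeight_one_zero h1 h2)
    (s := {cochain !![0, 0, 0; 0, 0, 0; -a.e21 v, v, 0]}) (k := 1)
    (by
      rintro _ rfl
      have := h.isTorusCocycle_one_zero.isDerivation_one (gr := gr) (zero_mem _) (zero_mem _)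
        (zero_mem _) (zero_mem _) (neg_mem hv1) hv
      rw [neg_zero] at this
      exact ⟨this, cochain_h1 .., cochain_h2 ..⟩)
    (by
      intro A B C₁ C₂ D₁ D₂ hZ
      have c0 : (1 : F) + 0 ≠ 0 := by simp
      have c1 : (1 : F) + 0 ≠ -1 := by simpa using one_ne_neg_one h.two
      obtain ⟨rfl, rfl⟩ := h.torusCocycle_of_ne hZ c0 c1
      obtain ⟨rfl, -, c, rfl⟩ := h.D_eq_of_ne hZ c0 rfl rfl
      rw [signTwist_one_cochain, Submodule.mem_span_singleton]
      rcases h.C_eq_of_ne hZ c1 rfl rfl with ⟨rfl, rfl⟩ | ⟨h', -⟩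
      · exact ⟨-c, by ext x; simp [cochain]; module⟩
      · have := congrArg Prod.snd h'
        simp at this)
  refine ⟨key.1, ?_⟩
  rw [rank_H1 key.1 key.2]
  refine rank_span_singleton fun h0 => h.ne_zero ?_
  have := LinearMap.congr_fun h0 (SL21.e32 F)
  simpa [cochain, SL21.e32] using this

/-- The weight of `ψ₄` and `ψ₅`. -/
theorem Der_neg_one_zero (h : a.IsAtypical p (-1, 0) v) :
    Der a.rep gr = Ider a.rep gr ⊔
        Submodule.span F {cochain !![0, a.e31 (a.vec v (p - 2)), a.vec v (p - 1); 0, 0, 0; 0, 0, 0],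
          cochain !![0, 0, 0; -a.e31 v, 0, v; 0, 0, 0]} ∧
      Module.rank F (H1 a.rep gr) = 2 := by
  have hp1 := (Fact.out : p.Prime).one_lt
  have key := h.Der_eq_Ider_sup_span hp2 hg hd
    (fun x h1 h2 => h.zeroWeight_neg_one_zero h1 h2)
    (s := {cochain !![0, a.e31 (a.vec v (p - 2)), a.vec v (p - 1); 0, 0, 0; 0, 0, 0],
          cochain !![0, 0, 0; -a.e31 v, 0, v; 0, 0, 0]}) (k := 1)
    (by
      rintro _ (rfl | rfl)
      · have := h.isTorusCocycle_neg_one_zero_left.isDerivation_one (gr := gr)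
          (e32_mem hg (vec_mem hg hv _)) (zero_mem _) (vec_mem hg hv _) (zero_mem _) (zero_mem _)
          (zero_mem _)
        rw [neg_zero, h.e32_vec_pred hp2, neg_neg] at this
        exact ⟨this, cochain_h1 .., cochain_h2 ..⟩
      · have := h.isTorusCocycle_neg_one_zero_right.isDerivation_one (gr := gr)
          (zero_mem _) (e31_mem hg hv) (zero_mem _) hv (zero_mem _) (zero_mem _)
        rw [neg_zero] at this
        exact ⟨this, cochain_h1 .., cochain_h2 ..⟩)
    (by
      intro A B C₁ C₂ D₁ D₂ hZ
      obtain ⟨c, d, rfl, rfl, rfl, rfl, rfl, rfl⟩ := h.torusCocycle_neg_one_zero hZ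
      rw [signTwist_one_cochain, Submodule.mem_span_pair, h.e32_vec_pred hp2]
      exact ⟨-c, -d, by ext x; simp [cochain]; module⟩)
  refine ⟨key.1, ?_⟩
  rw [rank_H1 key.1 key.2]
  refine rank_span_pair (fun h0 => ?_) fun c h0 => h.ne_zero ?_
  · have := LinearMap.congr_fun h0 (SL21.e13 F)
    exact h.vec_ne_zero (r := p - 1) (by omega) (by rw [natCast_pred]; simp) le_rfl
      (by simpa [cochain, SL21.e13] using this)
  · have := LinearMap.congr_fun h0 (SL21.e23 F)
    simpa [cochain, SL21.e23] using this.symm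

/-- The weight of `ψ₆` and `ψ₇`. -/
theorem Der_neg_one_one (h : a.IsAtypical p (-1, 1) v) :
    Der a.rep gr = Ider a.rep gr ⊔
        Submodule.span F {cochain !![0, a.vec v (p - 2), 0; 0, 0, 0;
            0, a.e31 (a.vec v (p - 2)), 0],
          cochain !![0, 0, 0; v, 0, 0; a.e32 v, 0, 0]} ∧
      Module.rank F (H1 a.rep gr) = 2 := by
  have key := h.Der_eq_Ider_sup_span hp2 hg hd
    (fun x h1 h2 => h.zeroWeight_neg_one_one hp2 h1 h2)
    (s := {cochain !![0, a.vec v (p - 2), 0; 0, 0, 0; 0, a.e31 (a.vec v (p - 2)), 0],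
          cochain !![0, 0, 0; v, 0, 0; a.e32 v, 0, 0]}) (k := 0)
    (by
      rintro _ (rfl | rfl)
      · exact ⟨(h.isTorusCocycle_neg_one_one_left hp2).isDerivation_zero (vec_mem hg hv _)
          (zero_mem _) (zero_mem _) (zero_mem _) (zero_mem _) (e31_mem hg (vec_mem hg hv _)),
          cochain_h1 .., cochain_h2 ..⟩
      · exact ⟨h.isTorusCocycle_neg_one_one_right.isDerivation_zero (zero_mem _) hv
          (zero_mem _) (zero_mem _) (e32_mem hg hv) (zero_mem _), cochain_h1 .., cochain_h2 ..⟩)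
    (by
      intro A B C₁ C₂ D₁ D₂ hZ
      obtain ⟨c, d, rfl, rfl, rfl, rfl, rfl, rfl⟩ := h.torusCocycle_neg_one_one hp2 hZ
      rw [signTwist_zero_cochain, Submodule.mem_span_pair]
      exact ⟨c, d, by ext x; simp [cochain]; module⟩)
  refine ⟨key.1, ?_⟩
  rw [rank_H1 key.1 key.2]
  refine rank_span_pair (fun h0 => ?_) fun c h0 => h.ne_zero ?_
  · have := LinearMap.congr_fun h0 (evenIncl F (SL21.e12 F))
    exact h.vec_ne_zero (r := p - 2) (by omega) (by rw [natCast_sub_two hp2]; norm_num) le_rfl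
      (by simpa [cochain, SL21.e12, evenIncl] using this)
  · have := LinearMap.congr_fun h0 (SL21.e21 F)
    simpa [cochain, SL21.e21] using this.symm

end Action.IsAtypical

end Exceptional

/-! ### Cohomology of modules over the enveloping algebra -/

section Final

variable {p : ℕ} {F : Type u} [Field F] {χ : Module.Dual F (evenPart F)}

/-- The vector `e₃₁ⁱ e₃₂ʲ e₂₁ᵏ x`. -/
def monomialVec {X : Type v} [AddCommGroup X] [Module (Env p (sl21 F) χ) X] (x : X) (i j k : ℕ) :
    X :=
  (ι p (sl21 F) χ (e31 F) ^ i * ι p (sl21 F) χ (e32 F) ^ j * ι p (sl21 F) χ (e21 F) ^ k) • x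

section Module

variable {X : Type v} [AddCommGroup X] [Module F X] [Module (Env p (sl21 F) χ) X]
  [IsScalarTower F (Env p (sl21 F) χ) X] {two : (2 : F) ≠ 0} {x : X}

theorem pow_smul_eq (y : sl21 F) (n : ℕ) (x : X) :
    ι p (sl21 F) χ y ^ n • x = (((act p χ two X).rep y) ^ n) x := by
  induction n with
  | zero => simp
  | succ n ih => rw [pow_succ', pow_succ', mul_smul, ih, Module.End.mul_apply, rep_act,
      Env.toRep_apply]

theorem monomialVec_eq (i j k : ℕ) : monomialVec (p := p) (χ := χ) x i j k =
    ((act p χ two X).e31 ^ i) (((act p χ two X).e32 ^ j) ((act p χ two X).vec x k)) := by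
  rw [monomialVec, mul_smul, mul_smul, pow_smul_eq (two := two), pow_smul_eq (two := two),
    pow_smul_eq (two := two), Action.rep_e31, Action.rep_e32, Action.rep_e21, EvenAction.vec]

variable [Fact p.Prime] [CharP F p]

omit [CharP F p] in
/-- A simple module for `χ = 0` with a maximal vector is restricted. -/
theorem isSimpleHighestWeight_of_simple {l : F × F} (hχ : χ = 0) (hv : x ≠ 0)
    (hm : (act p χ two X).IsMaximal l x)
    (hs : ∀ W : Submodule (Env p (sl21 F) χ) X, W = ⊥ ∨ W = ⊤) :
    (act p χ two X).IsSimpleHighestWeight p l x := by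
  have hp : p ≠ 0 := (Fact.out : p.Prime).ne_zero
  have hz : ∀ w, χ w ^ p = 0 := fun w => by rw [hχ, LinearMap.zero_apply, zero_pow hp]
  refine ⟨hm, hv, fun W hW => ?_, ?_, ?_, ?_⟩
  · rcases hs (Env.submoduleOf W hW.ι_smul_mem) with h | h
    · left
      rw [eq_bot_iff]
      intro y hy
      have : y ∈ Env.submoduleOf W hW.ι_smul_mem := hy
      rw [h] at this
      exact this
    · right
      rw [eq_top_iff]
      intro y _
      have : y ∈ Env.submoduleOf W hW.ι_smul_mem := h ▸ Submodule.mem_top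
      exact this
  · rw [act_e21_pow, hz, map_zero]
  · rw [act_h1_pow, hz, map_zero, add_zero]
  · rw [act_h2_pow, hz, map_zero, add_zero]

theorem Der_eq_psi3 {l : F × F} (hl : l = (-1, -1)) (h : (act p χ two X).IsAtypical p l x)
    (hp2 : 2 < p) :
    Der (Env.toRep p (sl21 F) χ X) (generatedGrading (χ := χ) (p := p) x) =
      Ider (Env.toRep p (sl21 F) χ X) (generatedGrading (χ := χ) (p := p) x) ⊔
        Submodule.span F {cochain !![0, 0, -monomialVec (p := p) (χ := χ) x 0 1 0; 0, 0,
          monomialVec (p := p) (χ := χ) x 1 0 0; 0, 0, 0]} ∧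
      Module.rank F (H1 (Env.toRep p (sl21 F) χ X) (generatedGrading (χ := χ) (p := p) x)) = 1 := by
  subst hl
  simp only [monomialVec_eq (two := two), pow_zero, pow_one, Module.End.one_apply,
    EvenAction.vec_zero]
  have := h.Der_neg_one_neg_one hp2 isGradedRep_generatedGrading (disjoint_generatedGrading h)
    mem_generatedGrading
  rwa [rep_act] at this

theorem Der_eq_psi45 {l : F × F} (hl : l = (-1, 0)) (h : (act p χ two X).IsAtypical p l x)
    (hp2 : 2 < p) :
    Der (Env.toRep p (sl21 F) χ X) (generatedGrading (χ := χ) (p := p) x) =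
      Ider (Env.toRep p (sl21 F) χ X) (generatedGrading (χ := χ) (p := p) x) ⊔
        Submodule.span F {cochain !![-monomialVec (p := p) (χ := χ) x 1 0 (p - 1),
            monomialVec (p := p) (χ := χ) x 1 0 (p - 2),
            monomialVec (p := p) (χ := χ) x 0 0 (p - 1); 0, 0, 0; 0, 0, 0],
          cochain !![0, 0, 0; -monomialVec (p := p) (χ := χ) x 1 0 0, 0,
            monomialVec (p := p) (χ := χ) x 0 0 0; 0, 0, 0]} ∧
      Module.rank F (H1 (Env.toRep p (sl21 F) χ X) (generatedGrading (χ := χ) (p := p) x)) = 2 := by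
  subst hl
  simp only [monomialVec_eq (two := two), pow_zero, pow_one, Module.End.one_apply,
    EvenAction.vec_zero, h.e31_vec_pred, neg_zero]
  have := h.Der_neg_one_zero hp2 isGradedRep_generatedGrading (disjoint_generatedGrading h)
    mem_generatedGrading
  rwa [rep_act] at this

theorem Der_eq_psi67 {l : F × F} (hl : l = (-1, 1)) (h : (act p χ two X).IsAtypical p l x)
    (hp2 : 2 < p) :
    Der (Env.toRep p (sl21 F) χ X) (generatedGrading (χ := χ) (p := p) x) =
      Ider (Env.toRep p (sl21 F) χ X) (generatedGrading (χ := χ) (p := p) x) ⊔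
        Submodule.span F {cochain !![0, monomialVec (p := p) (χ := χ) x 0 0 (p - 2), 0; 0, 0, 0;
            0, monomialVec (p := p) (χ := χ) x 1 0 (p - 2), 0],
          cochain !![0, 0, 0; monomialVec (p := p) (χ := χ) x 0 0 0, 0, 0;
            monomialVec (p := p) (χ := χ) x 0 1 0, 0, 0]} ∧
      Module.rank F (H1 (Env.toRep p (sl21 F) χ X) (generatedGrading (χ := χ) (p := p) x)) = 2 := by
  subst hl
  simp only [monomialVec_eq (two := two), pow_zero, pow_one, Module.End.one_apply,
    EvenAction.vec_zero]
  have := h.Der_neg_one_one hp2 isGradedRep_generatedGrading (disjoint_generatedGrading h)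
    mem_generatedGrading
  rwa [rep_act] at this

theorem Der_eq_psi8 {l : F × F} (hl : l = (1, 0)) (h : (act p χ two X).IsAtypical p l x)
    (hp2 : 2 < p) :
    Der (Env.toRep p (sl21 F) χ X) (generatedGrading (χ := χ) (p := p) x) =
      Ider (Env.toRep p (sl21 F) χ X) (generatedGrading (χ := χ) (p := p) x) ⊔
        Submodule.span F {cochain !![0, 0, 0; 0, 0, 0; -monomialVec (p := p) (χ := χ) x 0 0 1,
          monomialVec (p := p) (χ := χ) x 0 0 0, 0]} ∧
      Module.rank F (H1 (Env.toRep p (sl21 F) χ X) (generatedGrading (χ := χ) (p := p) x)) = 1 := by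
  subst hl
  have := h.Der_one_zero hp2 isGradedRep_generatedGrading (disjoint_generatedGrading h)
    mem_generatedGrading
  rw [rep_act] at this
  simpa only [monomialVec_eq (two := two), pow_zero, pow_one, Module.End.one_apply,
    EvenAction.vec_zero, EvenAction.vec] using this

theorem Der_le_Ider_of_atypical {l : F × F} (h : (act p χ two X).IsAtypical p l x) (hp2 : 2 < p)
    (h3 : l ≠ (-1, -1)) (h4 : l ≠ (-1, 0)) (h6 : l ≠ (-1, 1)) (h8 : l ≠ (1, 0)) :
    Der (Env.toRep p (sl21 F) χ X) (generatedGrading (χ := χ) (p := p) x) ≤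
      Ider (Env.toRep p (sl21 F) χ X) (generatedGrading (χ := χ) (p := p) x) := by
  have := h.Der_le_Ider hp2 isGradedRep_generatedGrading h3 h4 h6 h8
    (gr := generatedGrading (χ := χ) (p := p) x)
  rwa [rep_act] at this

end Module

variable [Fact p.Prime] [CharP F p] {l : F × F}

theorem simpleVec_ne_zero (two : (2 : F) ≠ 0) (hχ : χ = 0) (h1 : l.1 ^ p = l.1)
    (h2 : l.2 ^ p = l.2) : simpleVec p χ l ≠ 0 := by
  subst hχ
  exact fun h => notMem_sumProper_of_isMaximal (kacVec_ne_zero (evenVec_ne_zero h1 h2)) span_kacVec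
    (isMaximal_kacVec two) ((Submodule.Quotient.mk_eq_zero _).1 h)

theorem isAtypical_simpleVec (two : (2 : F) ≠ 0) (hχ : χ = 0) (h1 : l.1 ^ p = l.1)
    (h2 : l.2 ^ p = l.2) (h : l.2 * (l.1 + 1) = 0) :
    (act p χ two (Simple p χ l)).IsAtypical p l (simpleVec p χ l) :=
  ⟨isSimpleHighestWeight_of_simple hχ (simpleVec_ne_zero two hχ h1 h2) (isMaximal_simpleVec two)
    eq_bot_or_top_of_quotient_sumProper, two, h⟩

omit [CharP F p] in
theorem neg_one_pow_char (hp2 : 2 < p) : (-1 : F) ^ p = -1 :=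
  ((Fact.out : p.Prime).odd_of_ne_two hp2.ne').neg_one_pow

section

variable (hp2 : 2 < p) (hχ : χ = 0)

include hp2 hχ

theorem simpleDer_eq_psi3 (hl : l = (-1, -1)) : (simpleDer p χ l =
      simpleIder p χ l ⊔ Submodule.span F {psi3 p χ l}) ∧
    Module.rank F (simpleH1 p χ l) = 1 :=
  Der_eq_psi3 hl (isAtypical_simpleVec (two_ne_zero_of_lt hp2) hχ
    (by rw [hl, neg_one_pow_char hp2]) (by rw [hl, neg_one_pow_char hp2]) (by simp [hl])) hp2

theorem simpleDer_eq_psi45 (hl : l = (-1, 0)) : (simpleDer p χ l =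
      simpleIder p χ l ⊔ Submodule.span F {psi4 p χ l, psi5 p χ l}) ∧
    Module.rank F (simpleH1 p χ l) = 2 :=
  Der_eq_psi45 hl (isAtypical_simpleVec (two_ne_zero_of_lt hp2) hχ
    (by rw [hl, neg_one_pow_char hp2]) (by rw [hl, zero_pow (Fact.out : p.Prime).ne_zero])
    (by simp [hl])) hp2

theorem simpleDer_eq_psi67 (hl : l = (-1, 1)) : (simpleDer p χ l =
      simpleIder p χ l ⊔ Submodule.span F {psi6 p χ l, psi7 p χ l}) ∧
    Module.rank F (simpleH1 p χ l) = 2 :=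
  Der_eq_psi67 hl (isAtypical_simpleVec (two_ne_zero_of_lt hp2) hχ
    (by rw [hl, neg_one_pow_char hp2]) (by rw [hl, one_pow]) (by simp [hl])) hp2

theorem simpleDer_eq_psi8 (hl : l = (1, 0)) : (simpleDer p χ l =
      simpleIder p χ l ⊔ Submodule.span F {psi8 p χ l}) ∧
    Module.rank F (simpleH1 p χ l) = 1 :=
  Der_eq_psi8 hl (isAtypical_simpleVec (two_ne_zero_of_lt hp2) hχ
    (by rw [hl, one_pow]) (by rw [hl, zero_pow (Fact.out : p.Prime).ne_zero]) (by simp [hl])) hp2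

theorem simpleDer_le_simpleIder_of_atypical (h1 : l.1 ^ p = l.1)
    (h2 : l.2 ^ p = l.2) (h : l.2 * (l.1 + 1) = 0) (h3 : l ≠ (-1, -1)) (h4 : l ≠ (-1, 0))
    (h6 : l ≠ (-1, 1)) (h8 : l ≠ (1, 0)) : simpleDer p χ l ≤ simpleIder p χ l :=
  Der_le_Ider_of_atypical (isAtypical_simpleVec (two_ne_zero_of_lt hp2) hχ h1 h2 h) hp2
    h3 h4 h6 h8

end

omit [Fact p.Prime] [CharP F p] in
theorem rank_simpleH1_eq_zero (h : simpleDer p χ l ≤ simpleIder p χ l) :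
    Module.rank F (simpleH1 p χ l) = 0 := rank_H1_eq_zero h

end Final

end SL21

theorem theorem1p2 (p : ℕ) [Fact p.Prime] (hp : 2 < p)
    (F : Type*) [Field F] [IsAlgClosed F] [CharP F p] :
    -- the dimension of `H¹`, for all `χ` and all `λ` that are highest weights for `χ`
    (∀ (χ : Module.Dual F (SL21.evenPart F)) (l : F × F),
      χ (SL21.e12 F) = 0 →
      l.1 ^ p - l.1 = χ (SL21.h1 F) ^ p →
      l.2 ^ p - l.2 = χ (SL21.h2 F) ^ p →
      (χ = 0 ∧ (l = ((p : F) - 1, (p : F) - 1) ∨ l = (1, 0)) →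
        Module.rank F (SL21.simpleH1 p χ l) = 1) ∧
      (χ = 0 ∧ (l = ((p : F) - 1, 0) ∨ l = ((p : F) - 1, 1)) →
        Module.rank F (SL21.simpleH1 p χ l) = 2) ∧
      (¬ (χ = 0 ∧ (l = ((p : F) - 1, (p : F) - 1) ∨ l = (1, 0) ∨
          l = ((p : F) - 1, 0) ∨ l = ((p : F) - 1, 1))) →
        Module.rank F (SL21.simpleH1 p χ l) = 0)) ∧
    -- the explicit spanning cocycles
    (∀ (χ : Module.Dual F (SL21.evenPart F)) (l : F × F), χ = 0 →
      (l = ((p : F) - 1, (p : F) - 1) →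
        SL21.simpleDer p χ l =
          SL21.simpleIder p χ l ⊔ Submodule.span F {SL21.psi3 p χ l}) ∧
      (l = ((p : F) - 1, 0) →
        SL21.simpleDer p χ l =
          SL21.simpleIder p χ l ⊔ Submodule.span F {SL21.psi4 p χ l, SL21.psi5 p χ l}) ∧
      (l = ((p : F) - 1, 1) →
        SL21.simpleDer p χ l =
          SL21.simpleIder p χ l ⊔ Submodule.span F {SL21.psi6 p χ l, SL21.psi7 p χ l}) ∧
      (l = (1, 0) →
        SL21.simpleDer p χ l =
          SL21.simpleIder p χ l ⊔ Submodule.span F {SL21.psi8 p χ l})) := by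
  have hp1 : (p : F) - 1 = -1 := by rw [CharP.cast_eq_zero, zero_sub]
  have key : ∀ (l : F × F) (t : F), l = ((p : F) - 1, t) ↔ l = (-1, t) := fun l t => by rw [hp1]
  have key' : ∀ l : F × F, l = ((p : F) - 1, (p : F) - 1) ↔ l = (-1, -1) := fun l => by rw [hp1]
  refine ⟨fun χ l h12 hl1 hl2 => ⟨?_, ?_, fun h => ?_⟩, fun χ l hχ => ⟨?_, ?_, ?_, ?_⟩⟩
  · rintro ⟨hχ, hl | hl⟩
    · exact (SL21.simpleDer_eq_psi3 hp hχ ((key' l).1 hl)).2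
    · exact (SL21.simpleDer_eq_psi8 hp hχ hl).2
  · rintro ⟨hχ, hl | hl⟩
    · exact (SL21.simpleDer_eq_psi45 hp hχ ((key l 0).1 hl)).2
    · exact (SL21.simpleDer_eq_psi67 hp hχ ((key l 1).1 hl)).2
  · refine SL21.rank_simpleH1_eq_zero ?_
    by_cases hχ : χ = 0
    · by_cases hat : l.2 * (l.1 + 1) = 0
      · have hp0 : p ≠ 0 := by omega
        rw [hχ, LinearMap.zero_apply, zero_pow hp0, sub_eq_zero] at hl1 hl2
        exact SL21.simpleDer_le_simpleIder_of_atypical hp hχ hl1 hl2 hat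
          (fun h' => h ⟨hχ, Or.inl ((key' l).2 h')⟩)
          (fun h' => h ⟨hχ, Or.inr (Or.inr (Or.inl ((key l 0).2 h')))⟩)
          (fun h' => h ⟨hχ, Or.inr (Or.inr (Or.inr ((key l 1).2 h')))⟩)
          (fun h' => h ⟨hχ, Or.inr (Or.inl h')⟩)
      · exact SL21.simpleDer_le_simpleIder hp h12 (Or.inr hat)
    · exact SL21.simpleDer_le_simpleIder hp h12 (Or.inl hχ)
  · exact fun hl => (SL21.simpleDer_eq_psi3 hp hχ ((key' l).1 hl)).1
  · exact fun hl => (SL21.simpleDer_eq_psi45 hp hχ ((key l 0).1 hl)).1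
  · exact fun hl => (SL21.simpleDer_eq_psi67 hp hχ ((key l 1).1 hl)).1
  · exact fun hl => (SL21.simpleDer_eq_psi8 hp hχ hl).1

end
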